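/- A ribbon-immersed surface is the image $F_r=f(F)\subset S^3$ of a smooth immersion $f$ of a compact smooth surface $F$ without closed components (not necessarily connected or orientable) that is an embedding except for finitely many ribbon singularities: around the $j$-th singularity there are smooth coordinates in a cubical ball $B_j=[-2,2]^3$ (the balls being pairwise disjoint) in which $F_r$ consists of the square $[-2,2]^2\times\{0\}$ and the strip $\{0\}\times[-1,1]\times[-2,2]$, which are the images of two disjoint pieces of $F$. The preimage of a ribbon singularity is an interior arc (in the square) and a properly embedded arc (in the strip). The cut surface $F_c$ is obtained from $F$ by removing a small neighbourhood of each properly embedded arc. The local disoriented chain $\ell_j$ is the sum of the segments from $(0,0,\pm2)$ to the origin and from the origin to $(\pm2,0,0)$ in $B_j$; a disoriented cycle is a singular 1-cycle $\sum_j n_j\ell_j+a'$ in $F_r$ with $n_j\in\mathbb Z$ and $a'$ a chain in $F_r\setminus\bigcup_j\operatorname{Int}B_j$; and $DH_1(F_r)\le H_1(F_r;\mathbb Z)$ is the subgroup of classes represented by disoriented cycles. A virtually-banded surface for $F_r$ is a ribbon-immersed surface $G_r$ obtained from $F_r$ by adding a finite collection $\mathcal V$ of pairwise disjoint embedded oriented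 1-handles (virtual bands), which meet $F_r$ only in their attaching arcs and are attached along arcs of $\partial F$ lying in the cut surface $F_c$, such that either $F_c$ is connected (in which case $\mathcal V$ may be empty), or the following conditions hold: (i) a virtual band is attached to each component of $F_c$ that is not a topological disk with two cuts on the boundary; (ii) a virtual band is attached to each component of $F_c$ that contains the interior arc of a ribbon singularity; (iii) the graph whose vertices are the components of $F_c$ to which virtual bands are attached, and whose edges are the virtual bands, is connected; (iv) a virtual band is attached to each connected component of $F$. For $V\in\mathcal V$ let $K_V$ be the boundary of an oriented embedded disk in $S^3$ that meets $G_r$ exactly in a cocore of $V$, with $K_V\cap G_r=\emptyset$ and with intersection number $+1$ with the core of $V$. Let $\mathcal{DC}_*(F_r,\mathcal V)$ be the chain complex with $\mathcal{DC}_1=DH_1(G_r)$, with $\mathcal{DC}_0$ the free abelian group on $\mathcal V$, with all other groups zero, and with boundary map $\partial_{\mathcal V}[a]=\sum_{V\in\mathcal V}\operatorname{lk}(a,K_V)\,V$. Proposition. Let $G_r$ be a virtually-banded surface for the ribbon-immersed surface $F_r$, with collection of virtual bands $\mathcal V$. Then: (1) the homology groups $H_n(\mathcal{DC}_*(F_r,\mathcal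 V))$ are, up to isomorphism, independent of all choices: for any other virtually-banded surface for $F_r$, with bands $\mathcal V'$ (and any other choices of coordinates, orientations and disks), $H_n(\mathcal{DC}_*(F_r,\mathcal V))\cong H_n(\mathcal{DC}_*(F_r,\mathcal V'))$ for all $n$; (2) the inclusion $F_r\hookrightarrow G_r$ induces a canonical isomorphism $DH_1(F_r)\cong H_1(\mathcal{DC}_*(F_r,\mathcal V))$: there is a unique isomorphism that sends each $x\in DH_1(F_r)$ to the homology class of the 1-cycle of $\mathcal{DC}_*(F_r,\mathcal V)$ given by the image of $x$ in $H_1(G_r;\mathbb Z)$. -/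

import Mathlib

namespace DisorientedHomology

noncomputable section

open CategoryTheory
open scoped Manifold ContDiff Simplicial

universe u v

/-! ### Singular chains, singular homology and winding numbers -/

/-- The singular simplicial set of a topological space. -/
abbrev sing (X : Type) [TopologicalSpace X] : SSet.{0} := TopCat.toSSet.obj (TopCat.of X)

/-- The singular chain complex of a topological space, with integer coefficients. -/
abbrev singularChains (X : Type) [TopologicalSpace X] : ChainComplex (AddCommGrpCat.{0}) ℕ :=
  (sing X).chainComplex (AddCommGrpCat.of ℤ)

/-- The first singular homology group `H₁(X; ℤ)`. -/
abbrev H1 (X : Type) [TopologicalSpace X] : AddCommGrpCat.{0} := (singularChains X).homology 1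

/-- The chain map induced by a continuous map. -/
abbrev chainMap {X Y : Type} [TopologicalSpace X] [TopologicalSpace Y] (f : C(X, Y)) :
    singularChains X ⟶ singularChains Y :=
  SSet.chainComplexMap (TopCat.toSSet.map (TopCat.ofHom f)) (AddCommGrpCat.of ℤ)

/-- The homomorphism `H₁(X; ℤ) → H₁(Y; ℤ)` induced by a continuous map. -/
abbrev H1map {X Y : Type} [TopologicalSpace X] [TopologicalSpace Y] (f : C(X, Y)) :
    H1 X →+ H1 Y :=
  (HomologicalComplex.homologyMap (chainMap f) 1).hom

/-- The inclusion of a subset in a larger one, as a continuous map. -/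
def incl {Z : Type} [TopologicalSpace Z] {A B : Set Z} (h : A ⊆ B) : C(A, B) :=
  ⟨Set.inclusion h, continuous_inclusion h⟩

/-- A continuous map from the standard `1`-simplex, as a singular `1`-chain. -/
def simplexChain {X : Type} [TopologicalSpace X] (σ : C(stdSimplex ℝ (Fin 2), X)) :
    (singularChains X).X 1 :=
  ((sing X).ιChainComplex (R := AddCommGrpCat.of ℤ) (n := 1)
    ((TopCat.toSSetObjEquiv (TopCat.of X) (.op ⦋1⦌)).symm σ)).hom (1 : ℤ)

instance locallyPathConnectedSpace_stdSimplex (n : ℕ) :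
    LocallyPathConnectedSpace (stdSimplex ℝ (Fin (n + 1))) := by
  refine LocallyPathConnectedSpace.of_bases (p := fun _ r => 0 < r)
    (s := fun x r => Metric.ball x r) (fun x => Metric.nhds_basis_ball) ?_
  intro x r hr
  have hc : Convex ℝ (Metric.ball (x : Fin (n + 1) → ℝ) r ∩ stdSimplex ℝ (Fin (n + 1))) :=
    (convex_ball _ _).inter (convex_stdSimplex ℝ _)
  have hp := hc.isPathConnected ⟨x, Metric.mem_ball_self hr, x.2⟩
  have : Metric.ball x r = (Subtype.val ⁻¹' Metric.ball (x : Fin (n + 1) → ℝ) r :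
      Set (stdSimplex ℝ (Fin (n + 1)))) := rfl
  rw [this, Topology.IsInducing.subtypeVal.isPathConnected_iff, Set.image_preimage_eq_inter_range,
    Subtype.range_coe]
  exact hp

/-- Every continuous map from a simplex to the circle `ℝ/ℤ` lifts to `ℝ`. -/
theorem exists_lift {n : ℕ} (f : C(stdSimplex ℝ (Fin (n + 1)), UnitAddCircle)) :
    ∃ L : C(stdSimplex ℝ (Fin (n + 1)), ℝ), ∀ p, (L p : UnitAddCircle) = f p := by
  have : ContractibleSpace (stdSimplex ℝ (Fin (n + 1))) :=
    (convex_stdSimplex ℝ _).contractibleSpace ⟨_, single_mem_stdSimplex ℝ 0⟩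
  have a₀ : stdSimplex ℝ (Fin (n + 1)) := ⟨_, single_mem_stdSimplex ℝ 0⟩
  obtain ⟨e₀, he⟩ := QuotientAddGroup.mk_surjective (f a₀)
  obtain ⟨L, ⟨-, hL⟩, -⟩ :=
    (AddCircle.isCoveringMap_coe (1 : ℝ)).existsUnique_continuousMap_lifts f a₀ e₀ he
  exact ⟨L, fun p => congrFun hL p⟩

open stdSimplex (vertex)

/-- The total change of the angle along a path in `ℝ/ℤ` (parametrized by the `1`-simplex):
`L(v₁) - L(v₀)` for a continuous lift `L` to `ℝ`. -/
def increment (f : C(stdSimplex ℝ (Fin 2), UnitAddCircle)) : ℝ :=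
  (exists_lift f).choose (vertex 1) - (exists_lift f).choose (vertex 0)

theorem increment_eq {f : C(stdSimplex ℝ (Fin 2), UnitAddCircle)} (L : C(stdSimplex ℝ (Fin 2), ℝ))
    (hL : ∀ p, (L p : UnitAddCircle) = f p) : increment f = L (vertex 1) - L (vertex 0) := by
  set M := (exists_lift f).choose with hM
  have hM' : ∀ p, (M p : UnitAddCircle) = f p := (exists_lift f).choose_spec
  have hint : ∀ p, ∃ m : ℤ, M p - L p = m := by
    intro p
    have : ((M p - L p : ℝ) : UnitAddCircle) = 0 := by
      rw [AddCircle.coe_sub, hM', hL, sub_self]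
    obtain ⟨m, hm⟩ := (AddCircle.coe_eq_zero_iff (1 : ℝ)).1 this
    exact ⟨m, by simpa using hm.symm⟩
  have hconst : M (vertex 1) - L (vertex 1) = M (vertex 0) - L (vertex 0) := by
    have hpre : _root_.IsPreconnected (Set.range fun p => M p - L p) :=
      isPreconnected_range (M.continuous.sub L.continuous)
    by_contra hne
    obtain ⟨a, ha⟩ := hint (vertex 0)
    obtain ⟨b, hb⟩ := hint (vertex 1)
    have key : ∀ x y : stdSimplex ℝ (Fin 2), ∀ a b : ℤ, M x - L x = a → M y - L y = b →
        ¬ a < b := by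
      intro x y a b hx hy hab
      have hab' : (a : ℝ) + 1 ≤ b := by exact_mod_cast hab
      have hmem : (a : ℝ) + 1 / 2 ∈ Set.range fun p => M p - L p :=
        hpre.ordConnected.out ⟨x, rfl⟩ ⟨y, rfl⟩ ⟨by simp only [hx]; linarith,
          by simp only [hy]; linarith⟩
      obtain ⟨p, hp⟩ := hmem
      obtain ⟨m, hm⟩ := hint p
      simp only [hm] at hp
      have h2 : (2 * m : ℤ) = 2 * a + 1 := by
        have : (2 * m : ℝ) = 2 * a + 1 := by linarith
        exact_mod_cast this
      omega
    rcases lt_trichotomy a b with h | h | h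
    · exact key _ _ a b ha hb h
    · exact hne (by rw [ha, hb, h])
    · exact key _ _ b a hb ha h
  simp only [increment, ← hM]
  linarith

/-- A singular simplex of `X`, as a continuous map. -/
abbrev simplexMap {X : Type} [TopologicalSpace X] {n : ℕ}
    (x : (sing X) _⦋n⦌) : C(stdSimplex ℝ (Fin (n + 1)), X) :=
  TopCat.toSSetObjEquiv (TopCat.of X) (.op ⦋n⦌) x

theorem simplexMap_δ {X : Type} [TopologicalSpace X] {n : ℕ}
    (x : (sing X) _⦋n + 1⦌) (i : Fin (n + 2))
    (p : stdSimplex ℝ (Fin (n + 1))) :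
    simplexMap ((sing X).δ i x) p =
      simplexMap x (stdSimplex.map i.succAbove p) := rfl

/-- The homomorphism from singular `1`-chains to `ℝ` that sends a singular `1`-simplex `σ` to the
total change of `θ` along `σ`. -/
def windingChain {X : Type} [TopologicalSpace X] (θ : C(X, UnitAddCircle)) :
    (singularChains X).X 1 ⟶ AddCommGrpCat.of ℝ :=
  Limits.Sigma.desc fun x : (sing X) _⦋1⦌ =>
    AddCommGrpCat.ofHom (zmultiplesHom ℝ (increment (θ.comp (simplexMap x))))

theorem ι_windingChain {X : Type} [TopologicalSpace X] (θ : C(X, UnitAddCircle))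
    (x : (sing X) _⦋1⦌) :
    (sing X).ιChainComplex (R := AddCommGrpCat.of ℤ) x ≫ windingChain θ =
      AddCommGrpCat.ofHom (zmultiplesHom ℝ (increment (θ.comp (simplexMap x)))) :=
  Limits.Sigma.ι_desc _ _

theorem d_windingChain {X : Type} [TopologicalSpace X] (θ : C(X, UnitAddCircle)) :
    (singularChains X).d 2 1 ≫ windingChain θ = 0 := by
  refine SSet.chainComplex_hom_ext fun x => ?_
  obtain ⟨L, hL⟩ := exists_lift (θ.comp (simplexMap x))
  have h : ∀ i : Fin 3, increment (θ.comp (simplexMap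
      ((sing X).δ i x))) =
      L (vertex (i.succAbove 1)) - L (vertex (i.succAbove 0)) := by
    intro i
    rw [increment_eq (L.comp ⟨_, stdSimplex.continuous_map i.succAbove⟩) (fun p => hL _)]
    simp
  have := (sing X).ιChainComplex_d_assoc (R := AddCommGrpCat.of ℤ) x (windingChain θ)
  refine this.trans ?_
  rw [Preadditive.sum_comp]
  simp only [Preadditive.zsmul_comp, ι_windingChain, h]
  ext
  simp [Fin.sum_univ_three, Fin.succAbove]

/-- The winding homomorphism on homology, with real values. -/
def windingReal {X : Type} [TopologicalSpace X] (θ : C(X, UnitAddCircle)) : H1 X ⟶ AddCommGrpCat.of ℝ :=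
  (singularChains X).homologyι 1 ≫
    (singularChains X).descOpcycles (windingChain θ) 2 (by simp) (d_windingChain θ)

theorem windingReal_π {X : Type} [TopologicalSpace X] (θ : C(X, UnitAddCircle)) :
    (singularChains X).homologyπ 1 ≫ windingReal θ =
      (singularChains X).iCycles 1 ≫ windingChain θ := by
  simp [windingReal]

/-- The value of the angle at the singular `0`-simplices. -/
def angleZero {X : Type} [TopologicalSpace X] (θ : C(X, UnitAddCircle)) :
    (singularChains X).X 0 ⟶ AddCommGrpCat.of UnitAddCircle :=
  Limits.Sigma.desc fun x : (sing X) _⦋0⦌ =>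
    AddCommGrpCat.ofHom (zmultiplesHom UnitAddCircle (θ (simplexMap x (vertex 0))))

theorem windingChain_mod {X : Type} [TopologicalSpace X] (θ : C(X, UnitAddCircle)) :
    windingChain θ ≫ AddCommGrpCat.ofHom
      (QuotientAddGroup.mk' (AddSubgroup.zmultiples (1 : ℝ))) =
      (singularChains X).d 1 0 ≫ angleZero θ := by
  refine SSet.chainComplex_hom_ext fun x => ?_
  obtain ⟨L, hL⟩ := exists_lift (θ.comp (simplexMap x))
  have h : ∀ i : Fin 2, (sing X).ιChainComplex (R := AddCommGrpCat.of ℤ) ((sing X).δ i x) ≫ angleZero θ =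
      AddCommGrpCat.ofHom (zmultiplesHom UnitAddCircle
        ((L (vertex (i.succAbove 0)) : ℝ) : UnitAddCircle)) := by
    intro i
    refine (Limits.Sigma.ι_desc _ _).trans ?_
    rw [hL, simplexMap_δ, stdSimplex.map_vertex]
  have := (sing X).ιChainComplex_d_assoc (R := AddCommGrpCat.of ℤ) x (angleZero θ)
  refine Eq.trans ?_ this.symm
  rw [Preadditive.sum_comp]
  simp only [Preadditive.zsmul_comp, h]
  rw [← Category.assoc, ι_windingChain, increment_eq L hL]
  ext
  simp [Fin.sum_univ_two, Fin.succAbove, sub_eq_add_neg]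

theorem windingReal_int {X : Type} [TopologicalSpace X] (θ : C(X, UnitAddCircle)) (x : H1 X) :
    ∃ m : ℤ, (windingReal θ).hom x = (m : ℝ) := by
  have hs : Function.Surjective ((singularChains X).homologyπ 1).hom :=
    (AddCommGrpCat.epi_iff_surjective _).1 inferInstance
  obtain ⟨z, rfl⟩ := hs x
  have h1 := congrArg (fun f => f.hom z) (windingReal_π θ)
  have h2 := congrArg (fun f => f.hom (((singularChains X).iCycles 1).hom z)) (windingChain_mod θ)
  have h3 := congrArg (fun f => f.hom z) ((singularChains X).iCycles_d 1 0)
  simp only [AddCommGrpCat.hom_comp, AddMonoidHom.comp_apply] at h1 h2 h3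
  rw [h3] at h2
  rw [h1]
  simp at h2
  obtain ⟨m, hm⟩ := AddSubgroup.mem_zmultiples_iff.1 h2
  exact ⟨m, by rw [← hm]; simp⟩

/-- The winding number of a class in `H₁(X; ℤ)` under a continuous map `θ : X → ℝ/ℤ`, i.e. the
degree of its image in `H₁(ℝ/ℤ; ℤ) = ℤ`: for a cycle `∑ nᵢσᵢ` it is the sum of `nᵢ` times the total
change of `θ` along `σᵢ`. -/
def windingNumberFun {X : Type} [TopologicalSpace X] (θ : C(X, UnitAddCircle)) (x : H1 X) : ℤ :=
  (windingReal_int θ x).choose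

theorem windingNumberFun_spec {X : Type} [TopologicalSpace X] (θ : C(X, UnitAddCircle))
    (x : H1 X) : (windingReal θ).hom x = (windingNumberFun θ x : ℝ) :=
  (windingReal_int θ x).choose_spec

/-- The winding number as a homomorphism `H₁(X; ℤ) → ℤ`. -/
def windingNumber {X : Type} [TopologicalSpace X] (θ : C(X, UnitAddCircle)) : H1 X →+ ℤ where
  toFun := windingNumberFun θ
  map_zero' := by
    have h := windingNumberFun_spec θ 0
    rw [map_zero] at h
    exact Int.cast_injective (α := ℝ) (h.symm.trans Int.cast_zero.symm)
  map_add' x y := by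
    have h := windingNumberFun_spec θ (x + y)
    rw [map_add, windingNumberFun_spec, windingNumberFun_spec] at h
    exact Int.cast_injective (α := ℝ) (by push_cast; exact h.symm)

theorem windingNumber_homologyπ {X : Type} [TopologicalSpace X] (θ : C(X, UnitAddCircle))
    (z : (singularChains X).cycles 1) :
    (windingNumber θ (((singularChains X).homologyπ 1).hom z) : ℝ) =
      (windingChain θ).hom (((singularChains X).iCycles 1).hom z) := by
  have h1 := congrArg (fun f => f.hom z) (windingReal_π θ)
  exact (windingNumberFun_spec θ _).symm.trans h1

/-! ### Ribbon-immersed surfaces in the 3-sphere -/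

/-- The `3`-sphere, with its standard smooth structure. -/
abbrev S3 : Type := Metric.sphere (0 : EuclideanSpace ℝ (Fin 4)) 1

/-- Euclidean `3`-space, with coordinates `x = p 0`, `y = p 1`, `z = p 2`. -/
abbrev E3 : Type := EuclideanSpace ℝ (Fin 3)

/-- The cube `[-2,2]³`. -/
def cube : Set E3 := {p | ∀ i, |p i| ≤ 2}

/-- The interior of the cube `[-2,2]³`. -/
def openCube : Set E3 := {p | ∀ i, |p i| < 2}

/-- The horizontal square `[-2,2] × [-2,2] × {0}`. -/
def squareModel : Set E3 := {p | |p 0| ≤ 2 ∧ |p 1| ≤ 2 ∧ p 2 = 0}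

/-- The vertical strip `{0} × [-1,1] × [-2,2]`. -/
def stripModel : Set E3 := {p | p 0 = 0 ∧ |p 1| ≤ 1 ∧ |p 2| ≤ 2}

/-- The ribbon singularity `{0} × [-1,1] × {0}`, where the square and the strip meet. -/
def arcModel : Set E3 := {p | p 0 = 0 ∧ |p 1| ≤ 1 ∧ p 2 = 0}

/-- Numbered ribbon singularities of a map `f : F → S³`, with smooth coordinates in disjoint cubical
balls `B_j ⊆ S³` around them. The preimage of `B_j` has two disjoint pieces, mapped bijectively to
the horizontal square and to the vertical strip, and `f` is injective away from these balls. -/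
structure RibbonCoordinates {F : Type*} [TopologicalSpace F] (f : F → S3) where
  /-- The number of ribbon singularities. -/
  num : ℕ
  /-- The smooth coordinate chart of `S³` around the `j`-th ribbon singularity. -/
  chart : Fin num → OpenPartialHomeomorph S3 E3
  chart_mem : ∀ j, chart j ∈ IsManifold.maximalAtlas (𝓡 3) ∞ S3
  cube_subset : ∀ j, cube ⊆ (chart j).target
  disjoint_ball : ∀ i j, i ≠ j → Disjoint ((chart i).symm '' cube) ((chart j).symm '' cube)
  /-- The part of `F` that is mapped to the horizontal square in `B_j`. -/
  square : Fin num → Set F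
  /-- The part of `F` that is mapped to the vertical strip in `B_j`. -/
  strip : Fin num → Set F
  isClosed_square : ∀ j, IsClosed (square j)
  isClosed_strip : ∀ j, IsClosed (strip j)
  disjoint_square_strip : ∀ j, Disjoint (square j) (strip j)
  preimage_ball : ∀ j, f ⁻¹' ((chart j).symm '' cube) = square j ∪ strip j
  bijOn_square : ∀ j, Set.BijOn f (square j) ((chart j).symm '' squareModel)
  bijOn_strip : ∀ j, Set.BijOn f (strip j) ((chart j).symm '' stripModel)
  double_points : ∀ x y, f x = f y → x ≠ y → ∃ j, f x ∈ (chart j).symm '' cube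

/-- A ribbon-immersed surface: a smooth immersion in `S³` of a compact smooth surface without closed
components, which is an embedding except for finitely many ribbon singularities. -/
structure RibbonSurface where
  /-- The underlying (abstract) surface `F`. -/
  carrier : Type*
  [topologicalSpace : TopologicalSpace carrier]
  [t2Space : T2Space carrier]
  [compactSpace : CompactSpace carrier]
  [chartedSpace : ChartedSpace (EuclideanHalfSpace 2) carrier]
  [isManifold : IsManifold (𝓡∂ 2) ∞ carrier]
  /-- The immersion. -/
  toFun : carrier → S3
  smooth : ContMDiff (𝓡∂ 2) (𝓡 3) ∞ toFun
  immersion : ∀ x, Function.Injective (mfderiv (𝓡∂ 2) (𝓡 3) toFun x)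
  no_closed_component : ∀ x, (connectedComponent x ∩ (𝓡∂ 2).boundary carrier).Nonempty
  ribbon : Nonempty (RibbonCoordinates toFun)

attribute [instance] RibbonSurface.topologicalSpace RibbonSurface.t2Space
  RibbonSurface.compactSpace RibbonSurface.chartedSpace RibbonSurface.isManifold

/-- The image `F_r ⊆ S³` of the immersion. -/
abbrev RibbonSurface.image (F : RibbonSurface) : Set S3 := Set.range F.toFun

namespace RibbonCoordinates

variable {F : Type*} [TopologicalSpace F] {f : F → S3} (κ : RibbonCoordinates f)

/-- The interior of the ball `B_j`. -/
def openBall (j : Fin κ.num) : Set S3 := (κ.chart j).symm '' openCube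

/-- The interior arc in the preimage of the `j`-th ribbon singularity. -/
def interiorArc (j : Fin κ.num) : Set F :=
  {x | x ∈ κ.square j ∧ f x ∈ (κ.chart j).symm '' arcModel}

/-- The cut surface `F_c`: the result of removing from `F`, for every ribbon singularity, the
neighbourhood `|z| < r` of the properly embedded arc `z = 0` of the vertical strip. -/
def cutSurface (r : ℝ) : Set F :=
  {x | ∀ j, x ∈ κ.strip j → r ≤ |κ.chart j (f x) 2|}

/-- The cuts on the boundary of the cut surface: the arcs `z = r` and `z = -r` of each strip. -/
def cut (r : ℝ) (c : Fin κ.num × Bool) : Set F :=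
  {x | x ∈ κ.strip c.1 ∧ κ.chart c.1 (f x) 2 = if c.2 then r else -r}

/-- `C` is a connected component of the cut surface. -/
def IsCutComponent (r : ℝ) (C : Set F) : Prop :=
  ∃ x ∈ κ.cutSurface r, C = connectedComponentIn (κ.cutSurface r) x

/-- `C` is a topological disk with (exactly) two cuts on the boundary. -/
def IsDiskWithTwoCuts (r : ℝ) (C : Set F) : Prop :=
  Nonempty (C ≃ₜ Metric.closedBall (0 : EuclideanSpace ℝ (Fin 2)) 1) ∧
    {c | κ.cut r c ⊆ C}.ncard = 2

/-! ### Disoriented cycles and the first disoriented homology group -/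

/-- The part of `F_r` outside the interiors of the balls `B_j`. -/
def outside : Set S3 := Set.range f \ ⋃ j, κ.openBall j

theorem outside_subset : κ.outside ⊆ Set.range f := Set.sdiff_subset

theorem model_mem_range (j : Fin κ.num) {p : E3} (hp : p ∈ squareModel ∪ stripModel) :
    (κ.chart j).symm p ∈ Set.range f := by
  rcases hp with hp | hp
  · obtain ⟨x, -, hx⟩ := (κ.bijOn_square j).surjOn ⟨p, hp, rfl⟩
    exact ⟨x, hx⟩
  · obtain ⟨x, -, hx⟩ := (κ.bijOn_strip j).surjOn ⟨p, hp, rfl⟩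
    exact ⟨x, hx⟩

theorem model_subset_cube : squareModel ∪ stripModel ⊆ cube := by
  rintro p (⟨h0, h1, h2⟩ | ⟨h0, h1, h2⟩) i <;> fin_cases i <;> (simp_all; try linarith)

/-- The straight segment from `p` to `q` in the coordinates of `B_j`, as a singular simplex
of `F_r`. -/
def segmentSimplex (j : Fin κ.num) (p q : E3)
    (h : segment ℝ p q ⊆ squareModel ∪ stripModel) :
    C(stdSimplex ℝ (Fin 2), Set.range f) where
  toFun s := ⟨(κ.chart j).symm (s 0 • p + s 1 • q), κ.model_mem_range j
    (h ⟨s 0, s 1, s.2.1 0, s.2.1 1, stdSimplex.add_eq_one s, rfl⟩)⟩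
  continuous_toFun := by
    refine Continuous.subtype_mk ?_ _
    refine (κ.chart j).continuousOn_symm.comp_continuous ?_ fun s => κ.cube_subset j
      (model_subset_cube (h ⟨s 0, s 1, s.2.1 0, s.2.1 1, stdSimplex.add_eq_one s, rfl⟩))
    have hc : ∀ i, Continuous fun s : stdSimplex ℝ (Fin 2) => s i :=
      fun i => (continuous_apply i).comp continuous_subtype_val
    exact ((hc 0).smul continuous_const).add ((hc 1).smul continuous_const)

theorem vertical_subset (a : ℝ) (ha : |a| ≤ 2) :
    segment ℝ (!₂[0, 0, a] : E3) 0 ⊆ squareModel ∪ stripModel := by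
  rintro _ ⟨s, t, hs, ht, hst, rfl⟩
  right
  refine ⟨by simp, by simp, ?_⟩
  have hs1 : s ≤ 1 := by linarith
  simp [abs_mul, abs_of_nonneg hs]
  nlinarith [abs_nonneg a]

theorem horizontal_subset (a : ℝ) (ha : |a| ≤ 2) :
    segment ℝ (0 : E3) !₂[a, 0, 0] ⊆ squareModel ∪ stripModel := by
  rintro _ ⟨s, t, hs, ht, hst, rfl⟩
  left
  have ht1 : t ≤ 1 := by linarith
  refine ⟨?_, by simp, by simp⟩
  simp [abs_mul, abs_of_nonneg ht]
  nlinarith [abs_nonneg a]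

/-- The local disoriented `1`-chain `ℓ_j`: two vertical segments from `(0,0,±2)` to the origin and
two horizontal segments from the origin to `(±2,0,0)`. -/
def localChain (j : Fin κ.num) : (singularChains (Set.range f)).X 1 :=
  simplexChain (κ.segmentSimplex j !₂[0, 0, 2] 0 (vertical_subset 2 (by norm_num))) +
  simplexChain (κ.segmentSimplex j !₂[0, 0, -2] 0 (vertical_subset (-2) (by norm_num))) +
  simplexChain (κ.segmentSimplex j 0 !₂[2, 0, 0] (horizontal_subset 2 (by norm_num))) +
  simplexChain (κ.segmentSimplex j 0 !₂[-2, 0, 0] (horizontal_subset (-2) (by norm_num)))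

/-- A disoriented cycle: a `1`-cycle of the form `∑ n_j ℓ_j + a'`, where `a'` is a chain in the
complement of the interiors of the balls `B_j`. -/
def IsDisorientedCycle (z : (singularChains (Set.range f)).cycles 1) : Prop :=
  ∃ (n : Fin κ.num → ℤ) (a' : (singularChains κ.outside).X 1),
    ((singularChains (Set.range f)).iCycles 1).hom z =
      ∑ j, n j • κ.localChain j + ((chainMap (incl κ.outside_subset)).f 1).hom a'

/-- The first disoriented homology group `DH₁(F_r)`: the subgroup of `H₁(F_r; ℤ)` of the classes
that are represented by disoriented cycles. -/
def DH1 : AddSubgroup (H1 (Set.range f)) where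
  carrier := {x | ∃ z, κ.IsDisorientedCycle z ∧
    ((singularChains (Set.range f)).homologyπ 1).hom z = x}
  zero_mem' := ⟨0, ⟨0, 0, by simp⟩, by simp⟩
  add_mem' := by
    rintro _ _ ⟨z, ⟨n, a, h⟩, rfl⟩ ⟨z', ⟨n', a', h'⟩, rfl⟩
    refine ⟨z + z', ⟨n + n', a + a', ?_⟩, map_add _ _ _⟩
    rw [map_add, h, h', map_add]
    simp only [Pi.add_apply, add_smul, Finset.sum_add_distrib]
    abel
  neg_mem' := by
    rintro _ ⟨z, ⟨n, a, h⟩, rfl⟩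
    refine ⟨-z, ⟨-n, -a, ?_⟩, map_neg _ _⟩
    rw [map_neg, h, map_neg]
    simp only [Pi.neg_apply, neg_smul, Finset.sum_neg_distrib]
    abel

end RibbonCoordinates

/-! ### Oriented disks in the 3-sphere and linking numbers with their boundaries -/

/-- A smoothly embedded oriented closed disk in `S³`, presented as the unit disk of the `(x,y)`-plane
in a smooth coordinate chart that contains the closed unit ball. The orientation is the one for which
the positive side (with respect to the orientation of `S³`) is `z > 0`. -/
structure Disk where
  /-- The coordinate chart. -/
  chart : OpenPartialHomeomorph S3 E3
  chart_mem : chart ∈ IsManifold.maximalAtlas (𝓡 3) ∞ S3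
  ball_subset : Metric.closedBall 0 1 ⊆ chart.target

namespace Disk

variable (D : Disk)

/-- The points of the disk. -/
def points : Set S3 := D.chart.symm '' {p | p ∈ Metric.closedBall 0 1 ∧ p 2 = 0}

/-- The boundary circle `K` of the disk. -/
def boundary : Set S3 := D.chart.symm '' {p | p ∈ Metric.sphere 0 1 ∧ p 2 = 0}

open Classical in
/-- The angle around `K` with values in `ℝ/ℤ`. On the unit ball of the chart it is `(1 + u) / 2` with
`u = z / √(1 - x² - y²)`, which increases from `0` on the lower hemisphere to `1/2` on the disk and to
`1` on the upper hemisphere; outside of this ball it is constantly `0`. -/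
def angleFun (q : S3) : UnitAddCircle :=
  if q ∈ D.chart.symm '' Metric.closedBall 0 1 then
    (((1 + D.chart q 2 / √(1 - D.chart q 0 ^ 2 - D.chart q 1 ^ 2)) / 2 : ℝ) : UnitAddCircle)
  else 0

theorem norm_sq_E3 (p : E3) : ‖p‖ ^ 2 = p 0 ^ 2 + p 1 ^ 2 + p 2 ^ 2 := by
  rw [EuclideanSpace.real_norm_sq_eq, Fin.sum_univ_three]

theorem angleFun_eq_zero {q : S3} (hK : q ∉ D.boundary)
    (hq : q ∉ D.chart.symm '' Metric.ball 0 1) : D.angleFun q = 0 := by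
  unfold angleFun
  split_ifs with h
  · obtain ⟨p, hp, rfl⟩ := h
    rw [D.chart.right_inv (D.ball_subset hp)]
    have hp1 : ‖p‖ = 1 := by
      refine le_antisymm (by simpa using hp) (not_lt.1 fun hlt => hq ⟨p, by simpa using hlt, rfl⟩)
    have hp2 : p 2 ≠ 0 := fun h0 => hK ⟨p, ⟨by simpa using hp1, h0⟩, rfl⟩
    have hsq := norm_sq_E3 p
    rw [hp1] at hsq
    rw [show 1 - p 0 ^ 2 - p 1 ^ 2 = p 2 ^ 2 by linarith, Real.sqrt_sq_eq_abs]
    rcases lt_or_gt_of_ne hp2 with h0 | h0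
    · rw [abs_of_neg h0, div_neg, div_self hp2]
      simp
    · rw [abs_of_pos h0, div_self hp2]
      norm_num
  · rfl

theorem continuousOn_angleFun : ContinuousOn D.angleFun D.boundaryᶜ := by
  have hA : IsClosed (D.chart.symm '' Metric.closedBall 0 1) :=
    ((isCompact_closedBall (0 : E3) 1).image_of_continuousOn
      (D.chart.continuousOn_symm.mono D.ball_subset)).isClosed
  have hU : IsOpen (D.chart.symm '' Metric.ball 0 1) :=
    D.chart.symm.isOpen_image_of_subset_source Metric.isOpen_ball
      (Metric.ball_subset_closedBall.trans D.ball_subset)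
  have hcov : D.boundaryᶜ ⊆ (D.boundaryᶜ ∩ D.chart.symm '' Metric.closedBall 0 1) ∪
      (D.boundaryᶜ ∩ (D.chart.symm '' Metric.ball 0 1)ᶜ) := by
    intro q hq
    by_cases h : q ∈ D.chart.symm '' Metric.ball 0 1
    · exact Or.inl ⟨hq, Set.image_mono Metric.ball_subset_closedBall h⟩
    · exact Or.inr ⟨hq, h⟩
  have h1 : ContinuousOn D.angleFun
      (D.boundaryᶜ ∩ D.chart.symm '' Metric.closedBall 0 1) := by
    have hc : ContinuousOn D.chart (D.boundaryᶜ ∩ D.chart.symm '' Metric.closedBall 0 1) := by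
      refine D.chart.continuousOn.mono ?_
      rintro _ ⟨-, p, hp, rfl⟩
      exact D.chart.map_target (D.ball_subset hp)
    have hi : ∀ i, ContinuousOn (fun q => D.chart q i)
        (D.boundaryᶜ ∩ D.chart.symm '' Metric.closedBall 0 1) := fun i =>
      (EuclideanSpace.proj (𝕜 := ℝ) i).continuous.comp_continuousOn hc
    have hf : ContinuousOn (fun q => (((1 + D.chart q 2 /
        √(1 - D.chart q 0 ^ 2 - D.chart q 1 ^ 2)) / 2 : ℝ) : UnitAddCircle))
        (D.boundaryᶜ ∩ D.chart.symm '' Metric.closedBall 0 1) := by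
      refine (AddCircle.continuous_mk' (1 : ℝ)).comp_continuousOn ?_
      refine (continuousOn_const.add ((hi 2).div ?_ ?_)).div_const 2
      · exact ((continuousOn_const.sub ((hi 0).pow 2)).sub ((hi 1).pow 2)).sqrt
      · rintro _ ⟨hK, p, hp, rfl⟩
        rw [D.chart.right_inv (D.ball_subset hp)]
        have hsq := norm_sq_E3 p
        have hp1 : ‖p‖ ≤ 1 := by simpa using hp
        have hle : ‖p‖ ^ 2 ≤ 1 := by nlinarith [norm_nonneg p]
        refine (Real.sqrt_pos.2 ?_).ne'
        by_contra hneg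
        have h20 : p 2 = 0 := by nlinarith [sq_nonneg (p 2)]
        have hn : ‖p‖ ^ 2 = 1 := by nlinarith [sq_nonneg (p 2)]
        have : ‖p‖ = 1 := by nlinarith [norm_nonneg p]
        exact hK ⟨p, ⟨by simpa using this, h20⟩, rfl⟩
    refine hf.congr ?_
    rintro q ⟨-, hq⟩
    exact if_pos hq
  have h2 : ContinuousOn D.angleFun (D.boundaryᶜ ∩ (D.chart.symm '' Metric.ball 0 1)ᶜ) :=
    (continuousOn_const (c := (0 : UnitAddCircle))).congr fun q hq => D.angleFun_eq_zero hq.1 hq.2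
  intro q hq
  refine ContinuousWithinAt.mono (ContinuousWithinAt.union ?_ ?_) hcov
  · by_cases hqA : q ∈ D.chart.symm '' Metric.closedBall 0 1
    · exact h1 q ⟨hq, hqA⟩
    · refine continuousWithinAt_of_notMem_closure fun hcl => hqA ?_
      exact hA.closure_subset (closure_mono Set.inter_subset_right hcl)
  · by_cases hqU : q ∈ D.chart.symm '' Metric.ball 0 1
    · refine continuousWithinAt_of_notMem_closure fun hcl => ?_
      exact hU.isClosed_compl.closure_subset (closure_mono Set.inter_subset_right hcl) hqU
    · exact h2 q ⟨hq, hqU⟩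

/-- The angle around `K` as a continuous map `S³ ∖ K → ℝ/ℤ`. -/
def angle : C((D.boundaryᶜ : Set S3), UnitAddCircle) :=
  ⟨fun q => D.angleFun q, D.continuousOn_angleFun.domRestrict⟩

/-- The linking number with `K = ∂D`: for a `1`-cycle in `S³ ∖ K` it is the intersection number of the
cycle with `D`, i.e. the algebraic number of times the cycle passes through `D` to its positive side,
computed as the winding number of the angle around `K`. -/
def linkingNumber : H1 (D.boundaryᶜ : Set S3) →+ ℤ := windingNumber D.angle

end Disk

/-! ### Virtual bands and the disoriented chain complex -/

/-- A ribbon-immersed surface `G_r` obtained from the ribbon-immersed surface `F_r` by attaching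
embedded oriented `1`-handles `[0,1] × [0,1] → G`, called virtual bands. The attaching arcs of a band
are `{0} × [0,1]` and `{1} × [0,1]`, and its core is `s ↦ (s, 1/2)`, oriented from `s = 0` to
`s = 1`. -/
structure VirtualBands (F : RibbonSurface.{u}) (κ : RibbonCoordinates F.toFun) where
  /-- The ribbon-immersed surface `G_r`. -/
  G : RibbonSurface.{v}
  /-- Coordinates around the ribbon singularities of `G_r`. -/
  coords : RibbonCoordinates G.toFun
  /-- The inclusion of `F` as a subsurface of `G`. -/
  inclusion : C(F.carrier, G.carrier)
  inclusion_injective : Function.Injective inclusion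
  toFun_inclusion : ∀ x, G.toFun (inclusion x) = F.toFun x
  /-- The number of virtual bands. -/
  num : ℕ
  /-- The virtual bands. -/
  band : Fin num → C(unitInterval × unitInterval, G.carrier)
  cover : ∀ y, (∃ x, inclusion x = y) ∨ ∃ b p, band b p = y
  /-- The virtual bands are embedded in `S³` and pairwise disjoint. -/
  band_embedded : ∀ b p b' p', G.toFun (band b p) = G.toFun (band b' p') → b = b' ∧ p = p'
  /-- The virtual bands meet `F_r` only in their attaching arcs. -/
  band_inter : ∀ b p, G.toFun (band b p) ∈ F.image → p.1 = 0 ∨ p.1 = 1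
  /-- The (small) width of the neighbourhoods of the properly embedded arcs that are removed from `F`
  to form the cut surface. -/
  r : ℝ
  r_pos : 0 < r
  r_le : r ≤ 1
  /-- The attaching arcs lie on the boundary of `F`, and in the cut surface. -/
  band_attached : ∀ b p, p.1 = 0 ∨ p.1 = 1 →
    ∃ x ∈ (𝓡∂ 2).boundary F.carrier ∩ κ.cutSurface r, inclusion x = band b p

namespace VirtualBands

variable {F : RibbonSurface.{u}} {κ : RibbonCoordinates F.toFun} (W : VirtualBands.{u, v} F κ)

/-- The attaching arc `{e} × [0,1]` of a virtual band (for `e = 0` or `e = 1`), as a subset of `F`. -/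
def attachingArc (b : Fin W.num) (e : unitInterval) : Set F.carrier :=
  {x | ∃ t, W.inclusion x = W.band b (e, t)}

/-- The virtual band `b` is attached to `C ⊆ F` (at one of its two ends, at least). -/
def IsAttachedTo (b : Fin W.num) (C : Set F.carrier) : Prop :=
  W.attachingArc b 0 ⊆ C ∨ W.attachingArc b 1 ⊆ C

/-- The graph `Π(𝒱)`: its vertices are the components of the cut surface to which virtual bands are
attached, and two vertices are adjacent if they are joined by a virtual band. -/
def bandGraph :
    SimpleGraph {C : Set F.carrier // κ.IsCutComponent W.r C ∧ ∃ b, W.IsAttachedTo b C} :=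
  SimpleGraph.fromRel fun C C' => ∃ b, W.attachingArc b 0 ⊆ C.1 ∧ W.attachingArc b 1 ⊆ C'.1

/-- The conditions on the collection of virtual bands: either the cut surface is connected, or
- a virtual band is attached to each component of the cut surface that is not a disk with two cuts;
- a virtual band is attached to each component of the cut surface that contains the interior arc of a
  ribbon singularity;
- the graph `Π(𝒱)` is connected;
- a virtual band is attached to each connected component of `F`. -/
def IsAdmissible : Prop :=
  _root_.IsPreconnected (κ.cutSurface W.r) ∨
    ((∀ C, κ.IsCutComponent W.r C → ¬ κ.IsDiskWithTwoCuts W.r C → ∃ b, W.IsAttachedTo b C) ∧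
      (∀ C, κ.IsCutComponent W.r C → (∃ j, κ.interiorArc j ⊆ C) → ∃ b, W.IsAttachedTo b C) ∧
      W.bandGraph.Preconnected ∧
      ∀ x : F.carrier, ∃ b, W.IsAttachedTo b (connectedComponent x))

/-- The point `1/2` of the unit interval. -/
def half : unitInterval := ⟨1 / 2, by norm_num, by norm_num⟩

/-- The image in `S³` of the cocore `{1/2} × [0,1]` of a virtual band. -/
def cocore (b : Fin W.num) : Set S3 := {q | ∃ t, q = W.G.toFun (W.band b (half, t))}

/-- The disk `D` meets `G_r` in the cocore of the virtual band `b`, its boundary is disjoint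
from `G_r`, and its intersection number with the core of `b` is `+1`: the core crosses `D` from the
negative to the positive side. -/
structure IsCocoreDisk (b : Fin W.num) (D : Disk) : Prop where
  inter_eq : D.points ∩ W.G.image = W.cocore b
  image_subset : W.G.image ⊆ D.boundaryᶜ
  crosses : ∀ᶠ s in nhds half,
    (s < half → D.chart (W.G.toFun (W.band b (s, half))) 2 < 0) ∧
    (half < s → 0 < D.chart (W.G.toFun (W.band b (s, half))) 2)

end VirtualBands

/-- A virtually-banded surface `G_r` associated to the ribbon-immersed surface `F_r`: an admissible
collection `𝒱` of virtual bands, together with an oriented disk for each `V ∈ 𝒱`, with boundary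
`K_V`, that meets `G_r` in a cocore of `V`. -/
structure VirtuallyBandedSurface (F : RibbonSurface.{u}) (κ : RibbonCoordinates F.toFun) extends
    VirtualBands.{u, v} F κ where
  admissible : toVirtualBands.IsAdmissible
  /-- The disk with boundary `K_V`. -/
  disk : Fin num → Disk
  isCocoreDisk : ∀ b, toVirtualBands.IsCocoreDisk b (disk b)

namespace VirtuallyBandedSurface

variable {F : RibbonSurface.{u}} {κ : RibbonCoordinates F.toFun}
  (W : VirtuallyBandedSurface.{u, v} F κ)

theorem image_subset : F.image ⊆ W.G.image := by
  rintro _ ⟨x, rfl⟩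
  exact ⟨W.inclusion x, W.toFun_inclusion x⟩

/-- The homomorphism `H₁(F_r; ℤ) → H₁(G_r; ℤ)` induced by inclusion. -/
def inclusionMap : H1 F.image →+ H1 W.G.image := H1map (incl W.image_subset)

/-- The boundary homomorphism `∂_𝒱 : DH₁(G_r) → ℤ[𝒱]`, `[a] ↦ ∑_V lk(a, K_V) V`. -/
def boundaryMap : W.coords.DH1 →+ (Fin W.num →₀ ℤ) :=
  ∑ b, (Finsupp.singleAddHom b).comp ((W.disk b).linkingNumber.comp
    ((H1map (incl (W.isCocoreDisk b).image_subset)).comp W.coords.DH1.subtype))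

/-- The chain complex `𝒟𝒞_*(F_r, 𝒱)`, with `𝒟𝒞₁ = DH₁(G_r)`, with `𝒟𝒞₀` the free abelian group
on `𝒱`, and with trivial groups in all other degrees. -/
def complex : ChainComplex AddCommGrpCat.{0} ℕ where
  X
    | 0 => AddCommGrpCat.of (Fin W.num →₀ ℤ)
    | 1 => AddCommGrpCat.of W.coords.DH1
    | _ + 2 => AddCommGrpCat.of PUnit
  d
    | 1, 0 => AddCommGrpCat.ofHom W.boundaryMap
    | 0, _ => 0
    | 1, _ + 1 => 0
    | _ + 2, _ => 0
  shape i j h := by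
    match i, j with
    | 1, 0 => exact absurd rfl h
    | 0, _ => rfl
    | 1, _ + 1 => rfl
    | _ + 2, _ => rfl
  d_comp_d' i j k _ _ := by
    match i, j, k with
    | 0, _, _ => exact Limits.zero_comp
    | 1, _ + 1, _ => exact Limits.zero_comp
    | 1, 0, 0 => exact Limits.comp_zero
    | 1, 0, _ + 1 => exact Limits.comp_zero
    | _ + 2, _, _ => exact Limits.zero_comp

/-- A cycle of degree `1` in `𝒟𝒞_*(F_r, 𝒱)`, as a class in `H₁(G_r; ℤ)`. -/
def cycleClass (z : W.complex.cycles 1) : H1 W.G.image :=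
  W.coords.DH1.subtype ((W.complex.iCycles 1).hom z)

end VirtuallyBandedSurface

end

end DisorientedHomology

open DisorientedHomology

namespace DisorientedHomology

noncomputable section

open CategoryTheory
open scoped Manifold ContDiff Simplicial unitInterval
open stdSimplex (vertex)

universe u v w

/-! ### Elementwise homology of complexes of abelian groups -/

/-! The proof replaces disoriented cycles by a numerical condition. On the ball `B_j` the function
`z / 2 - sign z`, extended by zero, is continuous modulo `ℤ` on `F_r`: it vanishes on the square and
at both ends `z = ±2` of the strip. The sum of its jumps along a chain is a homomorphism `flux j`
that kills boundaries. It is `1` and `-1` on the rays from the centre to the two ends of the strip,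
and `0` on rays in the square and on chains outside the balls. A cycle is homologous to a
combination of such rays plus a chain outside the balls. The coefficient of the centre in its zero
boundary, together with the vanishing of the flux, forces the rays to combine into multiples of
`ℓ_j`. Hence a class lies in `DH₁` exactly when all its fluxes vanish
(`RibbonCoordinates.mem_DH1_iff`).

The flux depends on the coordinates only up to sign, and it is compatible with the inclusion of
`F_r` in `G_r` (`Compatible.flux_push1`). The topological point is that a properly embedded arc
cannot turn into an interior arc: the former separates its strip, whereas a neighbourhood of the
latter stays connected when the arc is removed. So `DH₁` does not depend on the coordinates, and a
class of `F_r` is disoriented in `F_r` if and only if it is so in `G_r`.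

The linking number with `K_V` is the winding number of an angle that runs once around the circle
along the band and is constant elsewhere, because both angles take the value `1/2` exactly on the
cocore and cross it in the same direction (`IsCocoreDisk.linkingNumber_eq`). Every cycle of `G_r` is
homologous to a chain in `F_r` plus multiples of the cores of the bands, and the multiplicities are
these winding numbers (`exists_decomposition`, `windingChain_coreComb`).

Degree one: a class in the kernel of the boundary map therefore comes from `H₁(F_r)`, and from
`DH₁(F_r)` by the flux criterion. The map from `H₁(F_r)` to `H₁(G_r)` is injective because each path
component of `F_r` receives a map from `G_r` that is the identity on that component and constant on
the others. This gives (2), and (1) in degree one.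

Degree zero: send a band to the difference of the end points of its core. A combination of bands is
in the image of the boundary map if and only if the resulting `0`-chain bounds a chain of `F_r` with
zero flux, that is, if it is a flat boundary (`mem_range_boundaryMap_iff`). So the cokernel embeds
in the group of differences of points of `F_r` modulo flat boundaries, which does not involve the
bands. Admissibility makes the embedding surjective. Paths off the properly embedded arcs have zero
flux, so all points of a component of the cut surface are equivalent, and connectedness of the band
graph links the components that carry bands. For points `x`, `y` on the two sides of a point `p` of
a properly embedded arc, `(x - p) + (y - p)` is a flat boundary. As `p` is also the image of a point
of an interior arc, it is already equivalent to the bands, so `x` is equivalent to the bands exactly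
when `y` is. This propagates over each component of `F`, and each of these carries a band. -/

theorem exists_cycle (K : ChainComplex AddCommGrpCat.{0} ℕ) {i j : ℕ}
    (hij : (ComplexShape.down ℕ).next i = j)
    (c : K.X i) (hc : (K.d i j).hom c = 0) : ∃ z : K.cycles i, (K.iCycles i).hom z = c := by
  let k : AddCommGrpCat.of ℤ ⟶ K.X i := AddCommGrpCat.ofHom (zmultiplesHom _ c)
  have hk : k ≫ K.d i j = 0 := by
    ext
    simpa [k] using hc
  refine ⟨(K.liftCycles k j hij hk).hom (1 : ℤ), ?_⟩
  have := congrArg (fun f => f.hom (1 : ℤ)) (K.liftCycles_i k j hij hk)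
  exact this.trans (one_zsmul c)

theorem homologyπ_eq_zero_iff (K : ChainComplex AddCommGrpCat.{0} ℕ) {i j : ℕ}
    (hij : (ComplexShape.down ℕ).prev i = j) (z : K.cycles i) :
    (K.homologyπ i).hom z = 0 ↔ ∃ y, (K.d j i).hom y = (K.iCycles i).hom z := by
  have hex := ShortComplex.exact_of_g_is_cokernel
    (ShortComplex.mk (K.toCycles j i) (K.homologyπ i) (by simp)) (K.homologyIsCokernel j i hij)
  rw [ShortComplex.ab_exact_iff] at hex
  have hinj : Function.Injective (K.iCycles i).hom := (AddCommGrpCat.mono_iff_injective _).1 inferInstance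
  constructor
  · intro h
    obtain ⟨y, hy⟩ := hex z h
    refine ⟨y, ?_⟩
    rw [← hy, ← K.toCycles_i j i]
    rfl
  · rintro ⟨y, hy⟩
    have : z = (K.toCycles j i).hom y := by
      apply hinj
      rw [← hy, ← K.toCycles_i j i]
      rfl
    rw [this]
    exact congrArg (fun f => f.hom y) (K.toCycles_comp_homologyπ j i)

theorem iCycles_injective (K : ChainComplex AddCommGrpCat.{0} ℕ) (i : ℕ) :
    Function.Injective (K.iCycles i).hom := (AddCommGrpCat.mono_iff_injective _).1 inferInstance

theorem homologyπ_surjective (K : ChainComplex AddCommGrpCat.{0} ℕ) (i : ℕ) :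
    Function.Surjective (K.homologyπ i).hom := (AddCommGrpCat.epi_iff_surjective _).1 inferInstance

/-! ### Singular chains in degrees at most one -/

section Chains

variable {X Y : Type} [TopologicalSpace X] [TopologicalSpace Y]

/-- Singular `1`-chains. -/
abbrev C1 (X : Type) [TopologicalSpace X] : Type := (singularChains X).X 1

/-- Singular `0`-chains. -/
abbrev C0 (X : Type) [TopologicalSpace X] : Type := (singularChains X).X 0

/-- The boundary homomorphism on `1`-chains. -/
abbrev bd (X : Type) [TopologicalSpace X] : C1 X →+ C0 X := ((singularChains X).d 1 0).hom

/-- The boundaries of `2`-chains. -/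
abbrev B1 (X : Type) [TopologicalSpace X] : AddSubgroup (C1 X) :=
    ((singularChains X).d 2 1).hom.range

/-- The induced homomorphism on `1`-chains. -/
abbrev push1 (f : C(X, Y)) : C1 X →+ C1 Y := ((chainMap f).f 1).hom

/-- The induced homomorphism on `0`-chains. -/
abbrev push0 (f : C(X, Y)) : C0 X →+ C0 Y := ((chainMap f).f 0).hom

/-- A singular simplex, as a chain. -/
def basisChain {n : ℕ} (x : (sing X) _⦋n⦌) : (singularChains X).X n :=
  ((sing X).ιChainComplex (R := AddCommGrpCat.of ℤ) x).hom (1 : ℤ)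

theorem chains_hom_ext {n : ℕ} {A : Type} [AddCommGroup A] {f g : (singularChains X).X n →+ A}
    (h : ∀ x, f (basisChain x) = g (basisChain x)) : f = g := by
  have : (AddCommGrpCat.ofHom f : (singularChains X).X n ⟶ AddCommGrpCat.of A) =
      AddCommGrpCat.ofHom g := by
    refine SSet.chainComplex_hom_ext fun x => ?_
    ext
    exact h x
  exact congrArg AddCommGrpCat.Hom.hom this

/-- The homomorphism on chains with given values on simplices. -/
def chainsLift {n : ℕ} {A : Type} [AddCommGroup A] (f : (sing X) _⦋n⦌ → A) :
    (singularChains X).X n →+ A :=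
  (Limits.Sigma.desc fun x : (sing X) _⦋n⦌ => AddCommGrpCat.ofHom (zmultiplesHom A (f x)) :
    (singularChains X).X n ⟶ AddCommGrpCat.of A).hom

theorem chainsLift_basisChain {n : ℕ} {A : Type} [AddCommGroup A] (f : (sing X) _⦋n⦌ → A)
    (x : (sing X) _⦋n⦌) : chainsLift f (basisChain x) = f x := by
  have := congrArg (fun f => f.hom (1 : ℤ)) (Limits.Sigma.ι_desc
    (fun x : (sing X) _⦋n⦌ => (AddCommGrpCat.ofHom (zmultiplesHom A (f x)) :
      AddCommGrpCat.of ℤ ⟶ AddCommGrpCat.of A)) x)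
  refine Eq.trans ?_ (this.trans ?_)
  · rfl
  · simp

/-- The singular simplex given by a continuous map. -/
abbrev simplexOf {n : ℕ} (s : C(stdSimplex ℝ (Fin (n + 1)), X)) : (sing X) _⦋n⦌ :=
  (TopCat.toSSetObjEquiv (TopCat.of X) (.op ⦋n⦌)).symm s

/-- A point, as a `0`-chain. -/
def pt (x : X) : C0 X := basisChain (simplexOf (ContinuousMap.const _ x))

/-- A path, as a `1`-chain. -/
def pathChain (γ : C(I, X)) : C1 X :=
  simplexChain (γ.comp (stdSimplexHomeomorphUnitInterval : C(_, I)))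

theorem basisChain_eq_pt (x : (sing X) _⦋0⦌) : basisChain x = pt (simplexMap x (vertex 0)) := by
  unfold pt
  congr 1
  apply (TopCat.toSSetObjEquiv (TopCat.of X) (.op ⦋0⦌)).injective
  rw [Equiv.apply_symm_apply]
  ext p
  have : p = vertex 0 := Subsingleton.elim _ _
  rw [this]
  rfl

theorem exists_basisChain_eq_pathChain (x : (sing X) _⦋1⦌) : ∃ γ :
    C(I, X), basisChain x = pathChain γ := by
  refine ⟨(simplexMap x).comp
    (stdSimplexHomeomorphUnitInterval.symm : C(I, _)), ?_⟩
  have : ((simplexMap x).comp (stdSimplexHomeomorphUnitInterval.symm : C(I, _))).comp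
      (stdSimplexHomeomorphUnitInterval : C(_, I)) = simplexMap x := by
    ext p
    simp
  unfold pathChain simplexChain
  rw [this]
  simp [basisChain, simplexMap]

theorem C0_hom_ext {A : Type} [AddCommGroup A] {f g : C0 X →+ A} (h : ∀ x, f (pt x) = g (pt x)) :
    f = g := chains_hom_ext fun x => by rw [basisChain_eq_pt, h]

theorem C1_hom_ext {A : Type} [AddCommGroup A] {f g : C1 X →+ A}
    (h : ∀ γ, f (pathChain γ) = g (pathChain γ)) : f = g := chains_hom_ext fun x => by
  obtain ⟨γ, hγ⟩ := exists_basisChain_eq_pathChain x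
  rw [hγ, h]

/-- The homomorphism on `0`-chains with given values at the points. -/
def lift0 {A : Type} [AddCommGroup A] (f : X → A) : C0 X →+ A :=
  chainsLift fun x => f (simplexMap x (vertex 0))

@[simp] theorem lift0_pt {A : Type} [AddCommGroup A] (f : X → A) (x : X) : lift0 f
    (pt x) = f x := by
  unfold lift0 pt
  rw [chainsLift_basisChain]
  rfl

theorem push_basisChain {n : ℕ} (f : C(X, Y)) (x : (sing X) _⦋n⦌) :
    ((chainMap f).f n).hom (basisChain x) = basisChain ((TopCat.toSSet.map (TopCat.ofHom f)).app _ x) := by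
  exact congrArg (fun f => f.hom (1 : ℤ)) (SSet.ι_chainComplexMap_f _ _
    (TopCat.toSSet.map (TopCat.ofHom f)) (AddCommGrpCat.of ℤ) x)

@[simp] theorem push0_pt (f : C(X, Y)) (x : X) : push0 f (pt x) = pt (f x) := by
  unfold pt
  rw [push_basisChain]
  rfl

@[simp] theorem push1_pathChain (f : C(X, Y)) (γ : C(I, X)) :
    push1 f (pathChain γ) = pathChain (f.comp γ) := by
  exact push_basisChain f _

/-- The `0`-chains are free on the points, so a choice of preimages defines a left inverse. This is
used to read off in `F_r` a boundary that is computed in `G_r`. -/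
theorem push0_injective (f : C(X, Y)) (hf : Function.Injective f) : Function.Injective
    (push0 f) := by
  classical
  have : (lift0 fun y => if h : ∃ x, f x = y then pt h.choose else 0).comp (push0 f) =
      AddMonoidHom.id _ := C0_hom_ext fun x => by
    have h : ∃ x', f x' = f x := ⟨x, rfl⟩
    simp only [AddMonoidHom.comp_apply, push0_pt, lift0_pt, dif_pos h, AddMonoidHom.id_apply]
    rw [hf h.choose_spec]
  exact Function.LeftInverse.injective fun c => DFunLike.congr_fun this c

theorem d_basisChain {n : ℕ} (x : (sing X) _⦋n + 1⦌) :
    ((singularChains X).d (n + 1) n).hom (basisChain x) =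
      ∑ i : Fin (n + 2), (-1 : ℤ) ^ i.val • basisChain ((sing X).δ i x) := by
  have := congrArg (fun f => f.hom (1 : ℤ)) ((sing X).ιChainComplex_d (R := AddCommGrpCat.of ℤ) x)
  refine Eq.trans this ?_
  let ev : (AddCommGrpCat.of ℤ ⟶ (singularChains X).X n) →+ (singularChains X).X n :=
    AddMonoidHom.mk' (fun f => f.hom (1 : ℤ)) fun _ _ => rfl
  refine (map_sum ev _ _).trans (Finset.sum_congr rfl fun i _ => ?_)
  exact map_zsmul ev _ _

@[simp] theorem bd_pathChain (γ : C(I, X)) : bd X (pathChain γ) = pt (γ 1) - pt (γ 0) := by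
  refine (d_basisChain _).trans ?_
  simp only [basisChain_eq_pt, simplexMap_δ, stdSimplex.map_vertex]
  simp [simplexMap, Fin.succAbove, sub_eq_add_neg]

theorem bd_push1 (f : C(X, Y)) (c : C1 X) : bd Y (push1 f c) = push0 f (bd X c) := by
  have := congrArg (fun f => f.hom c) ((chainMap f).comm 1 0)
  exact this

theorem bd_of_mem_B1 {c : C1 X} (hc : c ∈ B1 X) : bd X c = 0 := by
  obtain ⟨y, rfl⟩ := hc
  have := congrArg (fun f => f.hom y) ((singularChains X).d_comp_d 2 1 0)
  exact this

theorem push1_mem_B1 (f : C(X, Y)) {c : C1 X} (hc : c ∈ B1 X) : push1 f c ∈ B1 Y := by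
  obtain ⟨y, rfl⟩ := hc
  exact ⟨((chainMap f).f 2).hom y, congrArg (fun f => f.hom y) ((chainMap f).comm 2 1)⟩

end Chains

/-! ### Paths modulo boundaries -/

section Paths

variable {X Y : Type} [TopologicalSpace X] [TopologicalSpace Y]
  {E : Type*} [AddCommGroup E] [Module ℝ E] [TopologicalSpace E] [IsTopologicalAddGroup E]
  [ContinuousSMul ℝ E]

/-- The straight path from `a` to `b`, composed with `φ`. -/
def seg (φ : C(E, X)) (a b : E) : C(I, X) :=
  ⟨fun t => φ ((1 - (t : ℝ)) • a + (t : ℝ) • b), by fun_prop⟩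

@[simp] theorem seg_apply (φ : C(E, X)) (a b : E) (t : I) :
    seg φ a b t = φ ((1 - (t : ℝ)) • a + (t : ℝ) • b) := rfl

/-- Grouping the barycentric coordinates by the fibres of `f` shows that the faces of an affine
simplex are affine, with the expected vertices. -/
theorem map_comb {M : Type*} [AddCommGroup M] [Module ℝ M] {n m : ℕ} (f : Fin n → Fin m)
    (s : stdSimplex ℝ (Fin n)) (w : Fin m → M) :
    ∑ j, stdSimplex.map f s j • w j = ∑ i, s i • w (f i) := by
  simp only [stdSimplex.map_coe, FunOnFinite.linearMap_apply_apply, Finset.sum_smul]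
  rw [← Finset.sum_fiberwise Finset.univ f fun i => s i • w (f i)]
  refine Finset.sum_congr rfl fun j _ => Finset.sum_congr rfl fun i hi => ?_
  rw [(Finset.mem_filter.1 hi).2]

/-- The affine simplex with given vertices, composed with `φ`. -/
def affineSimplex {n : ℕ} (φ : C(E, X)) (w : Fin (n + 1) → E) :
    C(stdSimplex ℝ (Fin (n + 1)), X) :=
  ⟨fun s => φ (∑ i, s i • w i), by
    have hc : ∀ i, Continuous fun s : stdSimplex ℝ (Fin (n + 1)) => s i :=
      fun i => (continuous_apply i).comp continuous_subtype_val
    exact φ.continuous.comp (continuous_finsetSum _ fun i _ => (hc i).smul continuous_const)⟩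

theorem δ_affineSimplex {n : ℕ} (φ : C(E, X)) (w : Fin (n + 2) → E) (i : Fin (n + 2)) :
    (sing X).δ i (simplexOf (affineSimplex φ w)) =
      simplexOf (affineSimplex φ (w ∘ i.succAbove)) := by
  apply (TopCat.toSSetObjEquiv (TopCat.of X) (.op ⦋n⦌)).injective
  rw [Equiv.apply_symm_apply]
  ext p
  refine (simplexMap_δ _ i p).trans ?_
  exact congrArg φ (map_comb i.succAbove p w)

theorem pathChain_seg (φ : C(E, X)) (a b : E) :
    pathChain (seg φ a b) = basisChain (simplexOf (affineSimplex (n := 1) φ ![a, b])) := by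
  unfold pathChain simplexChain basisChain
  congr 4
  ext p
  have h0 : p 0 = 1 - p 1 := by have := stdSimplex.add_eq_one p; linarith
  have h1 : ((stdSimplexHomeomorphUnitInterval p : I) : ℝ) = p 1 := rfl
  simp [affineSimplex, h0, h1]

/-- The three segments are the faces of the affine triangle with vertices `a`, `b`, `c`, mapped by
`φ`. All homotopy arguments below reduce to this one `2`-simplex. -/
theorem pathChain_seg_add (φ : C(E, X)) (a b c : E) :
    pathChain (seg φ a b) + pathChain (seg φ b c) - pathChain (seg φ a c) ∈ B1 X := by
  refine ⟨basisChain (simplexOf (affineSimplex (n := 2) φ ![a, b, c])), ?_⟩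
  refine (d_basisChain _).trans ?_
  simp only [δ_affineSimplex, pathChain_seg]
  refine (Fin.sum_univ_three _).trans ?_
  have h0 : (![a, b, c] ∘ Fin.succAbove 0 : Fin 2 → E) = ![b, c] := by
    ext i; fin_cases i <;> rfl
  have h1 : (![a, b, c] ∘ Fin.succAbove 1 : Fin 2 → E) = ![a, c] := by
    ext i; fin_cases i <;> rfl
  have h2 : (![a, b, c] ∘ Fin.succAbove 2 : Fin 2 → E) = ![a, b] := by
    ext i; fin_cases i <;> rfl
  rw [h0, h1, h2]
  simp
  abel

/-- The group of `1`-chains modulo boundaries. -/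
abbrev Cls (X : Type) [TopologicalSpace X] : Type := C1 X ⧸ B1 X

/-- The class of a path modulo boundaries. -/
def pcls (γ : C(I, X)) : Cls X := QuotientAddGroup.mk' (B1 X) (pathChain γ)

theorem pcls_seg_add (φ : C(E, X)) (a b c : E) :
    pcls (seg φ a b) + pcls (seg φ b c) = pcls (seg φ a c) := by
  have := (QuotientAddGroup.eq_zero_iff _).2 (pathChain_seg_add φ a b c)
  rw [← sub_eq_zero]
  exact this

@[simp] theorem pcls_seg_self (φ : C(E, X)) (a : E) : pcls (seg φ a a) = 0 := by
  have := pcls_seg_add φ a a a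
  simpa using this

theorem pcls_const (x : X) : pcls (.const I x : C(I, X)) = 0 :=
  pcls_seg_self (.const ℝ x) 0

/-- The extension of a path to the real line. -/
def extendPath (γ : C(I, X)) : C(ℝ, X) :=
  ⟨fun t => γ (Set.projIcc 0 1 zero_le_one t), γ.continuous.comp continuous_projIcc⟩

theorem seg_extendPath (γ : C(I, X)) : seg (extendPath γ) 0 1 = γ := by
  ext t
  simp [extendPath]

/-- Both sides are the class of the diagonal of the square, once `H` is extended to the plane by
clamping so that the affine triangles apply. -/
theorem pcls_homotopy (H : C(I × I, X)) :
    pcls (H.comp (.prodMk (.const I 0) (.id I))) + pcls (H.comp (.prodMk (.id I) (.const I 1))) =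
    pcls (H.comp (.prodMk (.id I) (.const I 0))) + pcls (H.comp (.prodMk (.const I 1) (.id I))) := by
  let φ : C(ℝ × ℝ, X) := ⟨fun p => H (Set.projIcc 0 1 zero_le_one p.1, Set.projIcc 0 1 zero_le_one p.2),
    H.continuous.comp ((continuous_projIcc.comp continuous_fst).prodMk
      (continuous_projIcc.comp continuous_snd))⟩
  have h := (pcls_seg_add φ (0, 0) (0, 1) (1, 1)).trans (pcls_seg_add φ (0, 0) (1, 0) (1, 1)).symm
  convert h using 3 <;> ext t <;> simp [φ]

/-- Subdivide the path by the Lebesgue number lemma. Additivity is required only for segments of one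
map defined on the real line, so that subpaths can be joined without reparametrization. -/
theorem path_induction (P : C(I, X) → Prop)
    (hloc : ∀ x : X, ∃ U ∈ nhds x, ∀ γ : C(I, X), Set.range γ ⊆ U → P γ)
    (hadd : ∀ (φ : C(ℝ, X)) (a b c : ℝ), P (seg φ a b) → P (seg φ b c) → P (seg φ a c))
    (γ : C(I, X)) : P γ := by
  choose U hU hP using hloc
  obtain ⟨t, ht0, hmono, ⟨n, hn⟩, hsub⟩ := exists_monotone_Icc_subset_open_cover_unitInterval
    (c := fun x => γ ⁻¹' interior (U x)) (fun x => isOpen_interior.preimage γ.continuous)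
    (fun s _ => Set.mem_iUnion.2 ⟨γ s, mem_interior_iff_mem_nhds.2 (hU _)⟩)
  have hstep : ∀ k, P (seg (extendPath γ) (t k) (t (k + 1))) := by
    intro k
    obtain ⟨x, hx⟩ := hsub k
    refine hP x _ ?_
    rintro _ ⟨s, rfl⟩
    have hle : (t k : ℝ) ≤ t (k + 1) := hmono (Nat.le_succ k)
    have hm : (1 - (s : ℝ)) • (t k : ℝ) + (s : ℝ) • (t (k + 1) : ℝ) ∈ Set.Icc (t k : ℝ) (t (k + 1)) := by
      have := s.2.1
      have := s.2.2
      constructor <;> simp only [smul_eq_mul] <;> nlinarith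
    have hI : (1 - (s : ℝ)) • (t k : ℝ) + (s : ℝ) • (t (k + 1) : ℝ) ∈ Set.Icc (0 : ℝ) 1 :=
      ⟨(t k).2.1.trans hm.1, hm.2.trans (t (k + 1)).2.2⟩
    have := hx (show (⟨_, hI⟩ : I) ∈ Set.Icc (t k) (t (k + 1)) from ⟨hm.1, hm.2⟩)
    simp only [seg_apply, extendPath, ContinuousMap.coe_mk]
    rw [Set.projIcc_of_mem _ hI]
    exact interior_subset this
  have hall : ∀ k, P (seg (extendPath γ) (t 0) (t k)) := by
    intro k
    induction k with
    | zero =>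
      -- The empty subdivision gives a constant segment, which lies in the neighbourhood of its only
      -- point.
      refine hP (γ (t 0)) _ ?_
      rintro _ ⟨s, rfl⟩
      have : (1 - (s : ℝ)) • (t 0 : ℝ) + (s : ℝ) • (t 0 : ℝ) = t 0 := by simp; ring
      simp only [seg_apply, this]
      simp only [extendPath, ContinuousMap.coe_mk, Set.projIcc_val]
      exact mem_of_mem_nhds (hU _)
    | succ k ih => exact hadd _ _ _ _ ih (hstep k)
  have := hall n
  rw [hn n le_rfl, ht0] at this
  simpa [seg_extendPath] using this

/-- A homomorphism that vanishes on boundaries and is, on short paths, the difference of the values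
of a function at the end points, is this difference on all chains. -/
theorem eq_lift0_bd_of_local {A : Type} [AddCommGroup A] (D : C1 X →+ A) (hD : ∀ c ∈ B1 X, D c = 0)
    (q : X → A)
    (h : ∀ x : X, ∃ U ∈ nhds x, ∀ γ : C(I, X), Set.range γ ⊆ U →
      D (pathChain γ) = q (γ 1) - q (γ 0)) (c : C1 X) : D c = lift0 q (bd X c) := by
  have : D = (lift0 q).comp (bd X) := C1_hom_ext fun γ => by
    simp only [AddMonoidHom.comp_apply, bd_pathChain, map_sub, lift0_pt]
    refine path_induction (fun γ => D (pathChain γ) = q (γ 1) - q (γ 0)) h ?_ γ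
    intro φ a b c h1 h2
    -- Since `D` vanishes on the boundary of a triangle, it is additive under concatenation, as is
    -- the difference of the values of `q`.
    have := hD _ (pathChain_seg_add φ a b c)
    rw [map_sub, map_add, h1, h2, sub_eq_zero] at this
    rw [← this]
    simp
  exact DFunLike.congr_fun this c

end Paths

/-! ### Homology classes of cycles -/

section Classes

variable {X Y : Type} [TopologicalSpace X] [TopologicalSpace Y]

/-- The `1`-chain `c` is a cycle in the homology class `x`. -/
def Represents (c : C1 X) (x : H1 X) : Prop :=
  ∃ z, ((singularChains X).iCycles 1).hom z = c ∧ ((singularChains X).homologyπ 1).hom z = x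

theorem exists_represents_of_bd {c : C1 X} (hc : bd X c = 0) : ∃ x, Represents c x := by
  obtain ⟨z, hz⟩ := exists_cycle (singularChains X) (i := 1) (j := 0) (by simp) c hc
  exact ⟨_, z, hz, rfl⟩

theorem exists_represents (x : H1 X) : ∃ c, Represents c x := by
  obtain ⟨z, hz⟩ := homologyπ_surjective (singularChains X) 1 x
  exact ⟨_, z, rfl, hz⟩

theorem Represents.bd_eq {c : C1 X} {x : H1 X} (h : Represents c x) : bd X c = 0 := by
  obtain ⟨z, rfl, -⟩ := h
  exact congrArg (fun f => f.hom z) ((singularChains X).iCycles_d 1 0)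

theorem Represents.sub {c c' : C1 X} {x x' : H1 X} (h : Represents c x) (h' : Represents c' x') :
    Represents (c - c') (x - x') := by
  obtain ⟨z, rfl, rfl⟩ := h
  obtain ⟨z', rfl, rfl⟩ := h'
  exact ⟨z - z', map_sub _ _ _, map_sub _ _ _⟩

theorem Represents.eq_zero_iff {c : C1 X} {x : H1 X} (h : Represents c x) : x = 0 ↔ c ∈ B1 X := by
  obtain ⟨z, rfl, rfl⟩ := h
  exact homologyπ_eq_zero_iff (singularChains X) (i := 1) (j := 2) (by simp) z

theorem Represents.eq_iff {c c' : C1 X} {x x' : H1 X} (h : Represents c x) (h' : Represents c' x') :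
    x = x' ↔ c - c' ∈ B1 X := by
  rw [← sub_eq_zero, (h.sub h').eq_zero_iff]

theorem Represents.of_sub_mem {c c' : C1 X} {x : H1 X} (h : Represents c x) (h' : c - c' ∈ B1 X) :
    Represents c' x := by
  have hb : bd X c' = 0 := by
    have := bd_of_mem_B1 h'
    rwa [map_sub, h.bd_eq, zero_sub, neg_eq_zero] at this
  obtain ⟨x', hx'⟩ := exists_represents_of_bd hb
  rwa [(h.eq_iff hx').2 h']

theorem Represents.push (f : C(X, Y)) {c : C1 X} {x : H1 X} (h : Represents c x) :
    Represents (push1 f c) (H1map f x) := by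
  obtain ⟨z, rfl, rfl⟩ := h
  refine ⟨(HomologicalComplex.cyclesMap (chainMap f) 1).hom z, ?_, ?_⟩
  · exact congrArg (fun f => f.hom z) (HomologicalComplex.cyclesMap_i (chainMap f) 1)
  · exact (congrArg (fun f => f.hom z) (HomologicalComplex.homologyπ_naturality (chainMap f) 1)).symm

theorem Represents.windingNumber {c : C1 X} {x : H1 X} (h : Represents c x)
    (θ : C(X, UnitAddCircle)) :
    (DisorientedHomology.windingNumber θ x : ℝ) = (windingChain θ).hom c := by
  obtain ⟨z, rfl, rfl⟩ := h
  exact windingNumber_homologyπ θ z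

end Classes

/-! ### Jumps of real functions that are continuous modulo the integers -/

section Jumps

variable {X Y : Type} [TopologicalSpace X] [TopologicalSpace Y]

theorem exists_path_lift (f : C(I, UnitAddCircle)) :
    ∃ L : C(I, ℝ), ∀ t, (L t : UnitAddCircle) = f t := by
  obtain ⟨L, hL⟩ := exists_lift (n := 1) (f.comp (stdSimplexHomeomorphUnitInterval : C(_, I)))
  refine ⟨L.comp (stdSimplexHomeomorphUnitInterval.symm : C(I, _)), fun t => ?_⟩
  simp [hL]

theorem windingChain_pathChain (θ : C(X, UnitAddCircle)) (γ : C(I, X)) (L : C(I, ℝ))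
    (hL : ∀ t, (L t : UnitAddCircle) = θ (γ t)) :
    (windingChain θ).hom (pathChain γ) = L 1 - L 0 := by
  have := congrArg (fun f => f.hom (1 : ℤ)) (ι_windingChain θ
    (simplexOf (γ.comp (stdSimplexHomeomorphUnitInterval : C(_, I)))))
  refine Eq.trans this ?_
  refine (one_zsmul _).trans ?_
  simp only [simplexMap, Equiv.apply_symm_apply]
  rw [increment_eq (L.comp (stdSimplexHomeomorphUnitInterval : C(_, I))) fun p => hL _]
  simp

theorem windingChain_of_mem_B1 (θ : C(X, UnitAddCircle)) {c : C1 X} (hc : c ∈ B1 X) :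
    (windingChain θ).hom c = 0 := by
  obtain ⟨y, rfl⟩ := hc
  exact congrArg (fun f => f.hom y) (d_windingChain θ)

/-- The circle-valued map defined by a real function that is continuous modulo `ℤ`. -/
def modInt (e : X → ℝ) (he : Continuous fun x => (e x : UnitAddCircle)) : C(X, UnitAddCircle) :=
  ⟨_, he⟩

/-- The sum of the jumps of `e` along a chain. -/
def jump (e : X → ℝ) (he : Continuous fun x => (e x : UnitAddCircle)) : C1 X →+ ℝ :=
  (windingChain (modInt e he)).hom - (lift0 e).comp (bd X)

theorem jump_of_mem_B1 (e : X → ℝ) (he : Continuous fun x => (e x : UnitAddCircle)) {c : C1 X}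
    (hc : c ∈ B1 X) : jump e he c = 0 := by
  simp only [jump, AddMonoidHom.sub_apply, AddMonoidHom.comp_apply, bd_of_mem_B1 hc, map_zero,
    windingChain_of_mem_B1 _ hc, sub_zero]

theorem jump_pathChain (e : X → ℝ) (he : Continuous fun x => (e x : UnitAddCircle)) (γ : C(I, X))
    (L : C(I, ℝ)) (hL : ∀ t, (L t : UnitAddCircle) = e (γ t)) :
    jump e he (pathChain γ) = (L 1 - L 0) - (e (γ 1) - e (γ 0)) := by
  simp only [jump, AddMonoidHom.sub_apply, AddMonoidHom.comp_apply, bd_pathChain, map_sub, lift0_pt]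
  rw [windingChain_pathChain _ _ L hL]

/-- Here `e ∘ γ` is its own lift, so its total change is the difference of its end values. -/
theorem jump_pathChain_of_continuous (e : X → ℝ) (he : Continuous fun x => (e x : UnitAddCircle))
    (γ : C(I, X)) (h : Continuous fun t => e (γ t)) : jump e he (pathChain γ) = 0 := by
  rw [jump_pathChain e he γ ⟨_, h⟩ fun _ => rfl]
  simp

theorem jump_push1 (f : C(X, Y)) (e : Y → ℝ) (he : Continuous fun x => (e x : UnitAddCircle))
    (c : C1 X) : jump e he (push1 f c) = jump (e ∘ f) (he.comp f.continuous) c := by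
  have : (jump e he).comp (push1 f) = jump (e ∘ f) (he.comp f.continuous) := C1_hom_ext fun γ => by
    obtain ⟨L, hL⟩ := exists_path_lift ((modInt e he).comp (f.comp γ))
    rw [AddMonoidHom.comp_apply, push1_pathChain, jump_pathChain e he _ L hL,
      jump_pathChain (e ∘ f) _ _ L hL]
    rfl
  exact DFunLike.congr_fun this c

/-- Along a path, `s` times a lift of `e'` plus the continuous function `e - s * e'` is a lift of
`e`; the continuous part contributes no jump. Fluxes in different coordinates and winding numbers of
different angles are both compared in this way. -/
theorem jump_eq_of_continuous (e e' : X → ℝ) (he : Continuous fun x => (e x : UnitAddCircle))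
    (he' : Continuous fun x => (e' x : UnitAddCircle)) (s : ℤ)
    (h : Continuous fun x => e x - s * e' x) (c : C1 X) : jump e he c = s * jump e' he' c := by
  have : jump e he = (AddMonoidHom.mulLeft (s : ℝ)).comp (jump e' he') := C1_hom_ext fun γ => by
    obtain ⟨L, hL⟩ := exists_path_lift ((modInt e' he').comp γ)
    have hL' : ∀ t, (L t : UnitAddCircle) = e' (γ t) := hL
    rw [AddMonoidHom.comp_apply, jump_pathChain e' he' γ L hL, jump_pathChain e he γ
      ⟨fun t => s * L t + (e (γ t) - s * e' (γ t)), by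
        have := h.comp γ.continuous
        fun_prop⟩ fun t => ?_]
    · simp only [ContinuousMap.coe_mk, AddMonoidHom.coe_mulLeft]
      ring
    · have h1 : ((s * L t : ℝ) : UnitAddCircle) = ((s * e' (γ t) : ℝ) : UnitAddCircle) := by
        rw [← zsmul_eq_mul, ← zsmul_eq_mul, AddCircle.coe_zsmul, AddCircle.coe_zsmul, hL']
      simp only [ContinuousMap.coe_mk, AddCircle.coe_add, AddCircle.coe_sub, h1]
      abel
  exact DFunLike.congr_fun this c

/-- The end point terms in the jump cancel on a cycle. -/
theorem Represents.windingNumber_eq_jump {c : C1 X} {x : H1 X} (h : Represents c x) (e : X → ℝ)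
    (he : Continuous fun x => (e x : UnitAddCircle)) :
    (DisorientedHomology.windingNumber (modInt e he) x : ℝ) = jump e he c := by
  rw [h.windingNumber]
  simp [jump, h.bd_eq]

end Jumps

/-! ### The balls around the ribbon singularities -/

@[fun_prop] theorem continuous_coord (i : Fin 3) : Continuous fun p : E3 => p i :=
  (EuclideanSpace.proj (𝕜 := ℝ) i).continuous

theorem continuous_vec3 {Z : Type*} [TopologicalSpace Z] {a b c : Z → ℝ} (ha : Continuous a)
    (hb : Continuous b) (hc : Continuous c) : Continuous fun z => (!₂[a z, b z, c z] : E3) := by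
  refine (PiLp.continuous_toLp 2 _).comp (continuous_pi fun i => ?_)
  fin_cases i
  · exact ha
  · exact hb
  · exact hc

theorem isClosed_cube : IsClosed cube := by
  simp only [cube, Set.ofPred_forall]
  exact isClosed_iInter fun i => isClosed_le (by fun_prop) continuous_const

theorem isOpen_openCube : IsOpen openCube := by
  simp only [openCube, Set.ofPred_forall]
  exact isOpen_iInter_of_finite fun i => isOpen_lt (by fun_prop) continuous_const

theorem isCompact_cube : IsCompact cube := by
  refine Metric.isCompact_of_isClosed_isBounded isClosed_cube ?_
  -- Points of the cube have norm at most `2√3 < 4`.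
  refine Metric.isBounded_closedBall.subset (s := cube) (t := Metric.closedBall 0 4) ?_
  intro p hp
  have h := Disk.norm_sq_E3 p
  have h0 := abs_le.1 (hp 0)
  have h1 := abs_le.1 (hp 1)
  have h2 := abs_le.1 (hp 2)
  rw [mem_closedBall_zero_iff]
  nlinarith [norm_nonneg p]

theorem openCube_subset_cube : openCube ⊆ cube := fun _ hp i => (hp i).le

/-- Square and strip are star-shaped about the origin, so coning to the centre stays inside the
surface. -/
theorem smul_mem_models {p : E3} (hp : p ∈ squareModel ∪ stripModel) {t : ℝ} (h0 : 0 ≤ t)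
    (h1 : t ≤ 1) : t • p ∈ squareModel ∪ stripModel := by
  have key : ∀ {a b : ℝ}, |a| ≤ b → |t * a| ≤ b := fun {a b} h => by
    rw [abs_mul, abs_of_nonneg h0]
    nlinarith [abs_nonneg a]
  rcases hp with ⟨a, b, c⟩ | ⟨a, b, c⟩
  · exact Or.inl ⟨key a, key b, by simp [c]⟩
  · exact Or.inr ⟨by simp [a], key b, key c⟩

namespace RibbonCoordinates

variable {F : Type*} [TopologicalSpace F] {f : F → S3} (κ : RibbonCoordinates f)

/-- The cubical ball `B_j`. -/
def ball (j : Fin κ.num) : Set S3 := (κ.chart j).symm '' cube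

theorem mem_ball_iff {j : Fin κ.num} {q : S3} :
    q ∈ κ.ball j ↔ q ∈ (κ.chart j).source ∧ κ.chart j q ∈ cube := by
  constructor
  · rintro ⟨p, hp, rfl⟩
    have := κ.cube_subset j hp
    exact ⟨(κ.chart j).map_target this, by rwa [(κ.chart j).right_inv this]⟩
  · rintro ⟨h, h'⟩
    exact ⟨_, h', (κ.chart j).left_inv h⟩

theorem mem_openBall_iff {j : Fin κ.num} {q : S3} :
    q ∈ κ.openBall j ↔ q ∈ (κ.chart j).source ∧ κ.chart j q ∈ openCube := by
  constructor
  · rintro ⟨p, hp, rfl⟩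
    have := κ.cube_subset j (openCube_subset_cube hp)
    exact ⟨(κ.chart j).map_target this, by rwa [(κ.chart j).right_inv this]⟩
  · rintro ⟨h, h'⟩
    exact ⟨_, h', (κ.chart j).left_inv h⟩

theorem openBall_subset_ball (j : Fin κ.num) : κ.openBall j ⊆ κ.ball j :=
  Set.image_mono openCube_subset_cube

theorem mem_openBall_iff_of_mem_ball {j : Fin κ.num} {q : S3} (hq : q ∈ κ.ball j) :
    q ∈ κ.openBall j ↔ κ.chart j q ∈ openCube := by
  rw [mem_openBall_iff, and_iff_right (κ.mem_ball_iff.1 hq).1]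

theorem chart_symm {j : Fin κ.num} {p : E3} (hp : p ∈ cube) : κ.chart j ((κ.chart j).symm p) = p :=
  (κ.chart j).right_inv (κ.cube_subset j hp)

theorem symm_chart {j : Fin κ.num} {q : S3} (hq : q ∈ κ.ball j) :
    (κ.chart j).symm (κ.chart j q) = q := (κ.chart j).left_inv (κ.mem_ball_iff.1 hq).1

theorem symm_mem_ball {j : Fin κ.num} {p : E3} (hp : p ∈ cube) : (κ.chart j).symm p ∈ κ.ball j :=
  ⟨p, hp, rfl⟩

theorem isCompact_symm_image (j : Fin κ.num) {A : Set E3} (hA : IsClosed A) (h : A ⊆ cube) :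
    IsCompact ((κ.chart j).symm '' A) :=
  (isCompact_cube.of_isClosed_subset hA h).image_of_continuousOn
    ((κ.chart j).continuousOn_symm.mono (h.trans (κ.cube_subset j)))

theorem isClosed_ball (j : Fin κ.num) : IsClosed (κ.ball j) :=
  (κ.isCompact_symm_image j isClosed_cube subset_rfl).isClosed

theorem isOpen_openBall (j : Fin κ.num) : IsOpen (κ.openBall j) :=
  (κ.chart j).symm.isOpen_image_of_subset_source isOpen_openCube
    (openCube_subset_cube.trans (κ.cube_subset j))

theorem ball_unique {i j : Fin κ.num} {q : S3} (hi : q ∈ κ.ball i) (hj : q ∈ κ.ball j) : i = j := by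
  by_contra h
  exact Set.disjoint_left.1 (κ.disjoint_ball i j h) hi hj

theorem continuousOn_chart (j : Fin κ.num) : ContinuousOn (κ.chart j) (κ.ball j) :=
  (κ.chart j).continuousOn.mono fun _ h => (κ.mem_ball_iff.1 h).1

theorem chart_mem_models {j : Fin κ.num} {q : S3} (hq : q ∈ κ.ball j) (hr : q ∈ Set.range f) :
    κ.chart j q ∈ squareModel ∪ stripModel := by
  obtain ⟨x, rfl⟩ := hr
  have hx : x ∈ κ.square j ∪ κ.strip j := by
    rw [← κ.preimage_ball]
    exact hq
  rcases hx with hx | hx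
  · obtain ⟨p, hp, h⟩ := (κ.bijOn_square j).mapsTo hx
    rw [← h, κ.chart_symm (model_subset_cube (Or.inl hp))]
    exact Or.inl hp
  · obtain ⟨p, hp, h⟩ := (κ.bijOn_strip j).mapsTo hx
    rw [← h, κ.chart_symm (model_subset_cube (Or.inr hp))]
    exact Or.inr hp

/-! ### Sawtooth functions and the flux through a ribbon singularity. -/

/-- The height `z` of a point in the coordinates of `B_j`. -/
def height (j : Fin κ.num) (q : S3) : ℝ := κ.chart j q 2

theorem continuousOn_height (j : Fin κ.num) : ContinuousOn (κ.height j) (κ.ball j) :=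
  (continuous_coord 2).comp_continuousOn (κ.continuousOn_chart j)

/-- The strip has `|y| ≤ 1 < 2`, so it meets the frontier of the cube only in its two ends; the
square lies at height `0`. At these heights the sawtooth vanishes. -/
theorem height_eq_of_notMem_openCube {p : E3} (hp : p ∈ squareModel ∪ stripModel)
    (h : p ∉ openCube) : p 2 = 0 ∨ |p 2| = 2 := by
  rcases hp with ⟨-, -, c⟩ | ⟨a, b, c⟩
  · exact Or.inl c
  · right
    refine le_antisymm c (not_lt.1 fun hlt => h fun i => ?_)
    fin_cases i
    · simp [a]
    · exact b.trans_lt one_lt_two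
    · exact hlt

open Classical in
/-- The function `z / 2 - sign z` on `B_j`, extended by zero. Its restriction to the image of the
surface is continuous modulo the integers; on the surface it jumps along the properly embedded arc
of the ribbon singularity. -/
def sawtooth (j : Fin κ.num) (q : S3) : ℝ :=
  if q ∈ κ.ball j then κ.height j q / 2 - SignType.sign (κ.height j q) else 0

theorem sawtooth_of_height_eq_zero {j : Fin κ.num} {q : S3} (h : κ.height j q = 0) :
    κ.sawtooth j q = 0 := by
  simp [sawtooth, h]

theorem sawtooth_of_notMem_ball {j : Fin κ.num} {q : S3} (h : q ∉ κ.ball j) :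
    κ.sawtooth j q = 0 := if_neg h

/-- The slope `1/2` is chosen so that `z / 2 - sign z` vanishes at `z = ±2`, as it does at `z = 0`.
-/
theorem sawtooth_of_notMem_openBall {j : Fin κ.num} {q : S3} (hr : q ∈ Set.range f)
    (h : q ∉ κ.openBall j) : κ.sawtooth j q = 0 := by
  by_cases hb : q ∈ κ.ball j
  · have := height_eq_of_notMem_openCube (κ.chart_mem_models hb hr)
      (mt (κ.mem_openBall_iff_of_mem_ball hb).2 h)
    rcases this with h0 | h0
    · exact κ.sawtooth_of_height_eq_zero h0
    · rw [sawtooth, if_pos hb]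
      rcases (abs_eq (by norm_num)).1 h0 with h2 | h2 <;> simp [height, h2]
  · exact κ.sawtooth_of_notMem_ball hb

theorem coe_sawtooth_of_mem_ball {j : Fin κ.num} {q : S3} (h : q ∈ κ.ball j) :
    (κ.sawtooth j q : UnitAddCircle) = ((κ.height j q / 2 : ℝ) : UnitAddCircle) := by
  rw [sawtooth, if_pos h, AddCircle.coe_sub, sub_eq_self, AddCircle.coe_eq_zero_iff]
  exact ⟨SignType.sign (κ.height j q), by simp⟩

/-- Two closed sets cover `F_r`: on the ball the function is `z / 2` modulo `ℤ`, and off the open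
ball it is zero. -/
theorem continuous_coe_sawtooth (j : Fin κ.num) :
    Continuous fun q : Set.range f => (κ.sawtooth j q : UnitAddCircle) := by
  have h1 : ContinuousOn (fun q : Set.range f => (κ.sawtooth j q : UnitAddCircle))
      {q | (q : S3) ∈ κ.ball j} := by
    have : ContinuousOn (fun q : Set.range f => ((κ.height j q / 2 : ℝ) : UnitAddCircle))
        {q | (q : S3) ∈ κ.ball j} := by
      refine (AddCircle.continuous_mk' (1 : ℝ)).comp_continuousOn (ContinuousOn.div_const ?_ 2)
      exact (κ.continuousOn_height j).comp continuous_subtype_val.continuousOn fun q hq => hq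
    exact this.congr fun q hq => κ.coe_sawtooth_of_mem_ball hq
  have h2 : ContinuousOn (fun q : Set.range f => (κ.sawtooth j q : UnitAddCircle))
      {q | (q : S3) ∉ κ.openBall j} :=
    (continuousOn_const (c := 0)).congr fun q hq => by
      simp [κ.sawtooth_of_notMem_openBall q.2 hq]
  rw [← continuousOn_univ]
  refine (h1.union_of_isClosed h2 ((κ.isClosed_ball j).preimage continuous_subtype_val)
    ((κ.isOpen_openBall j).isClosed_compl.preimage continuous_subtype_val)).mono fun q _ => ?_
  by_cases h : (q : S3) ∈ κ.openBall j
  · exact Or.inl (κ.openBall_subset_ball j h)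
  · exact Or.inr h

/-- The sum of the jumps of the `j`-th sawtooth function along a chain of `F_r`: the difference of
the fluxes into the ribbon singularity through the two halves of the strip. -/
def flux (j : Fin κ.num) : C1 (Set.range f) →+ ℝ :=
  jump (fun q : Set.range f => κ.sawtooth j q) (κ.continuous_coe_sawtooth j)

end RibbonCoordinates

namespace RibbonCoordinates

variable {F : Type*} [TopologicalSpace F] {f : F → S3} (κ : RibbonCoordinates f)

/-! ### Paths in the models -/

theorem continuous_symm_comp {Z : Type*} [TopologicalSpace Z] (j : Fin κ.num) {g : Z → E3}
    (hc : Continuous g) (hg : ∀ t, g t ∈ squareModel ∪ stripModel) :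
    Continuous fun t => (κ.chart j).symm (g t) :=
  (κ.chart j).continuousOn_symm.comp_continuous hc
    fun t => κ.cube_subset j (model_subset_cube (hg t))

/-- A map to the models in the ball `B_j`, as a map to `F_r`. -/
def modelMap {Z : Type*} [TopologicalSpace Z] (j : Fin κ.num) (g : C(Z, E3))
    (hg : ∀ t, g t ∈ squareModel ∪ stripModel) : C(Z, Set.range f) :=
  ⟨fun t => ⟨(κ.chart j).symm (g t), κ.model_mem_range j (hg t)⟩,
    (κ.continuous_symm_comp j g.continuous hg).subtype_mk _⟩

theorem zero_mem_models : (0 : E3) ∈ squareModel ∪ stripModel := by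
  left; simp [squareModel]

/-- The straight path from the origin to `p` in the ball `B_j`. -/
def ray (j : Fin κ.num) (p : E3) (hp : p ∈ squareModel ∪ stripModel) : C(I, Set.range f) :=
  κ.modelMap j ⟨fun t => (t : ℝ) • p, by fun_prop⟩ fun t => smul_mem_models hp t.2.1 t.2.2

/-- Cone the path to the origin: the square `(s, t) ↦ s • g t` has a constant side at `s = 0`, the
path itself at `s = 1`, and the two rays as remaining sides. -/
theorem pcls_modelMap (j : Fin κ.num) (g : C(I, E3)) (hg : ∀ t, g t ∈ squareModel ∪ stripModel) :
    pcls (κ.modelMap j g hg) =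
      pcls (κ.ray j (g 1) (hg 1)) - pcls (κ.ray j (g 0) (hg 0)) := by
  have := pcls_homotopy (κ.modelMap j ⟨fun p : I × I => (p.1 : ℝ) • g p.2, by fun_prop⟩
    fun p => smul_mem_models (hg p.2) p.1.2.1 p.1.2.2)
  have h0 : (κ.modelMap j ⟨fun p : I × I => (p.1 : ℝ) • g p.2, by fun_prop⟩
      fun p => smul_mem_models (hg p.2) p.1.2.1 p.1.2.2).comp (.prodMk (.const I 0) (.id I)) =
      .const I ⟨(κ.chart j).symm 0, κ.model_mem_range j zero_mem_models⟩ := by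
    ext t; simp [modelMap]
  have h1 : (κ.modelMap j ⟨fun p : I × I => (p.1 : ℝ) • g p.2, by fun_prop⟩
      fun p => smul_mem_models (hg p.2) p.1.2.1 p.1.2.2).comp (.prodMk (.const I 1) (.id I)) =
      κ.modelMap j g hg := by
    ext t; simp [modelMap]
  rw [h0, h1, pcls_const, zero_add] at this
  rw [eq_sub_iff_add_eq, add_comm]
  exact this.symm

@[simp] theorem pcls_ray_zero (j : Fin κ.num) (h) : pcls (κ.ray j 0 h) = 0 := by
  have : κ.ray j 0 h = .const I ⟨(κ.chart j).symm 0, κ.model_mem_range j zero_mem_models⟩ := by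
    ext t; simp [ray, modelMap]
  rw [this, pcls_const]

theorem pcls_modelMap_of_eq (j : Fin κ.num) (g : C(I, E3))
    (hg : ∀ t, g t ∈ squareModel ∪ stripModel) {p q : E3} (h0 : g 0 = p) (h1 : g 1 = q)
    (hp : p ∈ squareModel ∪ stripModel) (hq : q ∈ squareModel ∪ stripModel) :
    pcls (κ.modelMap j g hg) = pcls (κ.ray j q hq) - pcls (κ.ray j p hp) := by
  subst h0 h1
  exact κ.pcls_modelMap j g hg

theorem cls_simplexChain_segmentSimplex (j : Fin κ.num) (p q : E3)
    (h : segment ℝ p q ⊆ squareModel ∪ stripModel) (hp : p ∈ squareModel ∪ stripModel)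
    (hq : q ∈ squareModel ∪ stripModel) :
    QuotientAddGroup.mk' (B1 (Set.range f)) (simplexChain (κ.segmentSimplex j p q h)) =
      pcls (κ.ray j q hq) - pcls (κ.ray j p hp) := by
  rw [← κ.pcls_modelMap_of_eq j ⟨fun t : I => (1 - (t : ℝ)) • p + (t : ℝ) • q, by fun_prop⟩
    (fun t => h ⟨1 - t, t, sub_nonneg.2 t.2.2, t.2.1, by ring, rfl⟩) (by simp) (by simp) hp hq]
  unfold pcls pathChain
  congr 2
  refine ContinuousMap.ext fun s => Subtype.ext ?_
  have h0 : s 0 = 1 - s 1 := by have := stdSimplex.add_eq_one s; linarith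
  have h1 : ((stdSimplexHomeomorphUnitInterval s : I) : ℝ) = s 1 := rfl
  simp [segmentSimplex, modelMap, h0, h1]

/-! ### Chains modulo chains outside the balls -/

/-- The classes of chains outside the balls and of rays to the boundaries of the balls. -/
def outerClasses : AddSubgroup (Cls (Set.range f)) :=
  AddSubgroup.closure
    ({x | ∃ γ : C(I, Set.range f), (∀ t, (γ t : S3) ∈ κ.outside) ∧ x = pcls γ} ∪
      {x | ∃ j p hp, p ∉ openCube ∧ x = pcls (κ.ray j p hp)})

open Classical in
/-- The class of the ray from the centre of a ball to a given point of the interior of the ball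
(and zero for other points). -/
def coneClass (q : Set.range f) : Cls (Set.range f) :=
  if h : ∃ j, (q : S3) ∈ κ.openBall j then
    pcls (κ.ray h.choose _ (κ.chart_mem_models (κ.openBall_subset_ball _ h.choose_spec) q.2))
  else 0

theorem coneClass_of_mem {j : Fin κ.num} {q : Set.range f} (h : (q : S3) ∈ κ.openBall j) :
    κ.coneClass q =
      pcls (κ.ray j _ (κ.chart_mem_models (κ.openBall_subset_ball _ h) q.2)) := by
  have h' : ∃ j, (q : S3) ∈ κ.openBall j := ⟨j, h⟩
  have hj : h'.choose = j := κ.ball_unique (κ.openBall_subset_ball _ h'.choose_spec)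
    (κ.openBall_subset_ball _ h)
  rw [coneClass, dif_pos h']
  congr 2
  rw [hj]

theorem coneClass_of_notMem {q : Set.range f} (h : ∀ j, (q : S3) ∉ κ.openBall j) :
    κ.coneClass q = 0 := dif_neg fun ⟨j, hj⟩ => h j hj

theorem pcls_of_mem_openBall (j : Fin κ.num) (γ : C(I, Set.range f))
    (h : ∀ t, (γ t : S3) ∈ κ.openBall j) :
    pcls γ = κ.coneClass (γ 1) - κ.coneClass (γ 0) := by
  have hb := fun t => κ.openBall_subset_ball j (h t)
  rw [κ.coneClass_of_mem (h 1), κ.coneClass_of_mem (h 0),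
    ← κ.pcls_modelMap_of_eq j ⟨fun t => κ.chart j (γ t),
      (κ.continuousOn_chart j).comp_continuous (by fun_prop) hb⟩
      (fun t => κ.chart_mem_models (hb t) (γ t).2)
      (p := κ.chart j (γ 0)) (q := κ.chart j (γ 1)) rfl rfl]
  congr 1
  refine ContinuousMap.ext fun t => Subtype.ext ?_
  simp [modelMap, κ.symm_chart (hb t)]

/-- Paths near the boundary of a ball are pushed out of the interior of the ball. -/
theorem pcls_of_push (j : Fin κ.num) (A : Set E3) (hA : A ⊆ squareModel ∪ stripModel)
    (pr : E3 → E3) (hpr : ContinuousOn pr A)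
    (h1 : ∀ p ∈ A, ∀ t : ℝ, 0 ≤ t → t ≤ 1 →
      (1 - t) • p + t • pr p ∈ squareModel ∪ stripModel)
    (h2 : ∀ p ∈ A, pr p ∉ openCube) (h3 : ∀ p ∈ A, p ∉ openCube → pr p = p)
    (γ : C(I, Set.range f)) (hγ : ∀ t, (γ t : S3) ∈ κ.ball j → κ.chart j (γ t) ∈ A)
    (hγ' : ∀ t, ∀ i ≠ j, (γ t : S3) ∉ κ.ball i) :
    QuotientAddGroup.mk' κ.outerClasses (pcls γ) =
      QuotientAddGroup.mk' κ.outerClasses (κ.coneClass (γ 1)) -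
        QuotientAddGroup.mk' κ.outerClasses (κ.coneClass (γ 0)) := by
  classical
  have hpm : ∀ p ∈ A, pr p ∈ squareModel ∪ stripModel := fun p hp => by
    simpa using h1 p hp 1 zero_le_one le_rfl
  -- This is the straight homotopy from `γ` to `pr ∘ γ` in the coordinates of `B_j`, constant in
  -- time off the ball. It is well defined and continuous because `pr` fixes the points off the open
  -- cube.
  let H0 : I × I → S3 := fun x => if (γ x.2 : S3) ∈ κ.ball j then
    (κ.chart j).symm ((1 - (x.1 : ℝ)) • κ.chart j (γ x.2) + (x.1 : ℝ) • pr (κ.chart j (γ x.2)))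
    else γ x.2
  have hH0 : ∀ x : I × I, (γ x.2 : S3) ∉ κ.openBall j → H0 x = γ x.2 := by
    intro x hx
    by_cases hb : (γ x.2 : S3) ∈ κ.ball j
    · have hn : κ.chart j (γ x.2) ∉ openCube := mt (κ.mem_openBall_iff_of_mem_ball hb).2 hx
      simp only [H0, if_pos hb, h3 _ (hγ _ hb) hn]
      rw [← add_smul]
      simp [κ.symm_chart hb]
    · simp [H0, hb]
  have hcont : Continuous H0 := by
    rw [← continuousOn_univ]
    have c1 : ContinuousOn H0 {x | (γ x.2 : S3) ∈ κ.ball j} := by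
      have : ContinuousOn (fun x : I × I => (κ.chart j).symm
          ((1 - (x.1 : ℝ)) • κ.chart j (γ x.2) + (x.1 : ℝ) • pr (κ.chart j (γ x.2))))
          {x | (γ x.2 : S3) ∈ κ.ball j} := by
        have hc : ContinuousOn (fun x : I × I => κ.chart j (γ x.2)) {x | (γ x.2 : S3) ∈ κ.ball j} :=
          (κ.continuousOn_chart j).comp (by fun_prop) fun x hx => hx
        have hp : ContinuousOn (fun x : I × I => pr (κ.chart j (γ x.2)))
            {x | (γ x.2 : S3) ∈ κ.ball j} := hpr.comp hc fun x hx => hγ _ hx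
        refine (κ.chart j).continuousOn_symm.comp (t := (κ.chart j).target) ?_ fun x hx =>
          κ.cube_subset j (model_subset_cube (h1 _ (hγ _ hx) _ x.1.2.1 x.1.2.2))
        have h1 : Continuous fun x : I × I => (x.1 : ℝ) := by fun_prop
        exact ((continuousOn_const.sub h1.continuousOn).smul hc).add (h1.continuousOn.smul hp)
      exact this.congr fun x hx => if_pos hx
    have c2 : ContinuousOn H0 {x | (γ x.2 : S3) ∉ κ.openBall j} := by
      have : Continuous fun x : I × I => (γ x.2 : S3) := by fun_prop
      exact this.continuousOn.congr fun x hx => hH0 x hx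
    refine (c1.union_of_isClosed c2 ((κ.isClosed_ball j).preimage (by fun_prop))
      ((κ.isOpen_openBall j).isClosed_compl.preimage (by fun_prop))).mono fun x _ => ?_
    by_cases h : (γ x.2 : S3) ∈ κ.openBall j
    · exact Or.inl (κ.openBall_subset_ball j h)
    · exact Or.inr h
  have hmem : ∀ x, H0 x ∈ Set.range f := by
    intro x
    by_cases hb : (γ x.2 : S3) ∈ κ.ball j
    · simp only [H0, if_pos hb]
      exact κ.model_mem_range j (h1 _ (hγ _ hb) _ x.1.2.1 x.1.2.2)
    · simp only [H0, if_neg hb]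
      exact (γ x.2).2
  let H : C(I × I, Set.range f) := ⟨fun x => ⟨H0 x, hmem x⟩, hcont.subtype_mk _⟩
  have hstart : H.comp (.prodMk (.const I 0) (.id I)) = γ := by
    refine ContinuousMap.ext fun t => Subtype.ext ?_
    change H0 (0, t) = γ t
    by_cases hb : (γ t : S3) ∈ κ.ball j
    · simp [H0, hb, κ.symm_chart hb]
    · simp [H0, hb]
  -- The pushed path avoids the interiors of all balls: `pr` leaves `openCube`, and `γ` does not
  -- meet the other balls.
  have hend : pcls (H.comp (.prodMk (.const I 1) (.id I))) ∈ κ.outerClasses := by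
    refine AddSubgroup.subset_closure (Or.inl ⟨_, fun t => ⟨(H (1, t)).2, ?_⟩, rfl⟩)
    rw [Set.mem_iUnion]
    rintro ⟨i, hi⟩
    change H0 (1, t) ∈ _ at hi
    by_cases hb : (γ t : S3) ∈ κ.ball j
    · simp only [H0, hb, if_true] at hi
      simp only [unitInterval, Set.Icc.coe_one, sub_self, zero_smul, one_smul, zero_add] at hi
      have hc := model_subset_cube (hpm _ (hγ _ hb))
      have hij := κ.ball_unique (κ.openBall_subset_ball _ hi) (κ.symm_mem_ball hc)
      subst hij
      have := (κ.mem_openBall_iff.1 hi).2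
      rw [κ.chart_symm hc] at this
      exact h2 _ (hγ _ hb) this
    · simp only [H0, hb, if_false] at hi
      by_cases hij : i = j
      · exact hb (hij ▸ κ.openBall_subset_ball _ hi)
      · exact hγ' t i hij (κ.openBall_subset_ball _ hi)
  -- The track of a point runs from `p` to `pr p`, so it is the ray to `pr p`, which is an outer
  -- class, minus the ray to `p`.
  have htrace : ∀ t, QuotientAddGroup.mk' κ.outerClasses
      (pcls (H.comp (.prodMk (.id I) (.const I t)))) =
      - QuotientAddGroup.mk' κ.outerClasses (κ.coneClass (γ t)) := by
    intro t
    by_cases ho : (γ t : S3) ∈ κ.openBall j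
    · have hb := κ.openBall_subset_ball _ ho
      have hp := hγ t hb
      rw [κ.coneClass_of_mem ho]
      have hray : QuotientAddGroup.mk' κ.outerClasses (pcls (κ.ray j _ (hpm _ hp))) = 0 :=
        (QuotientAddGroup.eq_zero_iff _).2 (AddSubgroup.subset_closure
          (Or.inr ⟨j, _, hpm _ hp, h2 _ hp, rfl⟩))
      have heq : H.comp (.prodMk (.id I) (.const I t)) = κ.modelMap j ⟨fun s : I =>
          (1 - (s : ℝ)) • κ.chart j (γ t) + (s : ℝ) • pr (κ.chart j (γ t)), by fun_prop⟩
          fun s => h1 _ hp _ s.2.1 s.2.2 := by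
        refine ContinuousMap.ext fun s => Subtype.ext ?_
        change H0 (s, t) = _
        simp [H0, hb, modelMap]
      rw [heq, κ.pcls_modelMap_of_eq j _ _ (p := κ.chart j (γ t)) (q := pr (κ.chart j (γ t)))
        (by simp) (by simp) (hA hp) (hpm _ hp), map_sub, hray, zero_sub]
    · have heq : H.comp (.prodMk (.id I) (.const I t)) = .const I (γ t) := by
        exact ContinuousMap.ext fun s => Subtype.ext (hH0 (s, t) ho)
      rw [heq, pcls_const, coneClass_of_notMem, map_zero, neg_zero]
      intro i hi
      by_cases hij : i = j
      · exact ho (hij ▸ hi)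
      · exact hγ' t i hij (κ.openBall_subset_ball _ hi)
  have key := congrArg (QuotientAddGroup.mk' κ.outerClasses) (pcls_homotopy H)
  have hend' : QuotientAddGroup.mk' κ.outerClasses
      (pcls (H.comp (.prodMk (.const I 1) (.id I)))) = 0 := (QuotientAddGroup.eq_zero_iff _).2 hend
  rw [map_add, map_add, hstart, htrace, htrace, hend', add_zero] at key
  rw [← sub_eq_zero] at key ⊢
  rw [← key]
  abel

end RibbonCoordinates

namespace RibbonCoordinates

variable {F : Type*} [TopologicalSpace F] {f : F → S3} (κ : RibbonCoordinates f)

theorem chart_mem_cube {j : Fin κ.num} {q : S3} (hq : q ∈ κ.ball j) : κ.chart j q ∈ cube :=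
  (κ.mem_ball_iff.1 hq).2

/-- A neighbourhood of a point of `B_j`, given in the coordinates, that avoids the other balls. -/
theorem exists_nhds_of_mem_ball {j : Fin κ.num} {q : S3} (hq : q ∈ κ.ball j) {A : Set E3}
    (hA : IsClosed A) (hqA : κ.chart j q ∉ A) :
    ∃ U ∈ nhds q, ∀ q' ∈ U, (q' ∈ κ.ball j → κ.chart j q' ∉ A) ∧ ∀ i ≠ j, q' ∉ κ.ball i := by
  refine ⟨((κ.chart j).symm '' (cube ∩ A))ᶜ ∩ ⋂ i, ⋂ (_ : i ≠ j), (κ.ball i)ᶜ, ?_, ?_⟩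
  · refine IsOpen.mem_nhds (IsOpen.inter ?_ (isOpen_iInter_of_finite fun i =>
      isOpen_iInter_of_finite fun _ => (κ.isClosed_ball i).isOpen_compl)) ⟨?_, ?_⟩
    · exact (κ.isCompact_symm_image j (isClosed_cube.inter hA)
        Set.inter_subset_left).isClosed.isOpen_compl
    · rintro ⟨p, ⟨hp, hpA⟩, rfl⟩
      rw [κ.chart_symm hp] at hqA
      exact hqA hpA
    · simp only [Set.mem_iInter]
      exact fun i hi hqi => hi (κ.ball_unique hqi hq)
  · rintro q' ⟨h1, h2⟩
    refine ⟨fun hb hA' => h1 ⟨_, ⟨κ.chart_mem_cube hb, hA'⟩, κ.symm_chart hb⟩, fun i hi => ?_⟩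
    simp only [Set.mem_iInter] at h2
    exact h2 i hi

theorem smul_lerp (p : E3) (m t : ℝ) : (1 - t) • p + t • (m • p) = (1 - t + t * m) • p := by
  rw [smul_smul, ← add_smul]

/-- On short paths the class modulo the outer classes is a difference of values at the end points. -/
theorem exists_nhds_pcls (q : Set.range f) : ∃ U ∈ nhds q, ∀ γ : C(I, Set.range f),
    Set.range γ ⊆ U → QuotientAddGroup.mk' κ.outerClasses (pcls γ) =
      QuotientAddGroup.mk' κ.outerClasses (κ.coneClass (γ 1)) -
        QuotientAddGroup.mk' κ.outerClasses (κ.coneClass (γ 0)) := by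
  by_cases ho : ∃ j, (q : S3) ∈ κ.openBall j
  · obtain ⟨j, hj⟩ := ho
    refine ⟨{q | (q : S3) ∈ κ.openBall j},
      ((κ.isOpen_openBall j).preimage continuous_subtype_val).mem_nhds hj, fun γ hγ => ?_⟩
    rw [κ.pcls_of_mem_openBall j γ fun t => hγ ⟨t, rfl⟩, map_sub]
  by_cases hb : ∃ j, (q : S3) ∈ κ.ball j
  · obtain ⟨j, hj⟩ := hb
    have hnot : κ.chart j q ∉ openCube :=
      fun h => ho ⟨j, (κ.mem_openBall_iff_of_mem_ball hj).2 h⟩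
    have hcoord := κ.chart_mem_models hj q.2
    -- At a frontier point, `A` is a closed part of the coordinates to be avoided by a small
    -- neighbourhood; what remains of the models lies in `A'`, where the retraction `pr` is defined.
    have hpull : ∀ (A A' : Set E3), IsClosed A → κ.chart j q ∉ A →
        (∀ p ∈ squareModel ∪ stripModel, p ∉ A → p ∈ A') → A' ⊆ squareModel ∪ stripModel →
        ∀ pr : E3 → E3, ContinuousOn pr A' →
        (∀ p ∈ A', ∀ t : ℝ, 0 ≤ t → t ≤ 1 →
          (1 - t) • p + t • pr p ∈ squareModel ∪ stripModel) →
        (∀ p ∈ A', pr p ∉ openCube) → (∀ p ∈ A', p ∉ openCube → pr p = p) →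
        ∃ U ∈ nhds q, ∀ γ : C(I, Set.range f),
          Set.range γ ⊆ U → QuotientAddGroup.mk' κ.outerClasses (pcls γ) =
          QuotientAddGroup.mk' κ.outerClasses (κ.coneClass (γ 1)) -
            QuotientAddGroup.mk' κ.outerClasses (κ.coneClass (γ 0)) := by
      intro A A' hA hqA hAA' hA' pr hpr h1 h2 h3
      obtain ⟨U, hU, hU'⟩ := κ.exists_nhds_of_mem_ball hj hA hqA
      refine ⟨Subtype.val ⁻¹' U, continuous_subtype_val.continuousAt hU, fun γ hγ => ?_⟩
      have hin : ∀ t, (γ t : S3) ∈ U := fun t => hγ ⟨t, rfl⟩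
      exact κ.pcls_of_push j A' hA' pr hpr h1 h2 h3 γ
        (fun t ht => hAA' _ (κ.chart_mem_models ht (γ t).2) ((hU' _ (hin t)).1 ht))
        fun t => (hU' _ (hin t)).2
    rcases height_eq_of_notMem_openCube hcoord hnot with h0 | h2
    · refine hpull {p | 1 ≤ |p 2| ∨ |p 0| ≤ 1 ∧ |p 1| ≤ 1}
        {p | p ∈ squareModel ∧ 1 < max |p 0| |p 1|} ?_ ?_ ?_ (fun p hp => Or.inl hp.1)
        (fun p => (2 / max |p 0| |p 1|) • p) ?_ ?_ ?_ ?_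
      · exact (isClosed_le continuous_const (continuous_coord 2).abs).union
          ((isClosed_le (continuous_coord 0).abs continuous_const).inter
            (isClosed_le (continuous_coord 1).abs continuous_const))
      · rintro (h | ⟨h, h'⟩)
        · rw [h0] at h; norm_num at h
        · refine hnot fun i => ?_
          fin_cases i
          · exact h.trans_lt one_lt_two
          · exact h'.trans_lt one_lt_two
          · simp [h0]
      · intro p hp hpA
        have hpA' : |p 2| < 1 ∧ (|p 0| ≤ 1 → 1 < |p 1|) := by
          simpa [not_or] using hpA
        rcases hp with hp | ⟨a, b, c⟩
        · refine ⟨hp, ?_⟩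
          rw [lt_max_iff]
          by_contra! hcon
          exact absurd (hpA'.2 hcon.1) (not_lt.2 hcon.2)
        · exact absurd (hpA'.2 (by simp [a])) (not_lt.2 b)
      · have hc : Continuous fun p : E3 => max |p 0| |p 1| := by fun_prop
        refine ContinuousOn.smul (continuousOn_const.div hc.continuousOn fun p hp => ?_)
          continuousOn_id
        exact (zero_lt_one.trans hp.2).ne'
      · rintro p ⟨⟨a, b, c⟩, hM⟩ t ht0 ht1
        left
        rw [smul_lerp]
        set M := max |p 0| |p 1| with hMd
        have hM0 : 0 < M := zero_lt_one.trans hM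
        have hM2 : M ≤ 2 := max_le a b
        have hk : 0 ≤ 1 - t + t * (2 / M) := by
          have := div_pos two_pos hM0
          nlinarith
        have hk2 : (1 - t + t * (2 / M)) * M ≤ 2 := by
          have : t * (2 / M) * M = 2 * t := by field_simp
          nlinarith
        have key : ∀ i, |p i| ≤ M → |((1 - t + t * (2 / M)) • p) i| ≤ 2 := fun i hi => by
          have : ((1 - t + t * (2 / M)) • p) i = (1 - t + t * (2 / M)) * p i := rfl
          rw [this, abs_mul, abs_of_nonneg hk]
          nlinarith
        exact ⟨key 0 (le_max_left _ _), key 1 (le_max_right _ _), by simp [c]⟩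
      · rintro p ⟨⟨a, b, c⟩, hM⟩ hopen
        set M := max |p 0| |p 1| with hMd
        have hM0 : 0 < M := zero_lt_one.trans hM
        have key : ∀ i, |p i| = M → False := fun i hi => by
          have := hopen i
          have h' : ((2 / M) • p) i = 2 / M * p i := rfl
          rw [h', abs_mul, hi, abs_of_pos (div_pos two_pos hM0), div_mul_cancel₀ _ hM0.ne'] at this
          exact lt_irrefl _ this
        rcases max_choice |p 0| |p 1| with h | h
        · exact key 0 h.symm
        · exact key 1 h.symm
      · rintro p ⟨⟨a, b, c⟩, hM⟩ hopen
        have hM2 : max |p 0| |p 1| = 2 := by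
          refine le_antisymm (max_le a b) (not_lt.1 fun hlt => hopen fun i => ?_)
          rw [max_lt_iff] at hlt
          fin_cases i
          · exact hlt.1
          · exact hlt.2
          · simp [c]
        simp [hM2]
    -- Near an end of the strip, `s` is the sign of the height. Excluding `s * z ≤ 0` removes the
    -- square and the other half of the strip, and the rest is pushed vertically to `z = 2 * s`.
    · obtain ⟨s, hs, hq2⟩ : ∃ s : ℝ, |s| = 1 ∧ s * κ.chart j q 2 = 2 := by
        rcases (abs_eq (by norm_num)).1 h2 with h | h
        · exact ⟨1, by norm_num, by rw [h]; norm_num⟩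
        · exact ⟨-1, by norm_num, by rw [h]; norm_num⟩
      have hss : s * s = 1 := by rw [← abs_mul_abs_self, hs, mul_one]
      refine hpull {p | s * p 2 ≤ 0} {p | p ∈ stripModel ∧ 0 < s * p 2} ?_ ?_ ?_
        (fun p hp => Or.inr hp.1) (fun p => !₂[p 0, p 1, 2 * s]) ?_ ?_ ?_ ?_
      · exact isClosed_le (by fun_prop) continuous_const
      · intro h
        have : s * κ.chart j q 2 ≤ 0 := h
        linarith
      · rintro p (⟨-, -, c⟩ | hp) hpA
        · exact absurd (by simp [c]) hpA
        · exact ⟨hp, not_le.1 hpA⟩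
      · exact (continuous_vec3 (continuous_coord 0) (continuous_coord 1)
          continuous_const).continuousOn
      · rintro p ⟨⟨a, b, c⟩, hM⟩ t ht0 ht1
        right
        refine ⟨by simp [a], ?_, ?_⟩
        · have : ((1 - t) • p + t • (!₂[p 0, p 1, 2 * s] : E3)) 1 = p 1 := by simp; ring
          rwa [this]
        · have : ((1 - t) • p + t • (!₂[p 0, p 1, 2 * s] : E3)) 2 = (1 - t) * p 2 + t * (2 * s) := by
            simp
          rw [this]
          refine (abs_add_le _ _).trans ?_
          rw [abs_mul, abs_mul, abs_mul, hs, abs_of_nonneg ht0, abs_of_nonneg (sub_nonneg.2 ht1)]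
          norm_num
          nlinarith
      · rintro p hp hopen
        have := hopen 2
        simp [abs_mul, hs] at this
      · rintro p ⟨hp, hM⟩ hopen
        have h2 : |p 2| = 2 := by
          rcases height_eq_of_notMem_openCube (Or.inr hp) hopen with h | h
          · simp [h] at hM
          · exact h
        have h3 : p 2 = 2 * s := by
          have h4 : s * p 2 = 2 := by
            rw [← abs_of_pos hM, abs_mul, hs, h2, one_mul]
          linear_combination s * h4 - p 2 * hss
        ext i
        fin_cases i <;> simp [h3]
  · push Not at hb
    refine ⟨{q | ∀ i, (q : S3) ∉ κ.ball i}, IsOpen.mem_nhds ?_ hb, fun γ hγ => ?_⟩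
    · rw [Set.ofPred_forall]
      exact isOpen_iInter_of_finite fun i =>
        (κ.isClosed_ball i).isOpen_compl.preimage continuous_subtype_val
    · have hin : ∀ t i, (γ t : S3) ∉ κ.ball i := fun t => hγ ⟨t, rfl⟩
      have hno : ∀ t i, (γ t : S3) ∉ κ.openBall i :=
        fun t i h => hin t i (κ.openBall_subset_ball i h)
      rw [κ.coneClass_of_notMem (hno 1), κ.coneClass_of_notMem (hno 0), sub_self]
      refine (QuotientAddGroup.eq_zero_iff _).2 (AddSubgroup.subset_closure (Or.inl
        ⟨γ, fun t => ⟨(γ t).2, ?_⟩, rfl⟩))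
      simpa using hno t

/-- Modulo outer classes the class of a short path is a difference of cone classes at its end
points, so the class of any chain depends only on its boundary. -/
theorem cls_mem_outerClasses {c : C1 (Set.range f)} (hc : bd _ c = 0) :
    QuotientAddGroup.mk' (B1 _) c ∈ κ.outerClasses := by
  have := eq_lift0_bd_of_local
    ((QuotientAddGroup.mk' κ.outerClasses).comp (QuotientAddGroup.mk' (B1 (Set.range f))))
    (fun c hc => by
      rw [AddMonoidHom.comp_apply, show QuotientAddGroup.mk' (B1 (Set.range f)) c = 0 from
        (QuotientAddGroup.eq_zero_iff _).2 hc, map_zero])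
    (fun q => QuotientAddGroup.mk' κ.outerClasses (κ.coneClass q)) κ.exists_nhds_pcls c
  rw [hc, map_zero] at this
  exact (QuotientAddGroup.eq_zero_iff _).1 this

end RibbonCoordinates

namespace RibbonCoordinates

variable {F : Type*} [TopologicalSpace F] {f : F → S3} (κ : RibbonCoordinates f)

/-! ### The classes of disoriented cycles -/

theorem right_mem_models {a : ℝ} (ha : |a| ≤ 2) : (!₂[a, 0, 0] : E3) ∈ squareModel ∪ stripModel :=
  horizontal_subset a ha (right_mem_segment ℝ _ _)

theorem top_mem_models {a : ℝ} (ha : |a| ≤ 2) : (!₂[0, 0, a] : E3) ∈ squareModel ∪ stripModel :=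
  vertical_subset a ha (left_mem_segment ℝ _ _)

/-- The ray from the centre of `B_j` to the boundary of the square. -/
def squareRay (j : Fin κ.num) : C(I, Set.range f) :=
  κ.ray j !₂[2, 0, 0] (right_mem_models (by norm_num))

/-- The rays from the centre of `B_j` to the two ends of the strip. -/
def stripRay (j : Fin κ.num) (b : Bool) : C(I, Set.range f) :=
  κ.ray j !₂[0, 0, if b then 2 else -2] (top_mem_models (by cases b <;> norm_num))

/-- Chains outside the balls, modulo boundaries. -/
def outsideClasses : AddSubgroup (Cls (Set.range f)) :=
  ((QuotientAddGroup.mk' (B1 (Set.range f))).comp (push1 (incl κ.outside_subset))).range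

theorem pcls_mem_outsideClasses (γ : C(I, Set.range f)) (h : ∀ t, (γ t : S3) ∈ κ.outside) :
    pcls γ ∈ κ.outsideClasses := by
  refine ⟨pathChain ⟨fun t => ⟨γ t, h t⟩, by fun_prop⟩, ?_⟩
  rw [AddMonoidHom.comp_apply, push1_pathChain]
  rfl

theorem symm_mem_outside {j : Fin κ.num} {p : E3} (hp : p ∈ squareModel ∪ stripModel)
    (h : p ∉ openCube) : (κ.chart j).symm p ∈ κ.outside := by
  refine ⟨κ.model_mem_range j hp, ?_⟩
  rw [Set.mem_iUnion]
  rintro ⟨i, hi⟩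
  have hc := model_subset_cube hp
  obtain rfl := κ.ball_unique (κ.openBall_subset_ball _ hi) (κ.symm_mem_ball hc)
  have := (κ.mem_openBall_iff.1 hi).2
  rw [κ.chart_symm hc] at this
  exact h this

/-- The rays to two points of the boundary of the ball differ by a path outside the balls if the
points can be joined in the boundary of the ball. -/
theorem pcls_ray_sub_mem (j : Fin κ.num) (g : C(I, E3))
    (hg : ∀ t, g t ∈ squareModel ∪ stripModel) (ho : ∀ t, g t ∉ openCube) {p q : E3}
    (h0 : g 0 = p) (h1 : g 1 = q) (hp : p ∈ squareModel ∪ stripModel)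
    (hq : q ∈ squareModel ∪ stripModel) :
    pcls (κ.ray j q hq) - pcls (κ.ray j p hp) ∈ κ.outsideClasses := by
  rw [← κ.pcls_modelMap_of_eq j g hg h0 h1 hp hq]
  exact κ.pcls_mem_outsideClasses _ fun t => κ.symm_mem_outside (hg t) (ho t)

/-- The edge of the square is a sphere for the sup norm of `ℝ × ℝ`, hence path connected, so one
standard ray suffices for the whole edge. -/
theorem squareRay_sub_mem (j : Fin κ.num) {p : E3} (hp : p ∈ squareModel) (ho : p ∉ openCube) :
    pcls (κ.ray j p (Or.inl hp)) - pcls (κ.squareRay j) ∈ κ.outsideClasses := by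
  have hrank : 1 < Module.rank ℝ (ℝ × ℝ) := by
    rw [← Module.finrank_eq_rank]
    simp
  have hpc := isPathConnected_sphere hrank (0 : ℝ × ℝ) (r := 2) zero_le_two
  have hsq : ∀ v : ℝ × ℝ, v ∈ Metric.sphere (0 : ℝ × ℝ) 2 → (!₂[v.1, v.2, 0] : E3) ∈ squareModel ∧
      (!₂[v.1, v.2, 0] : E3) ∉ openCube := by
    intro v hv
    rw [mem_sphere_zero_iff_norm, Prod.norm_def, Real.norm_eq_abs, Real.norm_eq_abs] at hv
    refine ⟨⟨(le_max_left _ _).trans hv.le, (le_max_right _ _).trans hv.le, by simp⟩, fun h => ?_⟩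
    have : max |v.1| |v.2| < 2 := max_lt (h 0) (h 1)
    exact this.ne hv
  have hp' : (p 0, p 1) ∈ Metric.sphere (0 : ℝ × ℝ) 2 := by
    rw [mem_sphere_zero_iff_norm, Prod.norm_def, Real.norm_eq_abs, Real.norm_eq_abs]
    refine le_antisymm (max_le hp.1 hp.2.1) (not_lt.1 fun hlt => ho fun i => ?_)
    rw [max_lt_iff] at hlt
    fin_cases i
    · exact hlt.1
    · exact hlt.2
    · simp [hp.2.2]
  obtain ⟨γ, hγ⟩ := hpc.joinedIn (2, 0) (by simp [Prod.norm_def]) (p 0, p 1) hp'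
  refine κ.pcls_ray_sub_mem j ⟨fun t => !₂[(γ t).1, (γ t).2, 0],
    continuous_vec3 (by fun_prop) (by fun_prop) continuous_const⟩
    (fun t => Or.inl (hsq _ (hγ t)).1) (fun t => (hsq _ (hγ t)).2) ?_ ?_ _ _
  · simp
  · ext i
    fin_cases i <;> simp [hp.2.2]

/-- Each end of the strip is a segment at constant height; slide along it to `y = 0`. -/
theorem stripRay_sub_mem (j : Fin κ.num) {p : E3} (hp : p ∈ stripModel) (b : Bool)
    (h : p 2 = if b then 2 else -2) :
    pcls (κ.ray j p (Or.inr hp)) - pcls (κ.stripRay j b) ∈ κ.outsideClasses := by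
  have hg : ∀ t : I, (!₂[0, (t : ℝ) * p 1, p 2] : E3) ∈ stripModel := by
    intro t
    refine ⟨by simp, ?_, hp.2.2⟩
    have h1 := hp.2.1
    change |(t : ℝ) * p 1| ≤ 1
    rw [abs_mul, abs_of_nonneg t.2.1]
    nlinarith [abs_nonneg (p 1), t.2.1, t.2.2]
  refine κ.pcls_ray_sub_mem j ⟨fun t => !₂[0, (t : ℝ) * p 1, p 2],
    continuous_vec3 continuous_const (by fun_prop) continuous_const⟩
    (fun t => Or.inr (hg t)) (fun t ho => ?_) ?_ ?_ _ _
  · have : |p 2| < 2 := ho 2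
    rw [h] at this
    cases b <;> norm_num at this
  · simp [h]
  · ext i
    fin_cases i <;> simp [hp.1]

/-- The homomorphism that forms combinations of rays. -/
def rayComb : (Fin κ.num → ℤ) × (Fin κ.num → ℤ) × (Fin κ.num → ℤ) →+ C1 (Set.range f) :=
  AddMonoidHom.mk' (fun n => ∑ j, (n.1 j • pathChain (κ.squareRay j) +
    n.2.1 j • pathChain (κ.stripRay j true) + n.2.2 j • pathChain (κ.stripRay j false))) (by
      intro a b
      rw [← Finset.sum_add_distrib]
      refine Finset.sum_congr rfl fun j _ => ?_
      simp only [Prod.fst_add, Prod.snd_add, Pi.add_apply, add_smul]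
      abel)

/-- A ray to the frontier ends on the edge of the square or on one of the two ends of the strip.
Three standard rays per singularity therefore suffice, up to paths outside the balls. -/
theorem outerClasses_le : κ.outerClasses ≤
    ((QuotientAddGroup.mk' (B1 (Set.range f))).comp κ.rayComb).range ⊔ κ.outsideClasses := by
  have hsingle : ∀ (j : Fin κ.num) (a b c : ℤ),
      κ.rayComb (Pi.single j a, Pi.single j b, Pi.single j c) = a • pathChain (κ.squareRay j) +
        b • pathChain (κ.stripRay j true) + c • pathChain (κ.stripRay j false) := by
    intro j a b c
    simp only [rayComb, AddMonoidHom.mk'_apply]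
    rw [Finset.sum_eq_single j]
    · simp
    · intro i _ hi
      simp [hi]
    · simp
  rw [outerClasses, AddSubgroup.closure_le]
  rintro x (⟨γ, hγ, rfl⟩ | ⟨j, p, hp, ho, rfl⟩)
  · exact AddSubgroup.mem_sup_right (κ.pcls_mem_outsideClasses γ hγ)
  · have key : ∀ γ : C(I, Set.range f), (∃ a b c : ℤ, pathChain γ = a • pathChain (κ.squareRay j) +
        b • pathChain (κ.stripRay j true) + c • pathChain (κ.stripRay j false)) →
        pcls (κ.ray j p hp) - pcls γ ∈ κ.outsideClasses →
        pcls (κ.ray j p hp) ∈ ((QuotientAddGroup.mk' (B1 (Set.range f))).comp κ.rayComb).range ⊔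
          κ.outsideClasses := by
      rintro γ ⟨a, b, c, h⟩ h'
      have h1 : pcls γ ∈ ((QuotientAddGroup.mk' (B1 (Set.range f))).comp κ.rayComb).range := by
        refine ⟨(Pi.single j a, Pi.single j b, Pi.single j c), ?_⟩
        rw [AddMonoidHom.comp_apply, hsingle, pcls, h]
      rw [← add_sub_cancel (pcls γ) (pcls (κ.ray j p hp))]
      exact AddSubgroup.add_mem_sup h1 h'
    rcases hp with hp | hp
    · exact key (κ.squareRay j) ⟨1, 0, 0, by simp⟩ (κ.squareRay_sub_mem j hp ho)
    · rcases height_eq_of_notMem_openCube (Or.inr hp) ho with h | h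
      · exfalso
        refine ho fun i => ?_
        fin_cases i
        · simp [hp.1]
        · exact hp.2.1.trans_lt one_lt_two
        · simp [h]
      · rcases (abs_eq (by norm_num)).1 h with h | h
        · exact key (κ.stripRay j true) ⟨0, 1, 0, by simp⟩ (κ.stripRay_sub_mem j hp true (by simp [h]))
        · exact key (κ.stripRay j false) ⟨0, 0, 1, by simp⟩
            (κ.stripRay_sub_mem j hp false (by simp [h]))

/-- The vertical segments of `ℓ_j` are reversed strip rays, and its horizontal segments are two
square rays, which agree up to a path along the edge of the square. -/
theorem cls_localChain (j : Fin κ.num) :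
    QuotientAddGroup.mk' (B1 (Set.range f)) (κ.localChain j) +
      pcls (κ.stripRay j true) + pcls (κ.stripRay j false) - 2 • pcls (κ.squareRay j) ∈
      κ.outsideClasses := by
  have h2 := right_mem_models (a := 2) (by norm_num)
  have h2' := right_mem_models (a := -2) (by norm_num)
  have h3 := top_mem_models (a := 2) (by norm_num)
  have h3' := top_mem_models (a := -2) (by norm_num)
  have hz := zero_mem_models
  have ho : (!₂[-2, 0, 0] : E3) ∉ openCube := fun h => by
    have := h 0
    norm_num at this
  have hs : (!₂[-2, 0, 0] : E3) ∈ squareModel := ⟨by simp, by simp, by simp⟩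
  have := κ.squareRay_sub_mem j hs ho
  simp only [localChain, map_add]
  rw [κ.cls_simplexChain_segmentSimplex j _ _ _ h3 hz, κ.cls_simplexChain_segmentSimplex j _ _ _ h3' hz,
    κ.cls_simplexChain_segmentSimplex j _ _ _ hz h2, κ.cls_simplexChain_segmentSimplex j _ _ _ hz h2']
  simp only [pcls_ray_zero]
  convert this using 1
  simp only [squareRay, stripRay, if_true, Bool.false_eq_true, if_false]
  abel

/-! ### The flux of rays, of local chains and of chains outside the balls. -/

theorem flux_of_mem_B1 (j : Fin κ.num) {c : C1 (Set.range f)} (hc : c ∈ B1 _) : κ.flux j c = 0 :=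
  jump_of_mem_B1 _ _ hc

theorem sawtooth_of_mem_ball_ne {i j : Fin κ.num} (h : i ≠ j) {q : S3} (hq : q ∈ κ.ball i) :
    κ.sawtooth j q = 0 :=
  κ.sawtooth_of_notMem_ball fun hj => h (κ.ball_unique hq hj)

theorem flux_modelMap_of_ne {i j : Fin κ.num} (h : i ≠ j) (g : C(I, E3)) (hg) :
    κ.flux j (pathChain (κ.modelMap i g hg)) = 0 := by
  refine jump_pathChain_of_continuous _ _ _ ?_
  have : ∀ t, κ.sawtooth j (κ.modelMap i g hg t) = 0 := fun t =>
    κ.sawtooth_of_mem_ball_ne h (κ.symm_mem_ball (model_subset_cube (hg t)))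
  simp only [this]
  exact continuous_const

theorem height_symm {j : Fin κ.num} {p : E3} (hp : p ∈ cube) :
    κ.height j ((κ.chart j).symm p) = p 2 := by
  rw [height, κ.chart_symm hp]

theorem sawtooth_symm {j : Fin κ.num} {p : E3} (hp : p ∈ cube) :
    κ.sawtooth j ((κ.chart j).symm p) = p 2 / 2 - SignType.sign (p 2) := by
  rw [sawtooth, if_pos (κ.symm_mem_ball hp), κ.height_symm hp]

/-- Half the height lifts the sawtooth along the path, so only the sign terms at the end points
survive. -/
theorem flux_modelMap (j : Fin κ.num) (g : C(I, E3)) (hg) :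
    κ.flux j (pathChain (κ.modelMap j g hg)) = SignType.sign (g 1 2) - SignType.sign (g 0 2) := by
  have hc : ∀ t, g t ∈ cube := fun t => model_subset_cube (hg t)
  have hm : ∀ t, ((κ.modelMap j g hg t : Set.range f) : S3) = (κ.chart j).symm (g t) := fun t => rfl
  rw [flux, jump_pathChain _ _ _ ⟨fun t => g t 2 / 2, by fun_prop⟩ fun t => ?_]
  · simp only [hm, κ.sawtooth_symm (hc _), ContinuousMap.coe_mk]
    ring
  · rw [hm, κ.coe_sawtooth_of_mem_ball (κ.symm_mem_ball (hc t)), κ.height_symm (hc t)]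
    rfl

theorem flux_ray (j : Fin κ.num) (p : E3) (hp) :
    κ.flux j (pathChain (κ.ray j p hp)) = SignType.sign (p 2) := by
  refine (κ.flux_modelMap j ⟨fun t : I => (t : ℝ) • p, by fun_prop⟩
    fun t => smul_mem_models hp t.2.1 t.2.2).trans ?_
  simp

theorem flux_ray_of_ne {i j : Fin κ.num} (h : i ≠ j) (p : E3) (hp) :
    κ.flux j (pathChain (κ.ray i p hp)) = 0 :=
  κ.flux_modelMap_of_ne h ⟨fun t : I => (t : ℝ) • p, by fun_prop⟩
    fun t => smul_mem_models hp t.2.1 t.2.2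

theorem flux_squareRay (i j : Fin κ.num) : κ.flux j (pathChain (κ.squareRay i)) = 0 := by
  by_cases h : i = j
  · subst h
    refine (κ.flux_ray i _ _).trans ?_
    simp
  · exact κ.flux_ray_of_ne h _ _

theorem flux_stripRay_of_ne {i j : Fin κ.num} (h : i ≠ j) (b : Bool) :
    κ.flux j (pathChain (κ.stripRay i b)) = 0 := κ.flux_ray_of_ne h _ _

theorem flux_stripRay_true (j : Fin κ.num) : κ.flux j (pathChain (κ.stripRay j true)) = 1 := by
  refine (κ.flux_ray j _ _).trans ?_
  simp

theorem flux_stripRay_false (j : Fin κ.num) : κ.flux j (pathChain (κ.stripRay j false)) = -1 := by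
  refine (κ.flux_ray j _ _).trans ?_
  simp

theorem flux_outside (j : Fin κ.num) (a : C1 κ.outside) :
    κ.flux j (push1 (incl κ.outside_subset) a) = 0 := by
  have : (κ.flux j).comp (push1 (incl κ.outside_subset)) = 0 := C1_hom_ext fun γ => by
    rw [AddMonoidHom.comp_apply, push1_pathChain]
    refine jump_pathChain_of_continuous _ _ _ ?_
    have : ∀ t, κ.sawtooth j ((incl κ.outside_subset).comp γ t) = 0 := fun t =>
      κ.sawtooth_of_notMem_openBall ((incl κ.outside_subset).comp γ t).2 fun h =>
        (γ t).2.2 (Set.mem_iUnion.2 ⟨j, h⟩)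
    simp only [this]
    exact continuous_const
  exact DFunLike.congr_fun this a

/-- The flux as a homomorphism on classes modulo boundaries. -/
def fluxCls (j : Fin κ.num) : Cls (Set.range f) →+ ℝ :=
  QuotientAddGroup.lift (B1 (Set.range f)) (κ.flux j) fun _ hc => κ.flux_of_mem_B1 j hc

theorem fluxCls_mk (j : Fin κ.num) (c : C1 (Set.range f)) :
    κ.fluxCls j (QuotientAddGroup.mk' _ c) = κ.flux j c := rfl

theorem fluxCls_outside (j : Fin κ.num) {x : Cls (Set.range f)} (hx : x ∈ κ.outsideClasses) :
    κ.fluxCls j x = 0 := by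
  obtain ⟨a, rfl⟩ := hx
  exact κ.flux_outside j a

/-- Up to homology and outside chains, `ℓ_i` contains each strip ray once, with equal coefficients.
Their fluxes `1` and `-1` cancel, and square rays have no flux. -/
theorem flux_localChain (i j : Fin κ.num) : κ.flux j (κ.localChain i) = 0 := by
  have := κ.fluxCls_outside j (κ.cls_localChain i)
  simp only [pcls, map_add, map_sub, map_nsmul, fluxCls_mk, flux_squareRay] at this
  by_cases h : i = j
  · subst h
    rw [flux_stripRay_true, flux_stripRay_false] at this
    simpa using this
  · simpa [κ.flux_stripRay_of_ne h] using this

-- This counts the centre of `B_j` in the boundary: each of the three rays starts there and ends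
-- outside the open balls.
open Classical in
theorem lift0_center_rayComb (j : Fin κ.num) (n) :
    lift0 (fun q : Set.range f => if (q : S3) = (κ.chart j).symm 0 then (1 : ℤ) else 0)
      (bd _ (κ.rayComb n)) = - (n.1 j + n.2.1 j + n.2.2 j) := by
  have hz : (0 : E3) ∈ cube := fun i => by simp
  have key : ∀ (i : Fin κ.num) (p : E3) (hp : p ∈ squareModel ∪ stripModel), p ∉ openCube →
      lift0 (fun q : Set.range f => if (q : S3) = (κ.chart j).symm 0 then (1 : ℤ) else 0)
      (bd _ (pathChain (κ.ray i p hp))) = if i = j then -1 else 0 := by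
    intro i p hp ho
    have h1 : ((κ.ray i p hp 1 : Set.range f) : S3) ≠ (κ.chart j).symm 0 := by
      intro h
      have h' := κ.symm_mem_outside (j := i) hp ho
      have e : ((κ.ray i p hp 1 : Set.range f) : S3) = (κ.chart i).symm p := by
        simp [ray, modelMap]
      rw [← e, h] at h'
      exact h'.2 (Set.mem_iUnion.2 ⟨j, ⟨0, fun i => by simp, rfl⟩⟩)
    have e0 : ((κ.ray i p hp 0 : Set.range f) : S3) = (κ.chart i).symm 0 := by
      simp [ray, modelMap]
    simp only [bd_pathChain, map_sub, lift0_pt, h1, if_false, e0]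
    by_cases hij : i = j
    · subst hij; simp
    · have : (κ.chart i).symm 0 ≠ (κ.chart j).symm 0 := fun h => hij
        (κ.ball_unique (κ.symm_mem_ball hz) (h ▸ κ.symm_mem_ball hz))
      simp [this, hij]
  have k1 : (!₂[2, 0, 0] : E3) ∉ openCube := fun h => by
    have := h 0
    norm_num at this
  have k2 : ∀ b : Bool, (!₂[0, 0, if b then 2 else -2] : E3) ∉ openCube := fun b h => by
    have : |if b then (2 : ℝ) else -2| < 2 := h 2
    cases b <;> norm_num at this
  have k3 : ∀ i, lift0 (fun q : Set.range f => if (q : S3) = (κ.chart j).symm 0 then (1 : ℤ) else 0)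
      (bd _ (pathChain (κ.squareRay i))) = if i = j then -1 else 0 := fun i => key i _ _ k1
  have k4 : ∀ i b, lift0 (fun q : Set.range f => if (q : S3) = (κ.chart j).symm 0 then (1 : ℤ) else 0)
      (bd _ (pathChain (κ.stripRay i b))) = if i = j then -1 else 0 := fun i b => key i _ _ (k2 b)
  simp only [rayComb, AddMonoidHom.mk'_apply, map_sum, map_add, map_zsmul, k3, k4]
  simp only [Finset.sum_add_distrib, smul_eq_mul, mul_ite, mul_zero, mul_neg, mul_one,
    Finset.sum_ite_eq', Finset.mem_univ, if_true]
  ring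

theorem flux_rayComb (j : Fin κ.num) (n) :
    κ.flux j (κ.rayComb n) = n.2.1 j - n.2.2 j := by
  simp only [rayComb, AddMonoidHom.mk'_apply, map_sum, map_add, map_zsmul, flux_squareRay, smul_zero,
    zero_add]
  rw [Finset.sum_eq_single j]
  · rw [flux_stripRay_true, flux_stripRay_false]
    simp [sub_eq_add_neg]
  · intro i _ hi
    rw [κ.flux_stripRay_of_ne hi, κ.flux_stripRay_of_ne hi]
    simp
  · simp

/-! ### The flux criterion for disoriented classes. -/

theorem mem_DH1_iff_exists (x : H1 (Set.range f)) : x ∈ κ.DH1 ↔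
    ∃ (n : Fin κ.num → ℤ) (a : C1 κ.outside),
      Represents (∑ j, n j • κ.localChain j + push1 (incl κ.outside_subset) a) x := by
  constructor
  · rintro ⟨z, ⟨n, a, h⟩, rfl⟩
    exact ⟨n, a, z, h, rfl⟩
  · rintro ⟨n, a, z, h, rfl⟩
    exact ⟨z, ⟨n, a, h⟩, rfl⟩

/-- A homology class is represented by a disoriented cycle if and only if, at each ribbon singularity,
the fluxes into the singularity through the two halves of the strip agree. -/
theorem mem_DH1_iff {c : C1 (Set.range f)} {x : H1 (Set.range f)} (hc : Represents c x) :
    x ∈ κ.DH1 ↔ ∀ j, κ.flux j c = 0 := by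
  rw [mem_DH1_iff_exists]
  constructor
  · rintro ⟨n, a, h⟩ j
    have := κ.flux_of_mem_B1 j ((hc.eq_iff h).1 rfl)
    rw [map_sub, sub_eq_zero] at this
    rw [this]
    simp only [map_add, map_sum, map_zsmul, flux_localChain, flux_outside]
    simp
  · intro h
    obtain ⟨_, ⟨n, rfl⟩, _, ⟨a, rfl⟩, hx⟩ := AddSubgroup.mem_sup.1
      (κ.outerClasses_le (κ.cls_mem_outerClasses hc.bd_eq))
    rw [AddMonoidHom.comp_apply, AddMonoidHom.comp_apply, ← map_add] at hx
    have hB : c - (κ.rayComb n + push1 (incl κ.outside_subset) a) ∈ B1 (Set.range f) := by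
      rw [← QuotientAddGroup.eq_zero_iff]
      exact sub_eq_zero.2 hx.symm
    -- The centre of `B_j` has coefficient zero in the boundary of the cycle, and outside chains do
    -- not see it.
    have h1 : ∀ j, n.1 j + n.2.1 j + n.2.2 j = 0 := by
      classical
      intro j
      have hbd := bd_of_mem_B1 hB
      rw [map_sub, hc.bd_eq, zero_sub, neg_eq_zero, map_add] at hbd
      have := congrArg (lift0 (fun q : Set.range f =>
        if (q : S3) = (κ.chart j).symm 0 then (1 : ℤ) else 0)) hbd
      rw [map_add, lift0_center_rayComb, map_zero, bd_push1] at this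
      have h0 : ((lift0 (fun q : Set.range f =>
          if (q : S3) = (κ.chart j).symm 0 then (1 : ℤ) else 0)).comp
          (push0 (incl κ.outside_subset))) = 0 := C0_hom_ext fun q => by
        rw [AddMonoidHom.comp_apply, push0_pt, lift0_pt, if_neg]
        · rfl
        · intro hq
          refine q.2.2 (Set.mem_iUnion.2 ⟨j, ⟨0, fun i => by simp, ?_⟩⟩)
          exact hq.symm
      have h0' := DFunLike.congr_fun h0 (bd _ a)
      rw [AddMonoidHom.comp_apply] at h0'
      rw [h0'] at this
      simp only [AddMonoidHom.zero_apply] at this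
      linarith
    -- The hypothesis on the flux balances the two strip rays.
    have h2 : ∀ j, n.2.1 j = n.2.2 j := by
      intro j
      have := κ.flux_of_mem_B1 j hB
      rw [map_sub, h j, map_add, flux_rayComb, flux_outside] at this
      have : (n.2.1 j : ℝ) = n.2.2 j := by linarith
      exact_mod_cast this
    -- With strip coefficients `n, n` and square coefficient `-2n`, the three rays form `-n • ℓ_j`
    -- up to outside chains, which explains the witness `-n.2.1` below.
    have h3 : QuotientAddGroup.mk' (B1 (Set.range f)) (κ.rayComb n + ∑ j, n.2.1 j • κ.localChain j) ∈
        κ.outsideClasses := by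
      simp only [rayComb, AddMonoidHom.mk'_apply]
      rw [← Finset.sum_add_distrib, map_sum]
      refine sum_mem fun j _ => ?_
      have := zsmul_mem (κ.cls_localChain j) (n.2.1 j)
      convert this using 1
      have e1 : n.1 j = -(2 * n.2.1 j) := by have := h1 j; rw [← h2 j] at this; linarith
      rw [e1, ← h2 j]
      simp only [map_add, map_zsmul, pcls]
      module
    obtain ⟨a', ha'⟩ := h3
    rw [AddMonoidHom.comp_apply] at ha'
    refine ⟨-n.2.1, a + a', hc.of_sub_mem ?_⟩
    rw [← QuotientAddGroup.eq_zero_iff]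
    change QuotientAddGroup.mk' (B1 (Set.range f)) _ = 0
    have hx' := hx
    simp only [map_sub, map_add, ha', ← hx, map_sum, Pi.neg_apply, neg_smul, Finset.sum_neg_distrib,
      map_neg]
    abel

end RibbonCoordinates

/-! ### Topological tools. -/

/-- Lifting a continuous map through the restriction of a continuous map to a compact set on which
it is injective. -/
theorem exists_continuous_lift {F Z Y : Type*} [TopologicalSpace F] [TopologicalSpace Z]
    [TopologicalSpace Y] [T2Space Y] {f : F → Y} (hf : Continuous f) {S : Set F} (hS : IsCompact S)
    (hinj : Set.InjOn f S) {g : Z → Y} (hg : Continuous g) (h : ∀ z, g z ∈ f '' S) :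
    ∃ l : C(Z, F), ∀ z, l z ∈ S ∧ f (l z) = g z := by
  choose l hl hl' using h
  have : CompactSpace S := isCompact_iff_compactSpace.1 hS
  have hemb : Topology.IsClosedEmbedding (S.domRestrict f) :=
    (hf.comp continuous_subtype_val).isClosedEmbedding (Set.injOn_iff_injective.1 hinj)
  have hc : Continuous fun z => (⟨l z, hl z⟩ : S) := by
    rw [hemb.isInducing.continuous_iff]
    convert hg using 1
    exact funext hl'
  exact ⟨⟨l, continuous_subtype_val.comp hc⟩, fun z => ⟨hl z, hl' z⟩⟩

/-- A continuous nowhere vanishing function on a preconnected set has constant sign. -/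
theorem IsPreconnected.pos_or_neg {Z : Type*} [TopologicalSpace Z] {S : Set Z}
    (hS : IsPreconnected S) {w : Z → ℝ} (hw : ContinuousOn w S) (h0 : ∀ z ∈ S, w z ≠ 0) :
    (∀ z ∈ S, 0 < w z) ∨ ∀ z ∈ S, w z < 0 := by
  by_contra! h
  obtain ⟨⟨a, ha, ha'⟩, b, hb, hb'⟩ := h
  obtain ⟨z, hz, hz'⟩ := hS.intermediate_value ha hb hw ⟨ha', hb'⟩
  exact h0 z hz hz'

/-- The projection of the real line onto `[-a, a]`. -/
def clamp (a t : ℝ) : ℝ := max (-a) (min a t)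

@[fun_prop] theorem continuous_clamp (a : ℝ) : Continuous (clamp a) := by
  unfold clamp; fun_prop

theorem abs_clamp_le {a : ℝ} (ha : 0 ≤ a) (t : ℝ) : |clamp a t| ≤ a := by
  rw [abs_le]
  exact ⟨le_max_left _ _, max_le (by linarith) (min_le_left _ _)⟩

theorem clamp_of_abs_le {a t : ℝ} (h : |t| ≤ a) : clamp a t = t := by
  rw [abs_le] at h
  rw [clamp, min_eq_right h.2, max_eq_right h.1]

namespace RibbonCoordinates

variable {F : Type*} [TopologicalSpace F] {f : F → S3} (κ : RibbonCoordinates f)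

/-! ### Ribbon singularities in the surface -/

/-- The properly embedded arc in the preimage of the `j`-th ribbon singularity. -/
def stripArc (j : Fin κ.num) : Set F := {x | x ∈ κ.strip j ∧ κ.height j (f x) = 0}

/-- The interior of the `j`-th strip. -/
def openStrip (j : Fin κ.num) : Set F := {x | x ∈ κ.strip j ∧ f x ∈ κ.openBall j}

/-- The interior of the `j`-th square. -/
def openSquare (j : Fin κ.num) : Set F := {x | x ∈ κ.square j ∧ f x ∈ κ.openBall j}

theorem mem_square_or_strip {j : Fin κ.num} {x : F} (h : f x ∈ κ.ball j) :
    x ∈ κ.square j ∨ x ∈ κ.strip j := by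
  have : x ∈ κ.square j ∪ κ.strip j := by
    rw [← κ.preimage_ball]
    exact h
  exact this

theorem mem_ball_of_mem_square {j : Fin κ.num} {x : F} (h : x ∈ κ.square j) : f x ∈ κ.ball j := by
  have : x ∈ f ⁻¹' ((κ.chart j).symm '' cube) := by
    rw [κ.preimage_ball]
    exact Or.inl h
  exact this

theorem mem_ball_of_mem_strip {j : Fin κ.num} {x : F} (h : x ∈ κ.strip j) : f x ∈ κ.ball j := by
  have : x ∈ f ⁻¹' ((κ.chart j).symm '' cube) := by
    rw [κ.preimage_ball]
    exact Or.inr h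
  exact this

theorem chart_mem_squareModel {j : Fin κ.num} {x : F} (h : x ∈ κ.square j) :
    κ.chart j (f x) ∈ squareModel := by
  obtain ⟨p, hp, hpx⟩ := (κ.bijOn_square j).mapsTo h
  rwa [← hpx, κ.chart_symm (model_subset_cube (Or.inl hp))]

theorem chart_mem_stripModel {j : Fin κ.num} {x : F} (h : x ∈ κ.strip j) :
    κ.chart j (f x) ∈ stripModel := by
  obtain ⟨p, hp, hpx⟩ := (κ.bijOn_strip j).mapsTo h
  rwa [← hpx, κ.chart_symm (model_subset_cube (Or.inr hp))]

theorem notMem_strip_of_mem_square {i j : Fin κ.num} {x : F} (h : x ∈ κ.square j) :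
    x ∉ κ.strip i := fun h' => by
  obtain rfl := κ.ball_unique (κ.mem_ball_of_mem_square h) (κ.mem_ball_of_mem_strip h')
  exact Set.disjoint_left.1 (κ.disjoint_square_strip j) h h'

theorem isOpen_openStrip (hf : Continuous f) (j : Fin κ.num) : IsOpen (κ.openStrip j) := by
  have : κ.openStrip j = f ⁻¹' κ.openBall j ∩ (κ.square j)ᶜ := by
    ext x
    constructor
    · exact fun h => ⟨h.2, fun h' => κ.notMem_strip_of_mem_square h' h.1⟩
    · exact fun h => ⟨(κ.mem_square_or_strip (κ.openBall_subset_ball j h.1)).resolve_left h.2, h.1⟩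
  rw [this]
  exact ((κ.isOpen_openBall j).preimage hf).inter (κ.isClosed_square j).isOpen_compl

theorem isOpen_openSquare (hf : Continuous f) (j : Fin κ.num) : IsOpen (κ.openSquare j) := by
  have : κ.openSquare j = f ⁻¹' κ.openBall j ∩ (κ.strip j)ᶜ := by
    ext x
    constructor
    · exact fun h => ⟨h.2, κ.notMem_strip_of_mem_square h.1⟩
    · exact fun h => ⟨(κ.mem_square_or_strip (κ.openBall_subset_ball j h.1)).resolve_right h.2, h.1⟩
  rw [this]
  exact ((κ.isOpen_openBall j).preimage hf).inter (κ.isClosed_strip j).isOpen_compl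

theorem arcModel_subset_openCube : arcModel ⊆ openCube := by
  rintro p ⟨a, b, c⟩ i
  fin_cases i
  · simp [a]
  · exact b.trans_lt one_lt_two
  · simp [c]

theorem mem_stripArc_iff {j : Fin κ.num} {x : F} :
    x ∈ κ.stripArc j ↔ x ∈ κ.strip j ∧ κ.chart j (f x) ∈ arcModel := by
  constructor
  · exact fun h => ⟨h.1, (κ.chart_mem_stripModel h.1).1, (κ.chart_mem_stripModel h.1).2.1, h.2⟩
  · exact fun h => ⟨h.1, h.2.2.2⟩

theorem mem_interiorArc_iff {j : Fin κ.num} {x : F} :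
    x ∈ κ.interiorArc j ↔ x ∈ κ.square j ∧ κ.chart j (f x) ∈ arcModel := by
  refine and_congr_right fun h => ⟨?_, fun h' => ⟨_, h', κ.symm_chart (κ.mem_ball_of_mem_square h)⟩⟩
  rintro ⟨p, hp, hpx⟩
  rwa [← hpx, κ.chart_symm (openCube_subset_cube (arcModel_subset_openCube hp))]

theorem stripArc_subset_openStrip (j : Fin κ.num) : κ.stripArc j ⊆ κ.openStrip j := fun _ hx =>
  ⟨hx.1, (κ.mem_openBall_iff_of_mem_ball (κ.mem_ball_of_mem_strip hx.1)).2
    (arcModel_subset_openCube (κ.mem_stripArc_iff.1 hx).2)⟩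

theorem interiorArc_subset_openSquare (j : Fin κ.num) : κ.interiorArc j ⊆ κ.openSquare j :=
  fun _ hx => ⟨hx.1, (κ.mem_openBall_iff_of_mem_ball (κ.mem_ball_of_mem_square hx.1)).2
    (arcModel_subset_openCube (κ.mem_interiorArc_iff.1 hx).2)⟩

theorem interiorArc_disjoint_stripArc {i j : Fin κ.num} {x : F} (h : x ∈ κ.interiorArc j) :
    x ∉ κ.stripArc i := fun h' => κ.notMem_strip_of_mem_square h.1 h'.1

/-- The ribbon singularity in `B_j`. -/
def arc (j : Fin κ.num) : Set S3 := (κ.chart j).symm '' arcModel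

theorem mem_arc_iff {j : Fin κ.num} {q : S3} :
    q ∈ κ.arc j ↔ q ∈ κ.ball j ∧ κ.chart j q ∈ arcModel := by
  constructor
  · rintro ⟨p, hp, rfl⟩
    have := openCube_subset_cube (arcModel_subset_openCube hp)
    exact ⟨κ.symm_mem_ball this, by rwa [κ.chart_symm this]⟩
  · exact fun h => ⟨_, h.2, κ.symm_chart h.1⟩

theorem arc_subset_openBall (j : Fin κ.num) : κ.arc j ⊆ κ.openBall j :=
  Set.image_mono arcModel_subset_openCube

theorem exists_stripArc_of_mem_arc {j : Fin κ.num} {q : S3} (h : q ∈ κ.arc j) :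
    ∃ x ∈ κ.stripArc j, f x = q := by
  obtain ⟨p, hp, rfl⟩ := h
  obtain ⟨x, hx, hxp⟩ := (κ.bijOn_strip j).surjOn ⟨p, ⟨hp.1, hp.2.1, by simp [hp.2.2]⟩, rfl⟩
  refine ⟨x, κ.mem_stripArc_iff.2 ⟨hx, ?_⟩, hxp⟩
  rwa [hxp, κ.chart_symm (openCube_subset_cube (arcModel_subset_openCube hp))]

theorem exists_interiorArc_of_mem_arc {j : Fin κ.num} {q : S3} (h : q ∈ κ.arc j) :
    ∃ x ∈ κ.interiorArc j, f x = q := by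
  obtain ⟨p, hp, rfl⟩ := h
  obtain ⟨x, hx, hxp⟩ := (κ.bijOn_square j).surjOn
    ⟨p, ⟨by simp [hp.1], hp.2.1.trans one_le_two, hp.2.2⟩, rfl⟩
  exact ⟨x, ⟨hx, p, hp, hxp.symm⟩, hxp⟩

theorem mem_arc_of_stripArc {j : Fin κ.num} {x : F} (h : x ∈ κ.stripArc j) : f x ∈ κ.arc j :=
  κ.mem_arc_iff.2 ⟨κ.mem_ball_of_mem_strip h.1, (κ.mem_stripArc_iff.1 h).2⟩

theorem mem_arc_of_interiorArc {j : Fin κ.num} {x : F} (h : x ∈ κ.interiorArc j) : f x ∈ κ.arc j :=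
  h.2

theorem stripArc_or_interiorArc {j : Fin κ.num} {x : F} (h : f x ∈ κ.arc j) :
    x ∈ κ.interiorArc j ∨ x ∈ κ.stripArc j := by
  have h' := κ.mem_arc_iff.1 h
  rcases κ.mem_square_or_strip h'.1 with hx | hx
  · exact Or.inl (κ.mem_interiorArc_iff.2 ⟨hx, h'.2⟩)
  · exact Or.inr (κ.mem_stripArc_iff.2 ⟨hx, h'.2⟩)

/-- Square and strip are each mapped injectively, so the two points lie one in each. Their common
image has `z = 0` from the square and `x = 0`, `|y| ≤ 1` from the strip. -/
theorem double_point {x y : F} (h : f x = f y) (hne : x ≠ y) :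
    ∃ j, (x ∈ κ.interiorArc j ∧ y ∈ κ.stripArc j) ∨ (y ∈ κ.interiorArc j ∧ x ∈ κ.stripArc j) := by
  obtain ⟨j, hj⟩ := κ.double_points x y h hne
  have key : ∀ x y, f x = f y → x ∈ κ.square j → y ∈ κ.strip j →
      x ∈ κ.interiorArc j ∧ y ∈ κ.stripArc j := by
    intro x y h hx hy
    have h1 := κ.chart_mem_squareModel hx
    have h2 := κ.chart_mem_stripModel hy
    have h3 : κ.chart j (f y) ∈ arcModel := ⟨h2.1, h2.2.1, by rw [← h]; exact h1.2.2⟩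
    exact ⟨κ.mem_interiorArc_iff.2 ⟨hx, by rwa [h]⟩, κ.mem_stripArc_iff.2 ⟨hy, h3⟩⟩
  refine ⟨j, ?_⟩
  rcases κ.mem_square_or_strip hj with hx | hx <;>
    rcases κ.mem_square_or_strip (show f y ∈ κ.ball j from h ▸ hj) with hy | hy
  · exact absurd ((κ.bijOn_square j).injOn hx hy h) hne
  · exact Or.inl (key x y h hx hy)
  · exact Or.inr (key y x h.symm hy hx)
  · exact absurd ((κ.bijOn_strip j).injOn hx hy h) hne

/-- A point of a properly embedded arc has the same image as a point of an interior arc. Thus the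
complement of the properly embedded arcs still covers `F_r`. -/
theorem exists_eq_of_mem_range (q : Set.range f) : ∃ x : F, (∀ j, x ∉ κ.stripArc j) ∧ f x = q := by
  obtain ⟨q, x, rfl⟩ := q
  by_cases h : ∃ j, x ∈ κ.stripArc j
  · obtain ⟨j, hj⟩ := h
    obtain ⟨y, hy, hyx⟩ := κ.exists_interiorArc_of_mem_arc (κ.mem_arc_of_stripArc hj)
    exact ⟨y, fun i => κ.interiorArc_disjoint_stripArc hy, hyx⟩
  · push Not at h
    exact ⟨x, h, rfl⟩

theorem isClosed_stripArc (hf : Continuous f) (j : Fin κ.num) : IsClosed (κ.stripArc j) := by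
  have : ContinuousOn (fun x => κ.height j (f x)) (κ.strip j) :=
    (κ.continuousOn_height j).comp hf.continuousOn fun x hx => κ.mem_ball_of_mem_strip hx
  exact this.preimage_isClosed_of_isClosed (κ.isClosed_strip j) (isClosed_singleton (x := 0))

/-- Pulled back to `F`, where square and strip are disjoint, the sawtooth is supported on the strip
and vanishes at its ends. Its only discontinuity is the change of sign of `z` across the properly
embedded arc. -/
theorem continuousAt_sawtooth (hf : Continuous f) {j : Fin κ.num} {x : F} (hx : x ∉ κ.stripArc j) :
    ContinuousAt (fun x => κ.sawtooth j (f x)) x := by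
  have hzero : ∀ y ∈ (κ.openStrip j)ᶜ, κ.sawtooth j (f y) = 0 := by
    intro y hy
    by_cases ho : f y ∈ κ.openBall j
    · refine κ.sawtooth_of_height_eq_zero (κ.chart_mem_squareModel
        ((κ.mem_square_or_strip (κ.openBall_subset_ball j ho)).resolve_right fun h => hy ⟨h, ho⟩)).2.2
    · exact κ.sawtooth_of_notMem_openBall ⟨y, rfl⟩ ho
  have hcover : Set.univ = κ.strip j ∪ (κ.openStrip j)ᶜ := by
    ext y
    by_cases h : y ∈ κ.openStrip j
    · simp [h.1]
    · simp [h]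
  rw [← continuousWithinAt_univ, hcover]
  refine ContinuousWithinAt.union ?_ ?_
  · by_cases hs : x ∈ κ.strip j
    · have h0 : κ.height j (f x) ≠ 0 := fun h => hx ⟨hs, h⟩
      have hc : ContinuousWithinAt (fun x => κ.height j (f x)) (κ.strip j) x :=
        ((κ.continuousOn_height j).comp hf.continuousOn
          fun x hx => κ.mem_ball_of_mem_strip hx) x hs
      have hsg : ContinuousWithinAt (fun x => ((SignType.sign (κ.height j (f x)) : SignType) : ℝ))
          (κ.strip j) x :=
        (continuous_of_discreteTopology (f := fun s : SignType => (s : ℝ))).continuousAt.comp_continuousWithinAt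
          (ContinuousAt.comp_continuousWithinAt (f := fun x => κ.height j (f x))
            (continuousAt_sign_of_ne_zero h0) hc)
      refine ((hc.div_const 2).sub hsg).congr (fun y hy => ?_) ?_
      · exact if_pos (κ.mem_ball_of_mem_strip hy)
      · exact if_pos (κ.mem_ball_of_mem_strip hs)
    · exact continuousWithinAt_of_notMem_closure (by rwa [(κ.isClosed_strip j).closure_eq])
  · by_cases hs : x ∈ κ.openStrip j
    · exact continuousWithinAt_of_notMem_closure (by
        rw [(κ.isOpen_openStrip hf j).isClosed_compl.closure_eq]
        exact fun h => h hs)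
    · exact (continuousWithinAt_const (b := (0 : ℝ))).congr hzero (hzero x hs)

/-! ### Parametrizations of the squares and strips -/

section Param

variable [CompactSpace F]

/-- The strip is compact and `f` is injective on it, so the model lifts to `F`; clamping extends the
parametrization to the whole plane. -/
theorem exists_stripMap (hf : Continuous f) (j : Fin κ.num) : ∃ l :
    C(ℝ × ℝ, F), ∀ p, l p ∈ κ.strip j ∧
    κ.chart j (f (l p)) = !₂[0, clamp 1 p.1, clamp 2 p.2] := by
  have hm : ∀ p : ℝ × ℝ, (!₂[0, clamp 1 p.1, clamp 2 p.2] : E3) ∈ stripModel := fun p =>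
    ⟨by simp, abs_clamp_le zero_le_one _, abs_clamp_le zero_le_two _⟩
  obtain ⟨l, hl⟩ := exists_continuous_lift hf (κ.isClosed_strip j).isCompact (κ.bijOn_strip j).injOn
    (g := fun p : ℝ × ℝ => (κ.chart j).symm !₂[0, clamp 1 p.1, clamp 2 p.2])
    (κ.continuous_symm_comp j (continuous_vec3 continuous_const (by fun_prop) (by fun_prop))
      fun p => Or.inr (hm p)) (fun p => (κ.bijOn_strip j).surjOn ⟨_, hm p, rfl⟩)
  refine ⟨l, fun p => ⟨(hl p).1, ?_⟩⟩
  rw [(hl p).2, κ.chart_symm (model_subset_cube (Or.inr (hm p)))]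

theorem exists_squareMap (hf : Continuous f) (j : Fin κ.num) : ∃ l :
    C(ℝ × ℝ, F), ∀ p, l p ∈ κ.square j ∧
    κ.chart j (f (l p)) = !₂[clamp 2 p.1, clamp 2 p.2, 0] := by
  have hm : ∀ p : ℝ × ℝ, (!₂[clamp 2 p.1, clamp 2 p.2, 0] : E3) ∈ squareModel := fun p =>
    ⟨abs_clamp_le zero_le_two _, abs_clamp_le zero_le_two _, by simp⟩
  obtain ⟨l, hl⟩ := exists_continuous_lift hf (κ.isClosed_square j).isCompact (κ.bijOn_square j).injOn
    (g := fun p : ℝ × ℝ => (κ.chart j).symm !₂[clamp 2 p.1, clamp 2 p.2, 0])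
    (κ.continuous_symm_comp j (continuous_vec3 (by fun_prop) (by fun_prop) continuous_const)
      fun p => Or.inl (hm p)) (fun p => (κ.bijOn_square j).surjOn ⟨_, hm p, rfl⟩)
  refine ⟨l, fun p => ⟨(hl p).1, ?_⟩⟩
  rw [(hl p).2, κ.chart_symm (model_subset_cube (Or.inl (hm p)))]

/-- The parametrization of the `j`-th strip. -/
def stripMap (hf : Continuous f) (j : Fin κ.num) : C(ℝ × ℝ, F) := (κ.exists_stripMap hf j).choose

/-- The parametrization of the `j`-th square. -/
def squareMap (hf : Continuous f) (j : Fin κ.num) : C(ℝ × ℝ, F) := (κ.exists_squareMap hf j).choose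

theorem stripMap_mem (hf : Continuous f) (j : Fin κ.num) (p : ℝ × ℝ) :
    κ.stripMap hf j p ∈ κ.strip j :=
  ((κ.exists_stripMap hf j).choose_spec p).1

theorem chart_stripMap (hf : Continuous f) (j : Fin κ.num) (p : ℝ × ℝ) :
    κ.chart j (f (κ.stripMap hf j p)) = !₂[0, clamp 1 p.1, clamp 2 p.2] :=
  ((κ.exists_stripMap hf j).choose_spec p).2

theorem squareMap_mem (hf : Continuous f) (j : Fin κ.num) (p : ℝ × ℝ) :
    κ.squareMap hf j p ∈ κ.square j :=
  ((κ.exists_squareMap hf j).choose_spec p).1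

theorem chart_squareMap (hf : Continuous f) (j : Fin κ.num) (p : ℝ × ℝ) :
    κ.chart j (f (κ.squareMap hf j p)) = !₂[clamp 2 p.1, clamp 2 p.2, 0] :=
  ((κ.exists_squareMap hf j).choose_spec p).2

theorem height_stripMap (hf : Continuous f) (j : Fin κ.num) (p : ℝ × ℝ) :
    κ.height j (f (κ.stripMap hf j p)) = clamp 2 p.2 := by
  rw [height, κ.chart_stripMap hf]
  rfl

theorem stripMap_chart (hf : Continuous f) {j : Fin κ.num} {x : F} (hx : x ∈ κ.strip j) :
    κ.stripMap hf j (κ.chart j (f x) 1, κ.height j (f x)) = x := by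
  refine (κ.bijOn_strip j).injOn (κ.stripMap_mem hf j _) hx ?_
  have h := κ.chart_mem_stripModel hx
  have hb := κ.mem_ball_of_mem_strip hx
  rw [← κ.symm_chart (κ.mem_ball_of_mem_strip (κ.stripMap_mem hf j _)), κ.chart_stripMap hf]
  refine (congrArg _ ?_).trans (κ.symm_chart hb)
  ext i
  fin_cases i
  · exact h.1.symm
  · exact clamp_of_abs_le h.2.1
  · exact clamp_of_abs_le h.2.2

theorem squareMap_chart (hf : Continuous f) {j : Fin κ.num} {x : F} (hx : x ∈ κ.square j) :
    κ.squareMap hf j (κ.chart j (f x) 0, κ.chart j (f x) 1) = x := by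
  refine (κ.bijOn_square j).injOn (κ.squareMap_mem hf j _) hx ?_
  have h := κ.chart_mem_squareModel hx
  have hb := κ.mem_ball_of_mem_square hx
  rw [← κ.symm_chart (κ.mem_ball_of_mem_square (κ.squareMap_mem hf j _)), κ.chart_squareMap hf]
  refine (congrArg _ ?_).trans (κ.symm_chart hb)
  ext i
  fin_cases i
  · exact clamp_of_abs_le h.1
  · exact clamp_of_abs_le h.2.1
  · exact h.2.2.symm

theorem isPreconnected_stripArc (hf : Continuous f) (j : Fin κ.num) : IsPreconnected
    (κ.stripArc j) := by
  have : κ.stripArc j = Set.range fun y : ℝ => κ.stripMap hf j (y, 0) := by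
    ext x
    constructor
    · intro hx
      refine ⟨κ.chart j (f x) 1, ?_⟩
      have := κ.stripMap_chart hf hx.1
      rwa [hx.2] at this
    · rintro ⟨y, rfl⟩
      refine ⟨κ.stripMap_mem hf j _, ?_⟩
      rw [κ.height_stripMap]
      simp [clamp]
  rw [this]
  exact isPreconnected_range (by fun_prop)

theorem isPreconnected_interiorArc (hf : Continuous f) (j : Fin κ.num) : IsPreconnected
    (κ.interiorArc j) := by
  have : κ.interiorArc j = (fun y : ℝ => κ.squareMap hf j (0, y)) '' Set.Icc (-1) 1 := by
    ext x
    constructor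
    · intro hx
      have h := (κ.mem_interiorArc_iff.1 hx).2
      refine ⟨κ.chart j (f x) 1, abs_le.1 h.2.1, ?_⟩
      have := κ.squareMap_chart hf hx.1
      rwa [h.1] at this
    · rintro ⟨y, hy, rfl⟩
      refine κ.mem_interiorArc_iff.2 ⟨κ.squareMap_mem hf j _, ?_⟩
      rw [κ.chart_squareMap]
      refine ⟨?_, ?_, rfl⟩
      · simp [clamp]
      · change |clamp 2 y| ≤ 1
        rw [clamp_of_abs_le ((abs_le.2 hy).trans one_le_two)]
        exact abs_le.2 hy
  rw [this]
  exact isPreconnected_Icc.image _ (by fun_prop)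

end Param

end RibbonCoordinates

/-! ### Comparison of coordinates around the ribbon singularities -/

/-- A rectangle minus a segment in its interior is connected. -/
theorem isPreconnected_rectangle_diff {δ : ℝ} (hδ : 0 < δ) :
    _root_.IsPreconnected ({p | |p.1| < δ ∧ |p.2| < 1 + δ ∧ (p.1 = 0 → 1 < |p.2|)} : Set (ℝ × ℝ)) := by
  have hbox : ∀ a b c d : ℝ, _root_.IsPreconnected (Set.Ioo a b ×ˢ Set.Ioo c d) := fun a b c d =>
    isPreconnected_Ioo.prod isPreconnected_Ioo
  -- The set is the union of four open boxes, right, upper, left and lower, each meeting an earlier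
  -- one in the indicated point.
  have h1 := _root_.IsPreconnected.union (s := Set.Ioo 0 δ ×ˢ Set.Ioo (-(1 + δ)) (1 + δ))
    (t := Set.Ioo (-δ) δ ×ˢ Set.Ioo 1 (1 + δ)) (δ / 2, 1 + δ / 2)
    ⟨⟨by linarith, by linarith⟩, by constructor <;> simp only <;> linarith⟩
    ⟨⟨by simp only; linarith, by simp only; linarith⟩, by constructor <;> simp only <;> linarith⟩
    (hbox _ _ _ _) (hbox _ _ _ _)
  have h2 := _root_.IsPreconnected.union (t := Set.Ioo (-δ) 0 ×ˢ Set.Ioo (-(1 + δ)) (1 + δ))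
    (-(δ / 2), 1 + δ / 2)
    (Or.inr ⟨⟨by simp only; linarith, by simp only; linarith⟩,
      by constructor <;> simp only <;> linarith⟩)
    ⟨⟨by simp only; linarith, by simp only; linarith⟩, by constructor <;> simp only <;> linarith⟩
    h1 (hbox _ _ _ _)
  have h3 := _root_.IsPreconnected.union (t := Set.Ioo (-δ) δ ×ˢ Set.Ioo (-(1 + δ)) (-1))
    (-(δ / 2), -(1 + δ / 2))
    (Or.inr ⟨⟨by simp only; linarith, by simp only; linarith⟩,
      by constructor <;> simp only <;> linarith⟩)
    ⟨⟨by simp only; linarith, by simp only; linarith⟩, by constructor <;> simp only <;> linarith⟩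
    h2 (hbox _ _ _ _)
  convert h3 using 1
  ext ⟨x, y⟩
  simp only [Set.mem_ofPred_eq, abs_lt, lt_abs, Set.mem_union, Set.mem_prod, Set.mem_Ioo]
  constructor
  · rintro ⟨⟨a, b⟩, ⟨c, d⟩, h⟩
    rcases lt_trichotomy x 0 with hx | hx | hx
    · exact Or.inl (Or.inr ⟨⟨a, hx⟩, c, d⟩)
    · by_cases hy : 1 < y
      · exact Or.inl (Or.inl (Or.inr ⟨⟨a, b⟩, hy, d⟩))
      · refine Or.inr ⟨⟨a, b⟩, c, ?_⟩
        have := (h hx).resolve_left hy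
        linarith
    · exact Or.inl (Or.inl (Or.inl ⟨⟨hx, b⟩, c, d⟩))
  · rintro (((⟨⟨a, b⟩, c, d⟩ | ⟨⟨a, b⟩, c, d⟩) | ⟨⟨a, b⟩, c, d⟩) | ⟨⟨a, b⟩, c, d⟩)
    · exact ⟨⟨by linarith, b⟩, ⟨c, d⟩, fun h => absurd h a.ne'⟩
    · exact ⟨⟨a, b⟩, ⟨by linarith, d⟩, fun _ => Or.inl c⟩
    · exact ⟨⟨a, by linarith⟩, ⟨c, d⟩, fun h => absurd h b.ne⟩
    · exact ⟨⟨a, b⟩, ⟨c, by linarith⟩, fun _ => Or.inr (by linarith)⟩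

/-- A neighbourhood of the segment `{0} × [-1, 1]` contains a rectangle. -/
theorem exists_rectangle_subset {O : Set (ℝ × ℝ)} (hO : IsOpen O)
    (h : ∀ y : ℝ, |y| ≤ 1 → (0, y) ∈ O) :
    ∃ δ > 0, ∀ p : ℝ × ℝ, |p.1| < δ → |p.2| < 1 + δ → p ∈ O := by
  have hK : IsCompact ((fun y : ℝ => ((0 : ℝ), y)) '' Set.Icc (-1) 1) :=
    isCompact_Icc.image (by fun_prop)
  obtain ⟨δ, hδ, hsub⟩ := hK.exists_thickening_subset_open hO (by
    rintro _ ⟨y, hy, rfl⟩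
    exact h y (abs_le.2 hy))
  -- The point of the segment closest to `p` is `(0, clamp 1 p.2)`.
  refine ⟨δ, hδ, fun p h1 h2 => hsub (Metric.mem_thickening_iff.2
    ⟨(0, clamp 1 p.2), ⟨_, abs_le.1 (abs_clamp_le zero_le_one _), rfl⟩, ?_⟩)⟩
  rw [Prod.dist_eq, max_lt_iff, Real.dist_eq, Real.dist_eq]
  refine ⟨by simpa using h1, ?_⟩
  rw [abs_lt] at h2 ⊢
  simp only [clamp]
  rcases le_total p.2 1 with h | h <;> rcases le_total (-1) p.2 with h' | h'
  · rw [min_eq_right h, max_eq_right h']; constructor <;> linarith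
  · rw [min_eq_right h, max_eq_left h']; constructor <;> linarith
  · rw [min_eq_left h, max_eq_right (by norm_num)]; constructor <;> linarith
  · linarith

namespace RibbonCoordinates

variable {F G : Type*} [TopologicalSpace F] [TopologicalSpace G]
  {f : F → S3} {g : G → S3} (κ : RibbonCoordinates f) (μ : RibbonCoordinates g)

theorem isPreconnected_arc [CompactSpace F] (hf : Continuous f) (j : Fin κ.num) : IsPreconnected
    (κ.arc j) := by
  have : κ.arc j = f '' κ.stripArc j := by
    ext q
    constructor
    · intro h
      obtain ⟨x, hx, hxq⟩ := κ.exists_stripArc_of_mem_arc h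
      exact ⟨x, hx, hxq⟩
    · rintro ⟨x, hx, rfl⟩
      exact κ.mem_arc_of_stripArc hx
  rw [this]
  exact (κ.isPreconnected_stripArc hf j).image _ hf.continuousOn

theorem arc_nonempty (j : Fin κ.num) : (κ.arc j).Nonempty :=
  ⟨_, 0, ⟨by simp, by simp, by simp⟩, rfl⟩

/-- An arc is connected and covered by the pairwise disjoint open balls of the other coordinate
system, so a single ball contains it. -/
theorem arc_subset_of_forall [CompactSpace F] (hf : Continuous f)
    (h : ∀ j, ∀ q ∈ κ.arc j, ∃ i, q ∈ μ.arc i)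
    (j : Fin κ.num) : ∃ i, κ.arc j ⊆ μ.arc i := by
  obtain ⟨q, hq⟩ := κ.arc_nonempty j
  obtain ⟨i, hi⟩ := h j q hq
  refine ⟨i, fun q' hq' => ?_⟩
  have hsub : κ.arc j ⊆ μ.openBall i := by
    refine (κ.isPreconnected_arc hf j).subset_left_of_subset_union (μ.isOpen_openBall i)
      (v := ⋃ k, ⋃ (_ : k ≠ i), μ.openBall k)
      (isOpen_iUnion fun k => isOpen_iUnion fun _ => μ.isOpen_openBall k) ?_ ?_
      ⟨q, hq, μ.arc_subset_openBall i hi⟩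
    · rw [Set.disjoint_left]
      intro x hx hx'
      simp only [Set.mem_iUnion] at hx'
      obtain ⟨k, hk, hxk⟩ := hx'
      exact hk (μ.ball_unique (μ.openBall_subset_ball _ hxk) (μ.openBall_subset_ball _ hx))
    · intro x hx
      obtain ⟨k, hk⟩ := h j x hx
      by_cases hki : k = i
      · exact Or.inl (hki ▸ μ.arc_subset_openBall k hk)
      · refine Or.inr ?_
        simp only [Set.mem_iUnion]
        exact ⟨k, hki, μ.arc_subset_openBall k hk⟩
  obtain ⟨k, hk⟩ := h j q' hq'
  rwa [← μ.ball_unique (μ.openBall_subset_ball _ (μ.arc_subset_openBall k hk))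
    (μ.openBall_subset_ball _ (hsub hq'))]

/-! ### Inclusions of surfaces and the correspondence of their ribbon singularities. -/

/-- The hypotheses on an inclusion `F → G` of surfaces under which the ribbon singularities of `F` and
of `G` correspond to each other. -/
structure Compatible (ι : C(F, G)) : Prop where
  continuous_left : Continuous f
  continuous_right : Continuous g
  injective : Function.Injective ι
  comp_eq : ∀ x, g (ι x) = f x
  double : ∀ y y', g y = g y' → y ≠ y' → y ∈ Set.range ι
  mem_nhds : ∀ j, ∀ x ∈ κ.stripArc j, Set.range ι ∈ nhds (ι x)

variable {κ μ} {ι : C(F, G)}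

namespace Compatible

/-- The union of the arcs is the set of images of double points, and `G` has no double points
besides those of `F`. Each arc then lies in an arc of the other surface, in both directions, and
disjointness of the balls gives equality. -/
theorem arc_eq [CompactSpace F] [CompactSpace G] (h : Compatible (g := g) κ ι) (j : Fin κ.num) :
    ∃ i, κ.arc j = μ.arc i := by
  have h1 : ∀ j, ∀ q ∈ κ.arc j, ∃ i, q ∈ μ.arc i := by
    intro j q hq
    obtain ⟨x, hx, hxq⟩ := κ.exists_stripArc_of_mem_arc hq
    obtain ⟨y, hy, hyq⟩ := κ.exists_interiorArc_of_mem_arc hq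
    have hne : ι y ≠ ι x := fun e => κ.interiorArc_disjoint_stripArc hy (h.injective e ▸ hx)
    have he : g (ι y) = g (ι x) := by rw [h.comp_eq, h.comp_eq, hxq, hyq]
    obtain ⟨i, ⟨-, hi⟩ | ⟨hi, -⟩⟩ := μ.double_point he hne
    · exact ⟨i, by rw [← hxq, ← h.comp_eq]; exact μ.mem_arc_of_stripArc hi⟩
    · exact ⟨i, by rw [← hxq, ← h.comp_eq]; exact μ.mem_arc_of_interiorArc hi⟩
  have h2 : ∀ i, ∀ q ∈ μ.arc i, ∃ j, q ∈ κ.arc j := by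
    intro j q hq
    obtain ⟨x, hx, hxq⟩ := μ.exists_stripArc_of_mem_arc hq
    obtain ⟨y, hy, hyq⟩ := μ.exists_interiorArc_of_mem_arc hq
    have hne : y ≠ x := fun e => μ.interiorArc_disjoint_stripArc hy (e ▸ hx)
    obtain ⟨x, rfl⟩ := h.double x y (hxq.trans hyq.symm) hne.symm
    obtain ⟨y, rfl⟩ := h.double y (ι x) (hyq.trans hxq.symm) hne
    rw [h.comp_eq] at hxq hyq
    obtain ⟨i, ⟨-, hi⟩ | ⟨hi, -⟩⟩ := κ.double_point (hyq.trans hxq.symm) fun e => hne (e ▸ rfl)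
    · exact ⟨i, by rw [← hxq]; exact κ.mem_arc_of_stripArc hi⟩
    · exact ⟨i, by rw [← hxq]; exact κ.mem_arc_of_interiorArc hi⟩
  obtain ⟨i, hi⟩ := κ.arc_subset_of_forall μ h.continuous_left h1 j
  obtain ⟨k, hk⟩ := μ.arc_subset_of_forall κ h.continuous_right h2 i
  obtain ⟨q, hq⟩ := κ.arc_nonempty j
  obtain rfl := κ.ball_unique (κ.openBall_subset_ball _ (κ.arc_subset_openBall _ hq))
    (κ.openBall_subset_ball _ (κ.arc_subset_openBall _ (hk (hi hq))))
  exact ⟨i, hi.antisymm hk⟩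

theorem exists_arc_eq [CompactSpace F] [CompactSpace G] (h : Compatible (g := g) κ ι)
    (i : Fin μ.num) : ∃ j, κ.arc j = μ.arc i := by
  obtain ⟨q, hq⟩ := μ.arc_nonempty i
  obtain ⟨x, hx, hxq⟩ := μ.exists_stripArc_of_mem_arc hq
  obtain ⟨y, hy, hyq⟩ := μ.exists_interiorArc_of_mem_arc hq
  have hne : y ≠ x := fun e => μ.interiorArc_disjoint_stripArc hy (e ▸ hx)
  obtain ⟨x, rfl⟩ := h.double x y (hxq.trans hyq.symm) hne.symm
  obtain ⟨y, rfl⟩ := h.double y (ι x) (hyq.trans hxq.symm) hne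
  rw [h.comp_eq] at hxq hyq
  have : ∃ j, q ∈ κ.arc j := by
    obtain ⟨i, ⟨-, hi⟩ | ⟨hi, -⟩⟩ := κ.double_point (hyq.trans hxq.symm) fun e => hne (e ▸ rfl)
    · exact ⟨i, by rw [← hxq]; exact κ.mem_arc_of_stripArc hi⟩
    · exact ⟨i, by rw [← hxq]; exact κ.mem_arc_of_interiorArc hi⟩
  obtain ⟨j, hj⟩ := this
  obtain ⟨k, hk⟩ := h.arc_eq (μ := μ) j
  obtain rfl := μ.ball_unique (μ.openBall_subset_ball _ (μ.arc_subset_openBall _ hq))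
    (μ.openBall_subset_ball _ (μ.arc_subset_openBall _ (hk ▸ hj)))
  exact ⟨j, hk⟩

/-- The inclusion is an embedding whose range is a neighbourhood of each point of a properly
embedded arc, so it is open there. -/
theorem image_mem_nhds [CompactSpace F] [T2Space G] (h : Compatible (g := g) κ ι) {j : Fin κ.num}
    {x : F} (hx : x ∈ κ.stripArc j) {U : Set F}
    (hU : U ∈ nhds x) : ι '' U ∈ nhds (ι x) := by
  have := (ι.continuous.isClosedEmbedding h.injective).isEmbedding.map_nhds_of_mem x (h.mem_nhds j x hx)
  rw [← this]
  exact Filter.image_mem_map hU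

/-- Near each point of the properly embedded arc there are points on both sides. -/
theorem exists_mem_sign [CompactSpace F] {κ : RibbonCoordinates f} (hf : Continuous f)
    {j : Fin κ.num} {x : F}
    (hx : x ∈ κ.stripArc j) {U : Set F} (hU : U ∈ nhds x) {s : ℝ} (hs : |s| = 1) :
    ∃ y ∈ U, y ∈ κ.strip j ∧ 0 < s * κ.height j (f y) := by
  have hc : Filter.Tendsto (fun z : ℝ => κ.stripMap hf j (κ.chart j (f x) 1, z)) (nhds 0) (nhds x) := by
    have h1 : Continuous fun z : ℝ => κ.stripMap hf j (κ.chart j (f x) 1, z) := by fun_prop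
    have h2 := κ.stripMap_chart hf hx.1
    rw [hx.2] at h2
    have := h1.tendsto 0
    rwa [h2] at this
  obtain ⟨δ, hδ, hball⟩ := Metric.mem_nhds_iff.1 (hc hU)
  -- The bound `δ / 2` keeps the point in `U`, and the bound `1` keeps the height within the strip,
  -- so that clamping has no effect.
  set z := s * min (δ / 2) 1 with hz
  have hm : 0 < min (δ / 2) 1 := lt_min (by linarith) one_pos
  have hza : |z| = min (δ / 2) 1 := by rw [hz, abs_mul, hs, one_mul, abs_of_pos hm]
  have hss : s * s = 1 := by rw [← abs_mul_abs_self, hs, mul_one]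
  refine ⟨κ.stripMap hf j (κ.chart j (f x) 1, z), hball ?_, κ.stripMap_mem hf j _, ?_⟩
  · rw [mem_ball_zero_iff, Real.norm_eq_abs, hza]
    exact (min_le_left _ _).trans_lt (by linarith)
  · rw [κ.height_stripMap, clamp_of_abs_le (by rw [hza]; exact (min_le_right _ _).trans one_le_two),
      hz, ← mul_assoc, hss, one_mul]
    exact hm

end Compatible

end RibbonCoordinates

namespace RibbonCoordinates

variable {F G : Type*} [TopologicalSpace F] [TopologicalSpace G]
  {f : F → S3} {g : G → S3} {κ : RibbonCoordinates f} {μ : RibbonCoordinates g} {ι : C(F, G)}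

theorem squareMap_mem_interiorArc [CompactSpace F] (hf : Continuous f) {j : Fin κ.num} {y : ℝ}
    (hy : |y| ≤ 1) : κ.squareMap hf j (0, y) ∈ κ.interiorArc j := by
  refine κ.mem_interiorArc_iff.2 ⟨κ.squareMap_mem hf j _, ?_⟩
  rw [κ.chart_squareMap hf]
  refine ⟨?_, ?_, rfl⟩
  · exact clamp_of_abs_le (by simp)
  · change |clamp 2 y| ≤ 1
    rwa [clamp_of_abs_le (hy.trans one_le_two)]

theorem stripMap_mem_stripArc [CompactSpace F] (hf : Continuous f) {j : Fin κ.num} (y : ℝ) :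
    κ.stripMap hf j (y, 0) ∈ κ.stripArc j :=
  ⟨κ.stripMap_mem hf j _, by rw [κ.height_stripMap]; exact clamp_of_abs_le (by simp)⟩

/-- The points of a square near the interior arc. -/
theorem squareNhds_mem (hf : Continuous f) {j : Fin κ.num} {x : F} (hx : x ∈ κ.interiorArc j)
    {δ : ℝ} (hδ : 0 < δ) :
    {y | y ∈ κ.openSquare j ∧ |κ.chart j (f y) 0| < δ ∧ |κ.chart j (f y) 1| < 1 + δ} ∈ nhds x := by
  have ho : κ.openSquare j ∈ nhds x :=
    (κ.isOpen_openSquare hf j).mem_nhds (κ.interiorArc_subset_openSquare j hx)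
  have hc : ContinuousAt (fun y => κ.chart j (f y)) x := by
    have : ContinuousOn (fun y => κ.chart j (f y)) (κ.openSquare j) :=
      (κ.continuousOn_chart j).comp hf.continuousOn fun y hy => κ.mem_ball_of_mem_square hy.1
    exact this.continuousAt ho
  have hi : ∀ i : Fin 3, ContinuousAt (fun y => |κ.chart j (f y) i|) x := fun i =>
    ((continuous_coord i).continuousAt.comp hc).abs
  have hm := (κ.mem_interiorArc_iff.1 hx).2
  filter_upwards [ho, (hi 0).eventually_lt_const (u := δ) (by simpa [hm.1] using hδ),
    (hi 1).eventually_lt_const (u := 1 + δ) (by linarith [hm.2.1])] with y h1 h2 h3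
  exact ⟨h1, h2, h3⟩

theorem stripNhds_mem (hf : Continuous f) {j : Fin κ.num} {x : F} (hx : x ∈ κ.stripArc j)
    {δ : ℝ} (hδ : 0 < δ) : {y | y ∈ κ.openStrip j ∧ |κ.height j (f y)| < δ} ∈ nhds x := by
  have ho : κ.openStrip j ∈ nhds x :=
    (κ.isOpen_openStrip hf j).mem_nhds (κ.stripArc_subset_openStrip j hx)
  have hc : ContinuousAt (fun y => |κ.height j (f y)|) x := by
    have : ContinuousOn (fun y => κ.height j (f y)) (κ.openStrip j) :=
      (κ.continuousOn_height j).comp hf.continuousOn fun y hy => κ.mem_ball_of_mem_strip hy.1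
    exact (this.continuousAt ho).abs
  filter_upwards [ho, hc.eventually_lt_const (u := δ) (by simpa [hx.2] using hδ)] with y h1 h2
  exact ⟨h1, h2⟩

namespace Compatible

/-- A properly embedded arc does not become an interior arc. -/
theorem not_forall_mem_interiorArc [CompactSpace F] [CompactSpace G] [T2Space G]
    (h : Compatible (g := g) κ ι) {j : Fin κ.num} {i : Fin μ.num} (hji : κ.arc j = μ.arc i)
    (hall : ∀ x ∈ κ.stripArc j, ι x ∈ μ.interiorArc i) : False := by
  have hg := h.continuous_right
  have hf := h.continuous_left
  -- Both arcs have the same image in `S³` and the square is mapped injectively, so the whole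
  -- interior arc is attained.
  have hsurj : ∀ y ∈ μ.interiorArc i, ∃ x ∈ κ.stripArc j, ι x = y := by
    intro y hy
    obtain ⟨x, hx, hxy⟩ := κ.exists_stripArc_of_mem_arc (hji ▸ μ.mem_arc_of_interiorArc hy)
    refine ⟨x, hx, (μ.bijOn_square i).injOn (hall x hx).1 hy.1 ?_⟩
    rw [h.comp_eq, hxy]
  have hO : IsOpen ((μ.squareMap hg i ⁻¹' interior (ι '' κ.openStrip j)) ∩
      ({p | |p.1| < 2} : Set (ℝ × ℝ))) :=
    (isOpen_interior.preimage (map_continuous _)).inter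
      (isOpen_lt (by fun_prop) continuous_const)
  obtain ⟨δ, hδ, hsub⟩ := exists_rectangle_subset hO fun y hy => by
    refine ⟨?_, by simp⟩
    obtain ⟨x, hx, hxy⟩ := hsurj _ (squareMap_mem_interiorArc hg hy)
    rw [Set.mem_preimage, ← hxy, mem_interior_iff_mem_nhds]
    exact h.image_mem_nhds hx ((κ.isOpen_openStrip hf j).mem_nhds
      (κ.stripArc_subset_openStrip j hx))
  have hlift : ∀ p : ℝ × ℝ, |p.1| < δ → |p.2| < 1 + δ → ∃ x ∈ κ.openStrip j,
      ι x = μ.squareMap hg i p := fun p h1 h2 =>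
    (interior_subset (s := ι '' κ.openStrip j) (hsub p h1 h2).1 :)
  have hv : ContinuousOn (fun p => κ.height j (g (μ.squareMap hg i p)))
      {p | |p.1| < δ ∧ |p.2| < 1 + δ ∧ (p.1 = 0 → 1 < |p.2|)} := by
    refine (κ.continuousOn_height j).comp (hg.comp (map_continuous _)).continuousOn ?_
    rintro p ⟨h1, h2, -⟩
    obtain ⟨x, hx, hxp⟩ := hlift p h1 h2
    change g _ ∈ κ.ball j
    rw [← hxp, h.comp_eq]
    exact κ.openBall_subset_ball j hx.2
  -- The rectangle minus the segment corresponds to points of the open strip off its properly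
  -- embedded arc, where the height does not vanish. As this set is connected, the height has
  -- constant sign on it.
  have h0 : ∀ p ∈ ({p | |p.1| < δ ∧ |p.2| < 1 + δ ∧ (p.1 = 0 → 1 < |p.2|)} : Set (ℝ × ℝ)),
      κ.height j (g (μ.squareMap hg i p)) ≠ 0 := by
    rintro p ⟨h1, h2, h3⟩ hz
    obtain ⟨x, hx, hxp⟩ := hlift p h1 h2
    rw [← hxp, h.comp_eq] at hz
    have hm := (μ.mem_interiorArc_iff.1 (hall x ⟨hx.1, hz⟩)).2
    rw [hxp, μ.chart_squareMap hg] at hm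
    have hm0 : clamp 2 p.1 = 0 := hm.1
    have hm1 : |clamp 2 p.2| ≤ 1 := hm.2.1
    rw [clamp_of_abs_le (hsub p h1 h2).2.le] at hm0
    have h4 := h3 hm0
    simp only [clamp] at hm1
    rw [abs_le] at hm1
    rw [lt_abs] at h4
    rcases h4 with h4 | h4
    · have : (1 : ℝ) < max (-2) (min 2 p.2) := lt_max_of_lt_right (lt_min one_lt_two h4)
      linarith
    · have : max (-2) (min 2 p.2) < (-1 : ℝ) :=
        max_lt (by norm_num) (lt_of_le_of_lt (min_le_right _ _) (by linarith))
      linarith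
  obtain ⟨x₀, hx₀, -⟩ := κ.exists_stripArc_of_mem_arc (κ.arc_nonempty j).some_mem
  -- Yet points on both sides of the strip lie near the arc, so both signs occur, which is the
  -- contradiction.
  have key : ∀ s : ℝ, |s| = 1 →
      ∃ p ∈ ({p | |p.1| < δ ∧ |p.2| < 1 + δ ∧ (p.1 = 0 → 1 < |p.2|)} : Set (ℝ × ℝ)),
        0 < s * κ.height j (g (μ.squareMap hg i p)) := by
    intro s hs
    obtain ⟨x, ⟨hx1, hx2, hx3⟩, hx, hsx⟩ := exists_mem_sign hf hx₀
      (ι.continuous.continuousAt (squareNhds_mem hg (hall x₀ hx₀) hδ)) hs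
    refine ⟨(μ.chart i (g (ι x)) 0, μ.chart i (g (ι x)) 1), ⟨hx2, hx3, ?_⟩, ?_⟩
    · intro hc0
      by_contra hc1
      have hint : ι x ∈ μ.interiorArc i := μ.mem_interiorArc_iff.2 ⟨hx1.1, hc0, not_lt.1 hc1,
        (μ.chart_mem_squareModel hx1.1).2.2⟩
      obtain ⟨x', hx', he⟩ := hsurj _ hint
      rw [← h.injective he, hx'.2, mul_zero] at hsx
      exact hsx.false
    · rw [μ.squareMap_chart hg hx1.1, h.comp_eq]
      exact hsx
  rcases DisorientedHomology.IsPreconnected.pos_or_neg (isPreconnected_rectangle_diff hδ) hv h0 with hp | hn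
  · obtain ⟨p, hp1, hp2⟩ := key (-1) (by simp)
    linarith [hp p hp1]
  · obtain ⟨p, hp1, hp2⟩ := key 1 (by simp)
    linarith [hn p hp1]

/-- The preimages of the square and of the strip are closed and disjoint, so the connected arc goes
entirely into one of them, and the case of the square has been excluded. -/
theorem mem_stripArc [CompactSpace F] [CompactSpace G] [T2Space G]
    (h : Compatible (g := g) κ ι) {j : Fin κ.num} {i : Fin μ.num} (hji : κ.arc j = μ.arc i) {x : F}
    (hx : x ∈ κ.stripArc j) : ι x ∈ μ.stripArc i := by
  have hor : ∀ x ∈ κ.stripArc j, ι x ∈ μ.interiorArc i ∨ ι x ∈ μ.stripArc i := fun x hx =>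
    μ.stripArc_or_interiorArc (by rw [h.comp_eq, ← hji]; exact κ.mem_arc_of_stripArc hx)
  refine (hor x hx).resolve_left fun hint => h.not_forall_mem_interiorArc hji fun y hy => ?_
  refine (hor y hy).resolve_right fun hstrip => ?_
  obtain ⟨z, hz, hz1, hz2⟩ := isPreconnected_closed_iff.1
    (κ.isPreconnected_stripArc h.continuous_left j) (ι ⁻¹' μ.square i) (ι ⁻¹' μ.strip i)
    ((μ.isClosed_square i).preimage ι.continuous) ((μ.isClosed_strip i).preimage ι.continuous)
    (fun z hz => (hor z hz).imp (fun h => h.1) fun h => h.1) ⟨x, hx, hint.1⟩ ⟨y, hy, hstrip.1⟩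
  exact Set.disjoint_left.1 (μ.disjoint_square_strip i) hz1 hz2

theorem mem_stripArc_iff [CompactSpace F] [CompactSpace G] [T2Space G]
    (h : Compatible (g := g) κ ι) {j : Fin κ.num} {i : Fin μ.num} (hji : κ.arc j = μ.arc i) {x : F} :
    ι x ∈ μ.stripArc i ↔ x ∈ κ.stripArc j := by
  refine ⟨fun hx => ?_, h.mem_stripArc hji⟩
  have hm := μ.mem_arc_of_stripArc hx
  rw [h.comp_eq, ← hji] at hm
  obtain ⟨y, hy, hyx⟩ := κ.exists_stripArc_of_mem_arc hm
  have := (μ.bijOn_strip i).injOn (h.mem_stripArc hji hy).1 hx.1 (by rw [h.comp_eq, h.comp_eq, hyx])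
  rwa [← h.injective this]

/-- Corresponding coordinates agree about the two sides of a properly embedded arc, up to a sign. -/
theorem exists_sign [CompactSpace F] [CompactSpace G] [T2Space G]
    (h : Compatible (g := g) κ ι) {j : Fin κ.num} {i : Fin μ.num} (hji : κ.arc j = μ.arc i) :
    ∃ s : ℤ, (s = 1 ∨ s = -1) ∧ ∀ x ∈ κ.stripArc j, ∀ᶠ y in nhds x,
      y ∈ κ.openStrip j ∧ ι y ∈ μ.openStrip i ∧
      ((SignType.sign (κ.height j (f y)) : SignType) : ℝ) =
        s * ((SignType.sign (μ.height i (f y)) : SignType) : ℝ) := by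
  have hg := h.continuous_right
  have hf := h.continuous_left
  -- The coordinates are exchanged so that the arc becomes `{0} × [-1, 1]`, as in
  -- `exists_rectangle_subset`.
  set σ' : C(ℝ × ℝ, F) := (κ.stripMap hf j).comp ⟨fun p => (p.2, p.1), by fun_prop⟩ with hσ'
  have hσ'h : ∀ p, κ.height j (f (σ' p)) = clamp 2 p.1 := fun p => κ.height_stripMap hf j _
  have hO : IsOpen (((fun p => ι (σ' p)) ⁻¹' μ.openStrip i) ∩ ({p | |p.1| < 2} : Set (ℝ × ℝ))) :=
    ((μ.isOpen_openStrip hg i).preimage (by fun_prop)).inter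
      (isOpen_lt (by fun_prop) continuous_const)
  obtain ⟨δ, hδ, hsub⟩ := exists_rectangle_subset hO fun y hy =>
    ⟨μ.stripArc_subset_openStrip i (h.mem_stripArc hji (stripMap_mem_stripArc hf y)), by simp⟩
  have hv : ContinuousOn (fun p => μ.height i (f (σ' p))) {p | |p.1| < δ ∧ |p.2| < 1 + δ} := by
    refine (μ.continuousOn_height i).comp (hf.comp (map_continuous _)).continuousOn ?_
    rintro p ⟨h1, h2⟩
    change f _ ∈ μ.ball i
    rw [← h.comp_eq]
    exact μ.mem_ball_of_mem_strip (hsub p h1 h2).1.1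
  have h0 : ∀ p : ℝ × ℝ, |p.1| < δ → |p.2| < 1 + δ → p.1 ≠ 0 → μ.height i (f (σ' p)) ≠ 0 := by
    intro p h1 h2 h3 hz
    rw [← h.comp_eq] at hz
    have hs : ι (σ' p) ∈ μ.stripArc i := ⟨(hsub p h1 h2).1.1, hz⟩
    have := ((h.mem_stripArc_iff hji).1 hs).2
    rw [hσ'h, clamp_of_abs_le (hsub p h1 h2).2.le] at this
    exact h3 this
  -- On each half of the rectangle the other height does not vanish and so has constant sign. The
  -- next claim shows that both signs occur, so the two halves carry opposite signs.
  have hhalf : ∀ a b : ℝ, -δ ≤ a → b ≤ δ → (∀ t ∈ Set.Ioo a b, t ≠ 0) →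
      (∀ p ∈ Set.Ioo a b ×ˢ Set.Ioo (-(1 + δ)) (1 + δ), 0 < μ.height i (f (σ' p))) ∨
      ∀ p ∈ Set.Ioo a b ×ˢ Set.Ioo (-(1 + δ)) (1 + δ), μ.height i (f (σ' p)) < 0 := by
    intro a b ha hb hab
    have hin : ∀ p ∈ Set.Ioo a b ×ˢ Set.Ioo (-(1 + δ)) (1 + δ), |p.1| < δ ∧ |p.2| < 1 + δ := by
      rintro p ⟨⟨h1, h2⟩, h3⟩
      exact ⟨abs_lt.2 ⟨by linarith, by linarith⟩, abs_lt.2 h3⟩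
    exact DisorientedHomology.IsPreconnected.pos_or_neg (isPreconnected_Ioo.prod isPreconnected_Ioo) (hv.mono hin)
      fun p hp => h0 p (hin p hp).1 (hin p hp).2 (hab _ hp.1)
  have hcoord : ∀ x ∈ κ.strip j, ∃ y : ℝ, |y| < 1 + δ ∧ σ' (κ.height j (f x), y) = x :=
    fun x hx => ⟨κ.chart j (f x) 1,
      ((κ.chart_mem_stripModel hx).2.1).trans_lt (by linarith), κ.stripMap_chart hf hx⟩
  have hev : ∀ x ∈ κ.stripArc j, ∀ᶠ y in nhds x, y ∈ κ.openStrip j ∧ ι y ∈ μ.openStrip i ∧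
      |κ.height j (f y)| < δ := by
    intro x hx
    filter_upwards [stripNhds_mem hf hx hδ, ι.continuous.continuousAt
      ((μ.isOpen_openStrip hg i).mem_nhds (μ.stripArc_subset_openStrip i (h.mem_stripArc hji hx)))]
      with y h1 h2
    exact ⟨h1.1, h2, h1.2⟩
  obtain ⟨x₀, hx₀, -⟩ := κ.exists_stripArc_of_mem_arc (κ.arc_nonempty j).some_mem
  have hboth : ∀ s : ℝ, |s| = 1 → ∃ p : ℝ × ℝ, |p.1| < δ ∧ |p.2| < 1 + δ ∧ p.1 ≠ 0 ∧
      0 < s * μ.height i (f (σ' p)) := by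
    intro s hs
    obtain ⟨_, ⟨x, hx, rfl⟩, hx2, hx3⟩ := exists_mem_sign hg (h.mem_stripArc hji hx₀)
      (h.image_mem_nhds hx₀ (hev x₀ hx₀)) hs
    obtain ⟨y, hy, hxy⟩ := hcoord x hx.1.1
    refine ⟨(κ.height j (f x), y), hx.2.2, hy, fun h00 => ?_, ?_⟩
    · have := (h.mem_stripArc hji (show x ∈ κ.stripArc j from ⟨hx.1.1, h00⟩)).2
      rw [this, mul_zero] at hx3
      exact hx3.false
    · rwa [hxy, ← h.comp_eq]
  have hdec : ∀ p : ℝ × ℝ, |p.1| < δ → |p.2| < 1 + δ → p.1 ≠ 0 →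
      p ∈ Set.Ioo 0 δ ×ˢ Set.Ioo (-(1 + δ)) (1 + δ) ∨
      p ∈ Set.Ioo (-δ) 0 ×ˢ Set.Ioo (-(1 + δ)) (1 + δ) := by
    intro p h1 h2 h3
    rw [abs_lt] at h1 h2
    rcases lt_or_gt_of_ne h3 with h4 | h4
    · exact Or.inr ⟨⟨h1.1, h4⟩, h2⟩
    · exact Or.inl ⟨⟨h4, h1.2⟩, h2⟩
  obtain ⟨s, hs, hsp, hsn⟩ : ∃ s : ℤ, (s = 1 ∨ s = -1) ∧
      (∀ p ∈ Set.Ioo 0 δ ×ˢ Set.Ioo (-(1 + δ)) (1 + δ), 0 < s * μ.height i (f (σ' p))) ∧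
      ∀ p ∈ Set.Ioo (-δ) 0 ×ˢ Set.Ioo (-(1 + δ)) (1 + δ), s * μ.height i (f (σ' p)) < 0 := by
    rcases hhalf 0 δ (by linarith) le_rfl (fun t ht => ht.1.ne') with hp | hp <;>
      rcases hhalf (-δ) 0 le_rfl hδ.le (fun t ht => ht.2.ne) with hn | hn
    · obtain ⟨p, h1, h2, h3, h4⟩ := hboth (-1) (by simp)
      rcases hdec p h1 h2 h3 with hd | hd
      · linarith [hp p hd]
      · linarith [hn p hd]
    · exact ⟨1, Or.inl rfl, fun p h => by simpa using hp p h, fun p h => by simpa using hn p h⟩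
    · exact ⟨-1, Or.inr rfl, fun p h => by simpa using hp p h, fun p h => by simpa using hn p h⟩
    · obtain ⟨p, h1, h2, h3, h4⟩ := hboth 1 (by simp)
      rcases hdec p h1 h2 h3 with hd | hd
      · linarith [hp p hd]
      · linarith [hn p hd]
  refine ⟨s, hs, fun x hx => ?_⟩
  filter_upwards [hev x hx] with y hy
  refine ⟨hy.1, hy.2.1, ?_⟩
  obtain ⟨z, hz, hyz⟩ := hcoord y hy.1.1
  by_cases hy0 : κ.height j (f y) = 0
  · have := (h.mem_stripArc hji (show y ∈ κ.stripArc j from ⟨hy.1.1, hy0⟩)).2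
    rw [h.comp_eq] at this
    rw [hy0, this]
    simp
  · rcases hdec (κ.height j (f y), z) hy.2.2 hz hy0 with hd | hd
    · have h1 := hsp _ hd
      rw [hyz] at h1
      rw [sign_pos hd.1.1]
      rcases hs with rfl | rfl
      · rw [sign_pos (by simpa using h1)]; simp
      · rw [sign_neg (by simpa using h1)]; simp
    · have h1 := hsn _ hd
      rw [hyz] at h1
      rw [sign_neg hd.1.2]
      rcases hs with rfl | rfl
      · rw [sign_neg (by simpa using h1)]; simp
      · rw [sign_pos (by simpa using h1)]; simp

/-- Near the arc the sign terms of the two sawtooth functions cancel and only the continuous heights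
remain; away from it both functions are continuous separately. -/
theorem continuous_sawtooth_sub [CompactSpace F] [CompactSpace G] [T2Space G]
    (h : Compatible (g := g) κ ι) {j : Fin κ.num} {i : Fin μ.num} (hji : κ.arc j = μ.arc i) :
    ∃ s : ℤ, (s = 1 ∨ s = -1) ∧
      Continuous fun x => κ.sawtooth j (f x) - s * μ.sawtooth i (f x) := by
  have hg := h.continuous_right
  have hf := h.continuous_left
  obtain ⟨s, hs, hx⟩ := h.exists_sign hji
  refine ⟨s, hs, continuous_iff_continuousAt.2 fun x => ?_⟩
  by_cases hxs : x ∈ κ.stripArc j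
  · have hc : ContinuousAt (fun y => κ.height j (f y) / 2 - s * (μ.height i (f y) / 2)) x := by
      have h1 : ContinuousOn (fun y => κ.height j (f y)) (κ.openStrip j) :=
        (κ.continuousOn_height j).comp hf.continuousOn fun y hy => κ.mem_ball_of_mem_strip hy.1
      have h2 : ContinuousOn (fun y => μ.height i (f y)) (ι ⁻¹' μ.openStrip i) :=
        (μ.continuousOn_height i).comp hf.continuousOn fun y hy => by
          rw [← h.comp_eq]; exact μ.mem_ball_of_mem_strip hy.1
      have h3 := h1.continuousAt ((κ.isOpen_openStrip hf j).mem_nhds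
        (κ.stripArc_subset_openStrip j hxs))
      have h4 := h2.continuousAt (((μ.isOpen_openStrip hg i).preimage ι.continuous).mem_nhds
        (μ.stripArc_subset_openStrip i (h.mem_stripArc hji hxs)))
      exact (h3.div_const 2).sub (continuousAt_const.mul (h4.div_const 2))
    refine hc.congr ?_
    filter_upwards [hx x hxs] with y hy
    have e1 : κ.sawtooth j (f y) = κ.height j (f y) / 2 - SignType.sign (κ.height j (f y)) :=
      if_pos (κ.mem_ball_of_mem_strip hy.1.1)
    have e2 : μ.sawtooth i (f y) = μ.height i (f y) / 2 - SignType.sign (μ.height i (f y)) :=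
      if_pos (by rw [← h.comp_eq]; exact μ.mem_ball_of_mem_strip hy.2.1.1)
    rw [e1, e2, hy.2.2]
    ring
  · refine (κ.continuousAt_sawtooth hf hxs).sub (continuousAt_const.mul ?_)
    have h1 := (μ.continuousAt_sawtooth hg (fun hh => hxs ((h.mem_stripArc_iff hji).1 hh))).comp
      ι.continuous.continuousAt
    refine h1.congr (Filter.Eventually.of_forall fun y => ?_)
    simp [h.comp_eq]

theorem range_subset (h : Compatible (g := g) κ ι) : Set.range f ⊆ Set.range g := by
  rintro _ ⟨x, rfl⟩
  exact ⟨ι x, h.comp_eq x⟩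

/-- The difference of the sawtooth functions lives on `F_r`, but `F → F_r` is a quotient map, so its
continuity can be checked on `F`, where the two branches at a singularity are apart. -/
theorem flux_push1 [CompactSpace F] [CompactSpace G] [T2Space G]
    (h : Compatible (g := g) κ ι) {j : Fin κ.num} {i : Fin μ.num} (hji : κ.arc j = μ.arc i) :
    ∃ s : ℤ, (s = 1 ∨ s = -1) ∧ ∀ c : C1 (Set.range f),
      κ.flux j c = s * μ.flux i (push1 (incl h.range_subset) c) := by
  obtain ⟨s, hs, hc⟩ := h.continuous_sawtooth_sub hji
  refine ⟨s, hs, fun c => ?_⟩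
  have hq : Topology.IsQuotientMap (Set.rangeFactorization f) :=
    (h.continuous_left.subtype_mk _).isClosedMap.isQuotientMap (h.continuous_left.subtype_mk _)
      Set.rangeFactorization_surjective
  rw [flux, flux, jump_push1]
  refine jump_eq_of_continuous _ _ _ _ s ?_ c
  rw [hq.continuous_iff]
  exact hc

theorem mem_DH1_iff [CompactSpace F] [CompactSpace G] [T2Space G]
    (h : Compatible (g := g) κ ι) (x : H1 (Set.range f)) :
    H1map (incl h.range_subset) x ∈ μ.DH1 ↔ x ∈ κ.DH1 := by
  obtain ⟨c, hc⟩ := exists_represents x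
  rw [κ.mem_DH1_iff hc, μ.mem_DH1_iff (hc.push _)]
  constructor
  · intro hi j
    obtain ⟨i, hji⟩ := h.arc_eq j
    obtain ⟨s, -, hs⟩ := h.flux_push1 hji
    rw [hs, hi, mul_zero]
  · intro hj i
    obtain ⟨j, hji⟩ := h.exists_arc_eq i
    obtain ⟨s, hs0, hs⟩ := h.flux_push1 hji
    have := hs c
    rw [hj] at this
    rcases hs0 with rfl | rfl <;> simpa using this.symm

end Compatible

/-- With the identity as inclusion, the comparison applies to two systems of coordinates for the
same surface. -/
theorem compatible_id [CompactSpace F] [T2Space F] (hf : Continuous f) (κ : RibbonCoordinates f) :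
    Compatible (g := f) κ (ContinuousMap.id F) where
  continuous_left := hf
  continuous_right := hf
  injective := Function.injective_id
  comp_eq _ := rfl
  double y _ _ _ := ⟨y, rfl⟩
  mem_nhds _ _ _ := by simp

end RibbonCoordinates

/-! ### Angles with the same regular fibre -/

/-- The representative in `(a, a + 1]` of a point of the circle `ℝ/ℤ`. -/
def rep (a : ℝ) (t : UnitAddCircle) : ℝ := (AddCircle.equivIoc (1 : ℝ) a t : ℝ)

theorem rep_coe {a s : ℝ} (hs : s ∈ Set.Ioc a (a + 1)) : rep a (s : UnitAddCircle) = s := by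
  have h : AddCircle.equivIoc (1 : ℝ) a (s : UnitAddCircle) = ⟨s, hs⟩ := by
    rw [← Equiv.eq_symm_apply]
    rfl
  rw [rep, h]

theorem coe_rep (a : ℝ) (t : UnitAddCircle) : (rep a t : UnitAddCircle) = t :=
  (AddCircle.equivIoc (1 : ℝ) a).symm_apply_apply t

theorem rep_mem (a : ℝ) (t : UnitAddCircle) : rep a t ∈ Set.Ioc a (a + 1) :=
  (AddCircle.equivIoc (1 : ℝ) a t).2

theorem continuousAt_rep {a : ℝ} {t : UnitAddCircle} (h : t ≠ a) : ContinuousAt (rep a) t :=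
  continuous_subtype_val.continuousAt.comp (AddCircle.continuousAt_equivIoc (1 : ℝ) a h)

/-- The representative that jumps at `1/2` is the one continuous there, minus an indicator of the
side. This isolates the crossing of the fibre over `1/2`. -/
theorem rep_neg_half (t : UnitAddCircle) :
    rep (-(1 / 2)) t = rep 0 t - if 1 / 2 < rep 0 t then 1 else 0 := by
  obtain ⟨h0, h1⟩ := rep_mem 0 t
  conv_lhs => rw [← coe_rep 0 t]
  split_ifs with h
  · have : ((rep 0 t : ℝ) : UnitAddCircle) = ((rep 0 t - 1 : ℝ) : UnitAddCircle) := by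
      rw [AddCircle.coe_sub, AddCircle.coe_period, sub_zero]
    rw [this, rep_coe ⟨by linarith, by linarith⟩]
  · rw [sub_zero, rep_coe ⟨by linarith, by linarith⟩]

theorem coe_neg_half : ((-(1 / 2) : ℝ) : UnitAddCircle) = ((1 / 2 : ℝ) : UnitAddCircle) := by
  have : ((1 / 2 : ℝ) : UnitAddCircle) = ((-(1 / 2) + 1 : ℝ) : UnitAddCircle) := by norm_num
  rw [this, AddCircle.coe_add, AddCircle.coe_period, add_zero]

theorem half_ne_zero : ((1 / 2 : ℝ) : UnitAddCircle) ≠ ((0 : ℝ) : UnitAddCircle) := fun h => by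
  have h1 := rep_coe (a := 0) (s := 1 / 2) ⟨by norm_num, by norm_num⟩
  have h2 := rep_coe (a := 0) (s := 1) ⟨by norm_num, by norm_num⟩
  rw [AddCircle.coe_period] at h2
  rw [h] at h1
  rw [show ((0 : ℝ) : UnitAddCircle) = 0 from rfl, h2] at h1
  norm_num at h1

/-- Two maps to the circle have the same winding numbers if they have the same fibre over `1/2` and
cross it in the same direction. -/
theorem windingNumber_congr {X : Type} [TopologicalSpace X] (θ θ' : C(X, UnitAddCircle))
    (h : ∀ x, θ x = ((1 / 2 : ℝ) : UnitAddCircle) ↔ θ' x = ((1 / 2 : ℝ) : UnitAddCircle))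
    (hs : ∀ x, θ x = ((1 / 2 : ℝ) : UnitAddCircle) →
      ∀ᶠ y in nhds x, (1 / 2 < rep 0 (θ y) ↔ 1 / 2 < rep 0 (θ' y)))
    (z : H1 X) : windingNumber θ z = windingNumber θ' z := by
  obtain ⟨c, hc⟩ := exists_represents z
  have hmod : ∀ θ : C(X, UnitAddCircle), (fun x => (rep (-(1 / 2)) (θ x) : UnitAddCircle)) = θ :=
    fun θ => funext fun x => coe_rep _ _
  have hcont : ∀ θ : C(X, UnitAddCircle),
      Continuous fun x => (rep (-(1 / 2)) (θ x) : UnitAddCircle) := fun θ => by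
    rw [hmod]; exact θ.continuous
  have hm : ∀ θ : C(X, UnitAddCircle), modInt (fun x => rep (-(1 / 2)) (θ x)) (hcont θ) = θ :=
    fun θ => ContinuousMap.ext fun x => coe_rep _ _
  have hj : ∀ θ : C(X, UnitAddCircle), (windingNumber θ z : ℝ) =
      jump (fun x => rep (-(1 / 2)) (θ x)) (hcont θ) c := fun θ => by
    rw [← hc.windingNumber_eq_jump, hm]
  -- Off the common fibre both representatives are continuous. On it, the representatives in `(0,
  -- 1]` are, and the indicators by which they differ from the present ones agree nearby and cancel.
  have hd : Continuous fun x => rep (-(1 / 2)) (θ x) - (1 : ℤ) * rep (-(1 / 2)) (θ' x) := by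
    refine continuous_iff_continuousAt.2 fun x => ?_
    by_cases hx : θ x = ((1 / 2 : ℝ) : UnitAddCircle)
    · have h1 : ContinuousAt (fun y => rep 0 (θ y)) x :=
        (continuousAt_rep (by rw [hx]; exact half_ne_zero)).comp θ.continuous.continuousAt
      have h2 : ContinuousAt (fun y => rep 0 (θ' y)) x :=
        (continuousAt_rep (by rw [(h x).1 hx]; exact half_ne_zero)).comp θ'.continuous.continuousAt
      refine (h1.sub h2).congr ?_
      filter_upwards [hs x hx] with y hy
      rw [rep_neg_half, rep_neg_half]
      simp only [hy, Int.cast_one, one_mul, Pi.sub_apply]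
      ring
    · have h1 : ContinuousAt (fun y => rep (-(1 / 2)) (θ y)) x :=
        (continuousAt_rep (by rw [coe_neg_half]; exact hx)).comp θ.continuous.continuousAt
      have h2 : ContinuousAt (fun y => rep (-(1 / 2)) (θ' y)) x :=
        (continuousAt_rep (by rw [coe_neg_half]; exact fun h' => hx ((h x).2 h'))).comp
          θ'.continuous.continuousAt
      exact h1.sub (continuousAt_const.mul h2)
  have := jump_eq_of_continuous _ _ (hcont θ) (hcont θ') 1 hd c
  rw [← hj, ← hj, Int.cast_one, one_mul] at this
  exact_mod_cast this

namespace VirtualBands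

variable {F : RibbonSurface.{u}} {κ : RibbonCoordinates F.toFun} (W : VirtualBands.{u, v} F κ)

/-! ### The image of a surface with bands as a quotient -/

/-- Bands are embedded and meet `F_r` only along attaching arcs, so they create no double points.
The attaching arcs lie in the cut surface, hence `G` agrees with `F` near the properly embedded
arcs. -/
theorem compatible : RibbonCoordinates.Compatible (g := W.G.toFun) κ W.inclusion where
  continuous_left := F.smooth.continuous
  continuous_right := W.G.smooth.continuous
  injective := W.inclusion_injective
  comp_eq := W.toFun_inclusion
  double y y' h hne := by
    rcases W.cover y with hy | ⟨b, p, rfl⟩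
    · exact hy
    · rcases W.cover y' with ⟨x, rfl⟩ | ⟨b', p', rfl⟩
      · rw [W.toFun_inclusion] at h
        obtain ⟨x', -, hx'⟩ := W.band_attached b p (W.band_inter b p ⟨x, h.symm⟩)
        exact ⟨x', hx'⟩
      · obtain ⟨rfl, rfl⟩ := W.band_embedded _ _ _ _ h
        exact absurd rfl hne
  mem_nhds j x hx := by
    have hcl : IsClosed (⋃ b, Set.range (W.band b)) :=
      isClosed_iUnion_of_finite fun b => (isCompact_range (W.band b).continuous).isClosed
    refine Filter.mem_of_superset (hcl.isOpen_compl.mem_nhds ?_) ?_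
    · simp only [Set.mem_compl_iff, Set.mem_iUnion, not_exists]
      rintro b ⟨p, hp⟩
      obtain ⟨x', ⟨-, hx'⟩, he⟩ := W.band_attached b p
        (W.band_inter b p ⟨x, by rw [hp, W.toFun_inclusion]⟩)
      rw [hp] at he
      rw [W.inclusion_injective he] at hx'
      have h1 := hx' j hx.1
      have h2 : κ.chart j (F.toFun x) 2 = 0 := hx.2
      rw [h2, abs_zero] at h1
      linarith [W.r_pos]
    · intro y hy
      rcases W.cover y with hy' | ⟨b, p, rfl⟩
      · exact hy'
      · exact (hy (Set.mem_iUnion_of_mem b (Set.mem_range_self p))).elim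

/-- The inclusion `F_r → G_r`. -/
def inc : C(F.image, W.G.image) := incl (W.compatible.range_subset)

/-- A band in `G_r`. -/
def bandMap (b : Fin W.num) : C(I × I, W.G.image) :=
  ⟨fun p => ⟨W.G.toFun (W.band b p), Set.mem_range_self _⟩,
    (W.G.smooth.continuous.comp (W.band b).continuous).subtype_mk _⟩

theorem coe_bandMap (b : Fin W.num) (p : I × I) :
    (W.bandMap b p : S3) = W.G.toFun (W.band b p) := rfl

theorem inc_injective : Function.Injective W.inc := fun _ _ h =>
  Subtype.ext (congrArg (Subtype.val : W.G.image → S3) h)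

theorem bandMap_inj {b b' : Fin W.num} {p p' : I × I} (h : W.bandMap b p = W.bandMap b' p') :
    b = b' ∧ p = p' := W.band_embedded _ _ _ _ (congrArg Subtype.val h)

theorem fst_of_bandMap_eq_inc {b : Fin W.num} {p : I × I} {x : F.image}
    (h : W.bandMap b p = W.inc x) : p.1 = 0 ∨ p.1 = 1 :=
  W.band_inter b p (by rw [← coe_bandMap, h]; exact x.2)

theorem exists_attached (b : Fin W.num) {p : I × I} (h : p.1 = 0 ∨ p.1 = 1) :
    ∃ x ∈ κ.cutSurface W.r, W.inclusion x = W.band b p ∧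
      W.bandMap b p = W.inc ⟨F.toFun x, x, rfl⟩ := by
  obtain ⟨x, ⟨-, hx⟩, he⟩ := W.band_attached b p h
  exact ⟨x, hx, he, Subtype.ext (by rw [coe_bandMap, ← he, W.toFun_inclusion]; rfl)⟩

theorem inc_or_bandMap (q : W.G.image) : (∃ x, W.inc x = q) ∨ ∃ b p, W.bandMap b p = q := by
  obtain ⟨_, y, rfl⟩ := q
  rcases W.cover y with ⟨x, rfl⟩ | ⟨b, p, rfl⟩
  · exact Or.inl ⟨⟨F.toFun x, x, rfl⟩, Subtype.ext (W.toFun_inclusion x).symm⟩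
  · exact Or.inr ⟨b, p, rfl⟩

/-- This is a continuous surjection from a compact space onto a Hausdorff space. -/
theorem isQuotientMap_glue : Topology.IsQuotientMap
    (Sum.elim W.inc fun s : Σ _ : Fin W.num, I × I => W.bandMap s.1 s.2) := by
  have : CompactSpace F.image := isCompact_iff_compactSpace.1 (isCompact_range F.smooth.continuous)
  have hc : Continuous (Sum.elim W.inc fun s : Σ _ : Fin W.num, I × I => W.bandMap s.1 s.2) :=
    W.inc.continuous.sumElim (continuous_sigma fun b => (W.bandMap b).continuous)
  refine hc.isClosedMap.isQuotientMap hc fun q => ?_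
  rcases W.inc_or_bandMap q with ⟨x, hx⟩ | ⟨b, p, hp⟩
  · exact ⟨Sum.inl x, hx⟩
  · exact ⟨Sum.inr ⟨b, p⟩, hp⟩

theorem continuous_iff_glue {Y : Type*} [TopologicalSpace Y] {h : W.G.image → Y} :
    Continuous h ↔ (Continuous fun x => h (W.inc x)) ∧
      ∀ b, Continuous fun p => h (W.bandMap b p) := by
  rw [W.isQuotientMap_glue.continuous_iff, continuous_sum_dom, continuous_sigma_iff]
  rfl

theorem isOpen_iff_glue {U : Set W.G.image} : IsOpen U ↔ IsOpen (W.inc ⁻¹' U) ∧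
      ∀ b, IsOpen (W.bandMap b ⁻¹' U) := by
  rw [← W.isQuotientMap_glue.isOpen_preimage, isOpen_sum_iff, isOpen_sigma_iff]
  rfl

/-- Maps out of `G_r` are obtained by gluing maps out of `F_r` and out of the bands. -/
theorem exists_glue {Y : Type*} [TopologicalSpace Y] (h₀ : C(F.image, Y))
    (hb : Fin W.num → C(I × I, Y))
    (hag : ∀ b p x, W.bandMap b p = W.inc x → hb b p = h₀ x) :
    ∃ h : C(W.G.image, Y), (∀ x, h (W.inc x) = h₀ x) ∧ ∀ b p, h (W.bandMap b p) = hb b p := by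
  have : ∀ q : W.G.image, ∃ y, (∀ x, W.inc x = q → y = h₀ x) ∧
      ∀ b p, W.bandMap b p = q → y = hb b p := by
    intro q
    by_cases hq : ∃ x, W.inc x = q
    · obtain ⟨x, rfl⟩ := hq
      exact ⟨h₀ x, fun x' hx' => by rw [W.inc_injective hx'], fun b p h => (hag b p x h).symm⟩
    · obtain ⟨b, p, rfl⟩ := (W.inc_or_bandMap q).resolve_left hq
      refine ⟨hb b p, fun x hx => absurd ⟨x, hx⟩ hq, fun b' p' h' => ?_⟩
      obtain ⟨rfl, rfl⟩ := W.bandMap_inj h'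
      rfl
  choose h h1 h2 using this
  have e1 : ∀ x, h (W.inc x) = h₀ x := fun x => h1 _ x rfl
  have e2 : ∀ b p, h (W.bandMap b p) = hb b p := fun b p => h2 _ b p rfl
  refine ⟨⟨h, W.continuous_iff_glue.2 ⟨?_, fun b => ?_⟩⟩, e1, e2⟩
  · simp only [e1]; exact h₀.continuous
  · simp only [e2]; exact (hb b).continuous

/-! ### The angle of a band -/

/-- The coordinate along the band is zero modulo `ℤ` at both ends, so it glues with the constant
zero. -/
theorem exists_bandAngle (b : Fin W.num) : ∃ θ : C(W.G.image, UnitAddCircle),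
    (∀ x, θ (W.inc x) = 0) ∧ ∀ b' p, θ (W.bandMap b' p) =
      if b' = b then ((p.1 : ℝ) : UnitAddCircle) else 0 := by
  refine W.exists_glue (.const _ 0)
    (fun b' => if b' = b then ⟨fun p => ((p.1 : ℝ) : UnitAddCircle),
      (AddCircle.continuous_mk' (1 : ℝ)).comp (by fun_prop)⟩ else .const _ 0) ?_ |>.imp ?_
  · intro b' p x h
    split_ifs with hb
    · rcases W.fst_of_bandMap_eq_inc h with h1 | h1
      · change ((p.1 : ℝ) : UnitAddCircle) = 0
        rw [h1]
        rfl
      · change ((p.1 : ℝ) : UnitAddCircle) = 0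
        rw [h1]
        exact AddCircle.coe_period 1
    · rfl
  · rintro θ ⟨h1, h2⟩
    refine ⟨h1, fun b' p => ?_⟩
    rw [h2]
    split_ifs <;> rfl

/-- The angle of a band: it increases from `0` to `1` along the band. -/
def bandAngle (b : Fin W.num) : C(W.G.image, UnitAddCircle) := (W.exists_bandAngle b).choose

theorem bandAngle_inc (b : Fin W.num) (x : F.image) : W.bandAngle b (W.inc x) = 0 :=
  (W.exists_bandAngle b).choose_spec.1 x

theorem bandAngle_bandMap (b b' : Fin W.num) (p : I × I) : W.bandAngle b (W.bandMap b' p) =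
    if b' = b then ((p.1 : ℝ) : UnitAddCircle) else 0 :=
  (W.exists_bandAngle b).choose_spec.2 b' p

theorem bandAngle_eq_half_iff {b : Fin W.num} {q : W.G.image} :
    W.bandAngle b q = ((1 / 2 : ℝ) : UnitAddCircle) ↔ ∃ t, W.bandMap b (half, t) = q := by
  constructor
  · intro h
    rcases W.inc_or_bandMap q with ⟨x, rfl⟩ | ⟨b', p, rfl⟩
    · rw [W.bandAngle_inc] at h
      exact absurd h.symm half_ne_zero
    · rw [W.bandAngle_bandMap] at h
      split_ifs at h with hb
      · subst hb
        refine ⟨p.2, congrArg _ (Prod.ext (Subtype.ext ?_) rfl)⟩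
        by_cases h0 : p.1 = 0
        · rw [h0] at h
          exact absurd h.symm half_ne_zero
        · have h1 := rep_coe (a := 0) (s := 1 / 2) ⟨by norm_num, by norm_num⟩
          have h2 := rep_coe (a := 0) (s := p.1) ⟨unitInterval.pos_iff_ne_zero.2 h0, by
            rw [zero_add]; exact p.1.2.2⟩
          rw [h, h1] at h2
          exact h2
      · exact absurd h.symm half_ne_zero
  · rintro ⟨t, rfl⟩
    rw [W.bandAngle_bandMap, if_pos rfl]
    rfl

/-- A part of a band away from its ends meets neither `F_r` nor another band, so openness is visible
in the glued topology. -/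
theorem isOpen_image_bandMap {b : Fin W.num} {O : Set (I × I)} (hO : IsOpen O)
    (h : ∀ p ∈ O, p.1 ≠ 0 ∧ p.1 ≠ 1) : IsOpen (W.bandMap b '' O) := by
  refine W.isOpen_iff_glue.2 ⟨?_, fun b' => ?_⟩
  · convert isOpen_empty
    refine Set.eq_empty_of_forall_notMem ?_
    rintro x ⟨p, hp, hx⟩
    rcases W.fst_of_bandMap_eq_inc hx with h' | h'
    · exact (h p hp).1 h'
    · exact (h p hp).2 h'
  · by_cases hb : b' = b
    · subst hb
      rwa [Set.preimage_image_eq _ fun p p' h => (W.bandMap_inj h).2]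
    · convert isOpen_empty
      refine Set.eq_empty_of_forall_notMem ?_
      rintro p ⟨p', -, hx⟩
      exact hb (W.bandMap_inj hx).1.symm

end VirtualBands

/-! ### The angle around the boundary of a disk. -/

namespace Disk

variable (D : Disk)

/-- The interior of the unit ball around the disk. -/
def openBall : Set S3 := D.chart.symm '' Metric.ball 0 1

theorem isOpen_openBall : IsOpen D.openBall :=
  D.chart.symm.isOpen_image_of_subset_source Metric.isOpen_ball
    (Metric.ball_subset_closedBall.trans D.ball_subset)

theorem mem_openBall {q : S3} (hq : q ∈ D.points) (hb : q ∉ D.boundary) : q ∈ D.openBall := by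
  obtain ⟨p, ⟨hp, hp2⟩, rfl⟩ := hq
  refine ⟨p, ?_, rfl⟩
  rw [mem_ball_zero_iff]
  rw [mem_closedBall_zero_iff] at hp
  refine lt_of_le_of_ne hp fun h => hb ⟨p, ⟨by simpa using h, hp2⟩, rfl⟩

theorem continuousOn_chart : ContinuousOn D.chart D.openBall := by
  refine D.chart.continuousOn.mono ?_
  rintro _ ⟨p, hp, rfl⟩
  exact D.chart.map_target (D.ball_subset (Metric.ball_subset_closedBall hp))

/-- In the open unit ball, the angle is `(1 + u) / 2`, where `|u| < 1` and `u` has the sign of `z`. -/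
theorem exists_angleFun_eq {q : S3} (hq : q ∈ D.openBall) : ∃ u : ℝ, |u| < 1 ∧
    (0 < u ↔ 0 < D.chart q 2) ∧ (u = 0 ↔ D.chart q 2 = 0) ∧
    D.angleFun q = (((1 + u) / 2 : ℝ) : UnitAddCircle) := by
  obtain ⟨p, hp, rfl⟩ := hq
  have hp' : p ∈ Metric.closedBall (0 : E3) 1 := Metric.ball_subset_closedBall hp
  rw [mem_ball_zero_iff] at hp
  have hsq := norm_sq_E3 p
  have hlt : p 2 ^ 2 < 1 - p 0 ^ 2 - p 1 ^ 2 := by nlinarith [norm_nonneg p]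
  have hroot : |p 2| < √(1 - p 0 ^ 2 - p 1 ^ 2) := Real.lt_sqrt_of_sq_lt (by rwa [sq_abs])
  have hpos : 0 < √(1 - p 0 ^ 2 - p 1 ^ 2) := (abs_nonneg _).trans_lt hroot
  refine ⟨p 2 / √(1 - p 0 ^ 2 - p 1 ^ 2), ?_, ?_, ?_, ?_⟩
  · rwa [abs_div, abs_of_pos hpos, div_lt_one hpos]
  · rw [D.chart.right_inv (D.ball_subset hp'), div_pos_iff_of_pos_right hpos]
  · rw [D.chart.right_inv (D.ball_subset hp'), div_eq_zero_iff, or_iff_left hpos.ne']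
  · rw [angleFun, if_pos ⟨p, hp', rfl⟩, D.chart.right_inv (D.ball_subset hp')]

theorem half_lt_rep_angleFun {q : S3} (hq : q ∈ D.openBall) :
    1 / 2 < rep 0 (D.angleFun q) ↔ 0 < D.chart q 2 := by
  obtain ⟨u, hu, hpos, -, he⟩ := D.exists_angleFun_eq hq
  rw [abs_lt] at hu
  rw [he, rep_coe ⟨by linarith, by linarith⟩, ← hpos]
  constructor <;> intro h <;> linarith

theorem angleFun_eq_half_iff {q : S3} (hK : q ∉ D.boundary) :
    D.angleFun q = ((1 / 2 : ℝ) : UnitAddCircle) ↔ q ∈ D.points := by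
  constructor
  · intro h
    by_cases hq : q ∈ D.openBall
    · obtain ⟨u, hu, -, hzero, he⟩ := D.exists_angleFun_eq hq
      have h1 := rep_coe (a := 0) (s := 1 / 2) ⟨by norm_num, by norm_num⟩
      rw [abs_lt] at hu
      have h2 := rep_coe (a := 0) (s := (1 + u) / 2) ⟨by linarith, by linarith⟩
      rw [← he, h, h1] at h2
      obtain ⟨p, hp, rfl⟩ := hq
      have hp' := Metric.ball_subset_closedBall hp
      have h0 := hzero.1 (by linarith)
      rw [D.chart.right_inv (D.ball_subset hp')] at h0
      exact ⟨p, ⟨hp', h0⟩, rfl⟩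
    · rw [D.angleFun_eq_zero hK hq] at h
      exact absurd h.symm half_ne_zero
  · intro hq
    obtain ⟨u, -, -, hzero, he⟩ := D.exists_angleFun_eq (D.mem_openBall hq hK)
    obtain ⟨p, ⟨hp, hp2⟩, rfl⟩ := hq
    rw [hzero.2 (by rw [D.chart.right_inv (D.ball_subset hp), hp2])] at he
    rw [he, add_zero]

end Disk

/-! ### Linking numbers with the boundaries of cocore disks. -/

namespace VirtualBands

variable {F : RibbonSurface.{u}} {κ : RibbonCoordinates F.toFun} {W : VirtualBands.{u, v} F κ}
  {b : Fin W.num} {D : Disk}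

theorem IsCocoreDisk.mem_points_iff (h : W.IsCocoreDisk b D) {q : W.G.image} :
    (q : S3) ∈ D.points ↔ ∃ t, W.bandMap b (half, t) = q := by
  have h1 : (q : S3) ∈ D.points ↔ (q : S3) ∈ W.cocore b := by
    rw [← h.inter_eq]
    exact ⟨fun h => ⟨h, q.2⟩, fun h => h.1⟩
  rw [h1]
  exact exists_congr fun t => ⟨fun h => Subtype.ext h.symm, fun h => (congrArg Subtype.val h).symm⟩

/-- Near the cocore, a band passes through the disk to its positive side. -/
theorem IsCocoreDisk.exists_delta (h : W.IsCocoreDisk b D) : ∃ δ > 0, δ ≤ 1 / 2 ∧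
    ∀ p : I × I, abs ((p.1 : ℝ) - 1 / 2) < δ → (W.bandMap b p : S3) ∈ D.openBall ∧
      (0 < D.chart (W.bandMap b p) 2 ↔ 1 / 2 < (p.1 : ℝ)) := by
  have hO : IsOpen ({p | (W.bandMap b p : S3) ∈ D.openBall} : Set (I × I)) :=
    D.isOpen_openBall.preimage (continuous_subtype_val.comp (W.bandMap b).continuous)
  have hsub : ∀ t, (half, t) ∈ ({p | (W.bandMap b p : S3) ∈ D.openBall} : Set (I × I)) := fun t =>
    D.mem_openBall (h.mem_points_iff.2 ⟨t, rfl⟩) (h.image_subset (W.bandMap b (half, t)).2)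
  have hK : IsCompact (({half} : Set I) ×ˢ (Set.univ : Set I)) :=
    isCompact_singleton.prod isCompact_univ
  obtain ⟨δ₁, hδ₁, h1⟩ := hK.exists_thickening_subset_open hO (by
    rintro ⟨s, t⟩ ⟨hs, -⟩
    obtain rfl : s = half := hs
    exact hsub t)
  obtain ⟨δ₂, hδ₂, h2⟩ := Metric.eventually_nhds_iff.1 h.crosses
  have hin : ∀ p : I × I, abs ((p.1 : ℝ) - 1 / 2) < δ₁ → (W.bandMap b p : S3) ∈ D.openBall := by
    intro p hp
    refine h1 (Metric.mem_thickening_iff.2 ⟨(half, p.2), ⟨rfl, trivial⟩, ?_⟩)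
    rw [Prod.dist_eq, dist_self, max_lt_iff]
    exact ⟨hp, hδ₁⟩
  have hcont : ContinuousOn (fun p : I × I => D.chart (W.bandMap b p) 2)
      {p | abs ((p.1 : ℝ) - 1 / 2) < δ₁} :=
    (continuous_coord 2).comp_continuousOn (D.continuousOn_chart.comp
      (continuous_subtype_val.comp (W.bandMap b).continuous).continuousOn hin)
  have hne : ∀ p : I × I, abs ((p.1 : ℝ) - 1 / 2) < δ₁ → (p.1 : ℝ) ≠ 1 / 2 →
      D.chart (W.bandMap b p) 2 ≠ 0 := by
    intro p hp hp1 h0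
    obtain ⟨x, hx, hxq⟩ := hin p hp
    have hx' := Metric.ball_subset_closedBall hx
    rw [← hxq, D.chart.right_inv (D.ball_subset hx')] at h0
    have hmem : (W.bandMap b p : S3) ∈ D.points := ⟨x, ⟨hx', h0⟩, hxq⟩
    obtain ⟨t, ht⟩ := h.mem_points_iff.1 hmem
    exact hp1 (congrArg (fun p : I × I => (p.1 : ℝ)) (W.bandMap_inj ht).2).symm
  -- `crosses` only speaks about the core. On either side of the cocore the height does not vanish,
  -- so its sign spreads from the core over the full width of the band.
  have hconst : ∀ p p' : I × I, abs ((p.1 : ℝ) - 1 / 2) < δ₁ → abs ((p'.1 : ℝ) - 1 / 2) < δ₁ →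
      ((p.1 : ℝ) < 1 / 2 ∧ (p'.1 : ℝ) < 1 / 2 ∨ 1 / 2 < (p.1 : ℝ) ∧ 1 / 2 < (p'.1 : ℝ)) →
      0 < D.chart (W.bandMap b p') 2 → 0 < D.chart (W.bandMap b p) 2 := by
    intro p p' hp hp' hside hpos
    have hord : (Set.uIcc p.1 p'.1).OrdConnected := Set.ordConnected_uIcc
    have hmem : ∀ s ∈ Set.uIcc p.1 p'.1, abs ((s : ℝ) - 1 / 2) < δ₁ ∧ (s : ℝ) ≠ 1 / 2 := by
      intro s hs
      rw [Set.mem_uIcc] at hs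
      have hs' : ((p.1 : ℝ) ≤ s ∧ (s : ℝ) ≤ p'.1) ∨ ((p'.1 : ℝ) ≤ s ∧ (s : ℝ) ≤ p.1) := hs
      rw [abs_lt] at hp hp' ⊢
      rcases hs' with hs' | hs' <;> rcases hside with hh | hh <;>
        exact ⟨⟨by linarith, by linarith⟩, fun h => by linarith⟩
    have hpre : _root_.IsPreconnected (Set.uIcc p.1 p'.1 ×ˢ (Set.univ : Set I)) :=
      (Set.OrdConnected.isPreconnected hord).prod isPreconnected_univ
    rcases DisorientedHomology.IsPreconnected.pos_or_neg hpre (hcont.mono fun q hq => (hmem _ hq.1).1)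
      (fun q hq => hne q (hmem _ hq.1).1 (hmem _ hq.1).2) with hp | hn
    · exact hp p ⟨Set.left_mem_uIcc, trivial⟩
    · exact absurd hpos (hn p' ⟨Set.right_mem_uIcc, trivial⟩).not_gt
  -- The bound `1 / 2` keeps the neighbourhood of the cocore off the ends of the band.
  refine ⟨min (1 / 2) (min δ₁ δ₂), lt_min (by norm_num) (lt_min hδ₁ hδ₂), min_le_left _ _,
    fun p hp => ?_⟩
  obtain ⟨-, hp⟩ := lt_min_iff.1 hp
  obtain ⟨hp1, hp2⟩ := lt_min_iff.1 hp
  have hcr := h2 (show dist p.1 half < δ₂ from hp2)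
  have hmid : abs ((((p.1, half) : I × I).1 : ℝ) - 1 / 2) < δ₁ := hp1
  refine ⟨hin p hp1, ?_⟩
  rcases lt_trichotomy (p.1 : ℝ) (1 / 2) with hlt | heq | hgt
  · refine iff_of_false (fun hpos => ?_) hlt.not_gt
    have := hconst (p.1, half) p hmid hp1 (Or.inl ⟨hlt, hlt⟩) hpos
    exact absurd (hcr.1 hlt) this.not_gt
  · refine iff_of_false (fun hpos => ?_) heq.not_gt
    have hmem : (W.bandMap b p : S3) ∈ D.points :=
      h.mem_points_iff.2 ⟨p.2, congrArg _ (Prod.ext (Subtype.ext heq.symm) rfl)⟩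
    obtain ⟨x, ⟨hx, hx2⟩, hxq⟩ := hmem
    rw [← hxq, D.chart.right_inv (D.ball_subset hx), hx2] at hpos
    exact hpos.false
  · exact iff_of_true (hconst p (p.1, half) hp1 hmid (Or.inr ⟨hgt, hgt⟩) (hcr.2 hgt)) hgt

/-- The linking number with the boundary of a cocore disk is the winding number of the angle of the
band. -/
theorem IsCocoreDisk.linkingNumber_eq (h : W.IsCocoreDisk b D) (x : H1 W.G.image) :
    D.linkingNumber (H1map (incl h.image_subset) x) = windingNumber (W.bandAngle b) x := by
  -- Winding numbers are natural: a lift of the angle along a path in `G_r` is a lift along its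
  -- image in the complement of the boundary circle.
  have hcomp : D.linkingNumber (H1map (incl h.image_subset) x) =
      windingNumber (D.angle.comp (incl h.image_subset)) x := by
    obtain ⟨c, hc⟩ := exists_represents x
    have h1 := (hc.push (incl h.image_subset)).windingNumber D.angle
    have h2 := hc.windingNumber (D.angle.comp (incl h.image_subset))
    have h3 : (windingChain D.angle).hom.comp (push1 (incl h.image_subset)) =
        (windingChain (D.angle.comp (incl h.image_subset))).hom := by
      refine C1_hom_ext fun γ => ?_
      obtain ⟨L, hL⟩ := exists_path_lift ((D.angle.comp (incl h.image_subset)).comp γ)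
      rw [AddMonoidHom.comp_apply, push1_pathChain, windingChain_pathChain _ _ L hL,
        windingChain_pathChain _ _ L hL]
    have h4 := DFunLike.congr_fun h3 c
    rw [AddMonoidHom.comp_apply] at h4
    rw [h4, ← h2] at h1
    exact_mod_cast h1
  rw [hcomp]
  have hang : ∀ q : W.G.image, D.angle.comp (incl h.image_subset) q = D.angleFun q := fun q => rfl
  refine windingNumber_congr _ _ (fun q => ?_) (fun q hq => ?_) x
  · rw [hang, D.angleFun_eq_half_iff (h.image_subset q.2), h.mem_points_iff, W.bandAngle_eq_half_iff]
  · rw [hang, D.angleFun_eq_half_iff (h.image_subset q.2), h.mem_points_iff] at hq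
    obtain ⟨t, rfl⟩ := hq
    obtain ⟨δ, hδ, hδ', hδp⟩ := h.exists_delta
    have hopen : IsOpen (W.bandMap b '' {p | abs ((p.1 : ℝ) - 1 / 2) < δ}) := by
      refine W.isOpen_image_bandMap (isOpen_lt (by fun_prop) continuous_const) fun p hp => ?_
      rw [Set.mem_ofPred_eq, abs_lt] at hp
      constructor <;> intro h0 <;> rw [h0] at hp <;> simp at hp <;> linarith
    filter_upwards [hopen.mem_nhds ⟨(half, t), by simpa [half] using hδ, rfl⟩]
    rintro _ ⟨p, hp, rfl⟩
    rw [hang, D.half_lt_rep_angleFun (hδp p hp).1, (hδp p hp).2, W.bandAngle_bandMap, if_pos rfl]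
    have hp' := abs_lt.1 (show abs ((p.1 : ℝ) - 1 / 2) < δ from hp)
    rw [rep_coe ⟨by linarith, by linarith⟩]

end VirtualBands

namespace VirtuallyBandedSurface

variable {F : RibbonSurface.{u}} {κ : RibbonCoordinates F.toFun}
  (W : VirtuallyBandedSurface.{u, v} F κ)

theorem boundaryMap_apply (x : W.coords.DH1) (b : Fin W.num) :
    W.boundaryMap x b = windingNumber (W.bandAngle b) (x : H1 W.G.image) := by
  rw [boundaryMap, AddMonoidHom.finsetSum_apply, Finsupp.finsetSum_apply]
  simp only [AddMonoidHom.comp_apply, Finsupp.singleAddHom_apply, Finsupp.single_apply]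
  rw [Finset.sum_ite_eq' Finset.univ b, if_pos (Finset.mem_univ b)]
  exact (W.isCocoreDisk b).linkingNumber_eq _

end VirtuallyBandedSurface

theorem pcls_homotopy_of_eq {X : Type} [TopologicalSpace X] (H : C(I × I, X)) {a b c d : C(I, X)}
    (ha : ∀ t, H (0, t) = a t) (hb : ∀ t, H (t, 1) = b t) (hc : ∀ t, H (t, 0) = c t)
    (hd : ∀ t, H (1, t) = d t) : pcls a + pcls b = pcls c + pcls d := by
  obtain rfl := ContinuousMap.ext (f := H.comp (.prodMk (.const I 0) (.id I))) ha
  obtain rfl := ContinuousMap.ext (f := H.comp (.prodMk (.id I) (.const I 1))) hb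
  obtain rfl := ContinuousMap.ext (f := H.comp (.prodMk (.id I) (.const I 0))) hc
  obtain rfl := ContinuousMap.ext (f := H.comp (.prodMk (.const I 1) (.id I))) hd
  exact pcls_homotopy H

/-- A path in a vector space is homotopic to the segment with the same endpoints. -/
theorem pcls_comp_eq_seg {E X : Type} [AddCommGroup E] [Module ℝ E] [TopologicalSpace E]
    [IsTopologicalAddGroup E] [ContinuousSMul ℝ E] [TopologicalSpace X] (φ : C(E, X)) (g : C(I, E)) :
    pcls (φ.comp g) = pcls (seg φ (g 0) (g 1)) := by
  have h := pcls_homotopy_of_eq (⟨fun p : I × I => φ ((1 - (p.1 : ℝ)) • g 0 + (p.1 : ℝ) • g p.2),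
    by fun_prop⟩ : C(I × I, X)) (a := .const I (φ (g 0))) (b := seg φ (g 0) (g 1))
    (c := .const I (φ (g 0))) (d := φ.comp g) (fun t => by simp) (fun t => by simp)
    (fun t => by simp [← add_smul]) (fun t => by simp)
  rw [pcls_const, zero_add, zero_add] at h
  exact h.symm

namespace VirtualBands

variable {F : RibbonSurface.{u}} {κ : RibbonCoordinates F.toFun} (W : VirtualBands.{u, v} F κ)

/-! ### Decomposition of cycles along the bands -/

/-- The core of a band. -/
def core (b : Fin W.num) : C(I, W.G.image) := (W.bandMap b).comp (.prodMk (.id I) (.const I half))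

/-- The projection of the plane onto the square `[0,1]²`. -/
def clampSquare : C(ℝ × ℝ, I × I) :=
  ⟨fun p => (Set.projIcc 0 1 zero_le_one p.1, Set.projIcc 0 1 zero_le_one p.2), by fun_prop⟩

theorem clampSquare_coe (p : I × I) : clampSquare ((p.1 : ℝ), (p.2 : ℝ)) = p :=
  Prod.ext (Set.projIcc_val zero_le_one _) (Set.projIcc_val zero_le_one _)

/-- The inclusion of the square in the plane. -/
def squareCoe : C(I × I, ℝ × ℝ) := ⟨fun p => ((p.1 : ℝ), (p.2 : ℝ)), by fun_prop⟩

/-- The homomorphism from the sum of the chains in `F_r` and the free group on the bands. -/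
def coreComb : C1 F.image × (Fin W.num → ℤ) →+ C1 W.G.image :=
  AddMonoidHom.coprod (push1 W.inc)
    (∑ b, (zmultiplesHom _ (pathChain (W.core b))).comp (Pi.evalAddMonoidHom (fun _ => ℤ) b))

theorem coreComb_apply (a : C1 F.image) (n : Fin W.num → ℤ) :
    W.coreComb (a, n) = push1 W.inc a + ∑ b, n b • pathChain (W.core b) := by
  simp [coreComb, AddMonoidHom.finsetSum_apply]

/-- The classes of chains in `F_r` and of cores. -/
def bandClasses : AddSubgroup (Cls W.G.image) :=
  ((QuotientAddGroup.mk' (B1 W.G.image)).comp W.coreComb).range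

theorem pcls_inc_mem (γ : C(I, W.G.image)) (h : ∀ t, ∃ x, W.inc x = γ t) :
    pcls γ ∈ W.bandClasses := by
  choose g hg using h
  have hgc : Continuous g := by
    have := γ.continuous
    rw [Topology.IsInducing.subtypeVal.continuous_iff] at this ⊢
    convert this using 1
    funext t
    exact congrArg (fun q : W.G.image => (q : S3)) (hg t)
  refine ⟨(pathChain ⟨g, hgc⟩, 0), ?_⟩
  rw [AddMonoidHom.comp_apply, coreComb_apply]
  simp only [push1_pathChain, Pi.zero_apply, zero_smul, Finset.sum_const_zero, add_zero]
  exact congrArg (fun γ => pcls γ) (ContinuousMap.ext hg)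

theorem pcls_core_mem (b : Fin W.num) : pcls (W.core b) ∈ W.bandClasses := by
  refine ⟨(0, Pi.single b 1), ?_⟩
  rw [AddMonoidHom.comp_apply, coreComb_apply, map_zero, zero_add,
    Finset.sum_eq_single b (fun b' _ hb => by rw [Pi.single_eq_of_ne hb, zero_smul])
      (fun h => absurd (Finset.mem_univ b) h), Pi.single_eq_same, one_smul]
  rfl

/-- The plane, projected to the square and mapped to a band. -/
def bandPlane (b : Fin W.num) : C(ℝ × ℝ, W.G.image) := (W.bandMap b).comp clampSquare

/-- The class of the segment in a band from the start of the core. -/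
def spoke (b : Fin W.num) (p : I × I) : Cls W.G.image :=
  pcls (seg (W.bandPlane b) (squareCoe (0, half)) (squareCoe p))

/-- The band extends to the plane by clamping, where every path is homologous to a straight segment;
this segment completes a triangle with two spokes. -/
theorem pcls_bandMap_comp (b : Fin W.num) (g : C(I, I × I)) :
    pcls ((W.bandMap b).comp g) = W.spoke b (g 1) - W.spoke b (g 0) := by
  have h := pcls_comp_eq_seg (W.bandPlane b) (squareCoe.comp g)
  have e : (W.bandPlane b).comp (squareCoe.comp g) = (W.bandMap b).comp g :=
    ContinuousMap.ext fun t => congrArg (W.bandMap b) (clampSquare_coe (g t))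
  rw [e] at h
  rw [h, spoke, spoke, ← pcls_seg_add _ (squareCoe (0, half)) (squareCoe (g 0)) (squareCoe (g 1))]
  simp

/-- A point of an attaching arc is reached from the start of the core by a path along that arc,
which lies in `F_r`, preceded by the core if the point is at the far end. -/
theorem spoke_mem {b : Fin W.num} {p : I × I} (hp : p.1 = 0 ∨ p.1 = 1) :
    W.spoke b p ∈ W.bandClasses := by
  have hend : ∀ (e : I), (e = 0 ∨ e = 1) → ∀ t, ∃ x, W.inc x = W.bandMap b (e, t) := by
    intro e he t
    obtain ⟨x, -, -, hx⟩ := W.exists_attached b (p := (e, t)) he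
    exact ⟨_, hx.symm⟩
  have hside : ∀ (e : I), (e = 0 ∨ e = 1) → ∀ t, W.spoke b (e, t) - W.spoke b (e, half) ∈
      W.bandClasses := by
    intro e he t
    -- This path slides along the attaching arc from `half` to `t`; `clampSquare` only serves to
    -- land in `I`, and its first coordinate is discarded.
    have hc : Continuous fun s : I => ((e, (clampSquare ((0 : ℝ), (1 - (s : ℝ)) * (half : I) + s * t)).2) : I × I) := by
      fun_prop
    have h := W.pcls_bandMap_comp b ⟨_, hc⟩
    have h1 : (clampSquare ((0 : ℝ), (t : ℝ))).2 = t := Set.projIcc_val zero_le_one _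
    have h0 : (clampSquare ((0 : ℝ), ((half : I) : ℝ))).2 = half := Set.projIcc_val zero_le_one _
    simp only [ContinuousMap.coe_mk, Set.Icc.coe_one, Set.Icc.coe_zero, sub_self, zero_mul, zero_add, one_mul,
      sub_zero, add_zero, h0, h1] at h
    rw [← h]
    exact W.pcls_inc_mem _ fun s => hend e he _
  have hcore : W.spoke b (1, half) - W.spoke b (0, half) ∈ W.bandClasses := by
    have h := W.pcls_bandMap_comp b (.prodMk (.id I) (.const I half))
    have := W.pcls_core_mem b
    rw [core, h] at this
    exact this
  have h00 : W.spoke b (0, half) = 0 := pcls_seg_self _ _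
  rw [h00, sub_zero] at hcore
  obtain ⟨e, t⟩ := p
  have := hside e hp t
  rcases hp with he | he
  · obtain rfl : e = 0 := he
    rwa [h00, sub_zero] at this
  · obtain rfl : e = 1 := he
    simpa using add_mem this hcore

open Classical in
/-- The class of the segment from the start of the core, for points of bands, and zero for points of
`F_r`. -/
def spokeClass (q : W.G.image) : Cls W.G.image ⧸ W.bandClasses :=
  if h : ∃ s : Fin W.num × (I × I), W.bandMap s.1 s.2 = q then
    QuotientAddGroup.mk' _ (W.spoke h.choose.1 h.choose.2) else 0

theorem spokeClass_bandMap (b : Fin W.num) (p : I × I) :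
    W.spokeClass (W.bandMap b p) = QuotientAddGroup.mk' _ (W.spoke b p) := by
  have h : ∃ s : Fin W.num × (I × I), W.bandMap s.1 s.2 = W.bandMap b p := ⟨(b, p), rfl⟩
  rw [spokeClass, dif_pos h]
  obtain ⟨h1, h2⟩ := W.bandMap_inj h.choose_spec
  rw [h1, h2]

/-- On the attaching arcs both cases of the definition apply, and they agree by `spoke_mem`. -/
theorem spokeClass_inc (x : F.image) : W.spokeClass (W.inc x) = 0 := by
  by_cases h : ∃ b p, W.bandMap b p = W.inc x
  · obtain ⟨b, p, h⟩ := h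
    rw [← h, spokeClass_bandMap]
    exact (QuotientAddGroup.eq_zero_iff _).2 (W.spoke_mem (W.fst_of_bandMap_eq_inc h))
  · exact dif_neg fun ⟨s, hs⟩ => h ⟨s.1, s.2, hs⟩

/-- The piecewise linear map that sends `[0, 1/3]` to `0` and `[2/3, 1]` to `1`. -/
def stretch (s : ℝ) : ℝ := max 0 (min 1 (3 * s - 1))

/-- This homotopy fixes `F_r` and pushes the outer thirds of the bands into it. It is curried, so
that it can be glued as a map into a path space; `stretch` fixes `0` and `1`, which makes the tracks
constant on the attaching arcs. -/
theorem exists_pushHomotopy : ∃ K : C(W.G.image, C(I, W.G.image)),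
    (∀ x, K (W.inc x) = .const I (W.inc x)) ∧
    ∀ b p, K (W.bandMap b p) = seg (W.bandPlane b) (squareCoe p) (stretch p.1, (p.2 : ℝ)) := by
  have hc : ∀ b : Fin W.num, Continuous fun p : (I × I) × I => W.bandPlane b
      ((1 - (p.2 : ℝ)) • squareCoe p.1 + (p.2 : ℝ) • (stretch p.1.1, (p.1.2 : ℝ))) := fun b => by
    unfold stretch
    fun_prop
  refine W.exists_glue ⟨fun x => .const I (W.inc x), ?_⟩
    (fun b => (⟨_, hc b⟩ : C((I × I) × I, W.G.image)).curry) ?_ |>.imp ?_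
  · exact ContinuousMap.continuous_const'.comp W.inc.continuous
  · intro b p x h
    refine ContinuousMap.ext fun t => ?_
    have hst : stretch p.1 = p.1 := by
      rcases W.fst_of_bandMap_eq_inc h with h1 | h1 <;> rw [h1] <;> norm_num [stretch]
    change W.bandPlane b ((1 - (t : ℝ)) • squareCoe p + (t : ℝ) • (stretch p.1, (p.2 : ℝ))) = W.inc x
    rw [hst, ← h]
    change W.bandPlane b ((1 - (t : ℝ)) • squareCoe p + (t : ℝ) • squareCoe p) = _
    rw [← add_smul, sub_add_cancel, one_smul]
    exact congrArg (W.bandMap b) (clampSquare_coe p)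
  · rintro K ⟨h1, h2⟩
    exact ⟨h1, fun b p => h2 b p⟩

/-- Near the closed middle third of a band a short path stays in that band, and its class is a
difference of spokes. Off all the middle thirds the homotopy pushes the path into `F_r`, and the
tracks of the end points are minus their spokes modulo `bandClasses`. -/
theorem exists_nhds_spokeClass (q : W.G.image) : ∃ U ∈ nhds q, ∀ γ : C(I, W.G.image),
    Set.range γ ⊆ U → QuotientAddGroup.mk' W.bandClasses (pcls γ) =
      W.spokeClass (γ 1) - W.spokeClass (γ 0) := by
  by_cases hq : ∃ b p, W.bandMap b p = q ∧ (1 : ℝ) / 3 ≤ p.1 ∧ (p.1 : ℝ) ≤ 2 / 3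
  · obtain ⟨b, p, rfl, hp1, hp2⟩ := hq
    have ho : IsOpen (W.bandMap b '' {p | 0 < p.1 ∧ p.1 < 1}) :=
      W.isOpen_image_bandMap ((isOpen_lt (f := fun _ : I × I => (0 : I)) continuous_const continuous_fst).inter
        (isOpen_lt (g := fun _ : I × I => (1 : I)) continuous_fst continuous_const) : IsOpen ({p | 0 < p.1 ∧ p.1 < 1} : Set (I × I))) fun p hp => ⟨hp.1.ne', hp.2.ne⟩
    refine ⟨_, ho.mem_nhds ⟨p, ⟨?_, ?_⟩, rfl⟩, fun γ hγ => ?_⟩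
    · exact Subtype.coe_lt_coe.1 (show (0 : ℝ) < p.1 by linarith)
    · exact Subtype.coe_lt_coe.1 (show (p.1 : ℝ) < 1 by linarith)
    · obtain ⟨g, hg⟩ := exists_continuous_lift (W.bandMap b).continuous isCompact_univ
        (fun p _ p' _ h => (W.bandMap_inj h).2) γ.continuous fun t => by
          obtain ⟨p, -, hp⟩ := hγ ⟨t, rfl⟩
          exact ⟨p, trivial, hp⟩
      have e : γ = (W.bandMap b).comp g := ContinuousMap.ext fun t => (hg t).2.symm
      rw [e, pcls_bandMap_comp, map_sub]
      exact congrArg₂ _ (W.spokeClass_bandMap b _).symm (W.spokeClass_bandMap b _).symm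
  · have hcl : IsClosed (⋃ b, W.bandMap b '' {p | (1 : ℝ) / 3 ≤ p.1 ∧ (p.1 : ℝ) ≤ 2 / 3}) := by
      refine isClosed_iUnion_of_finite fun b => (IsCompact.image ?_ (W.bandMap b).continuous).isClosed
      exact ((isClosed_le (f := fun _ : I × I => (1 : ℝ) / 3) (g := fun p => (p.1 : ℝ)) (by fun_prop)
        (by fun_prop)).inter (isClosed_le (f := fun p : I × I => (p.1 : ℝ)) (g := fun _ => (2 : ℝ) / 3)
          (by fun_prop) (by fun_prop))).isCompact
    refine ⟨_, hcl.isOpen_compl.mem_nhds ?_, fun γ hγ => ?_⟩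
    · intro h
      simp only [Set.mem_iUnion] at h
      obtain ⟨b, p, hp, rfl⟩ := h
      exact hq ⟨b, p, rfl, hp⟩
    · obtain ⟨K, hK1, hK2⟩ := W.exists_pushHomotopy
      -- Off the middle thirds `stretch` takes only the values `0` and `1`, so the pushed path ends
      -- on attaching arcs.
      have hstretch : ∀ b p, W.bandMap b p ∈ Set.range γ → stretch p.1 = 0 ∨ stretch p.1 = 1 := by
        intro b p hp
        have h := hγ hp
        simp only [Set.mem_compl_iff, Set.mem_iUnion, not_exists] at h
        have h' : ¬ ((1 : ℝ) / 3 ≤ p.1 ∧ (p.1 : ℝ) ≤ 2 / 3) := fun h' => h b ⟨p, h', rfl⟩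
        rw [not_and_or, not_le, not_le] at h'
        rcases h' with h' | h'
        · exact Or.inl (max_eq_left ((min_le_right _ _).trans (by linarith)))
        · right
          rw [stretch, min_eq_left (by linarith), max_eq_right zero_le_one]
      have hK : ∀ q ∈ Set.range γ, W.spokeClass q = - QuotientAddGroup.mk' W.bandClasses (pcls (K q)) := by
        intro q hqr
        rcases W.inc_or_bandMap q with ⟨x, rfl⟩ | ⟨b, p, rfl⟩
        · rw [hK1, pcls_const, spokeClass_inc, map_zero, neg_zero]
        · rw [spokeClass_bandMap, hK2, eq_neg_iff_add_eq_zero, ← map_add, spoke, pcls_seg_add]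
          refine (QuotientAddGroup.eq_zero_iff _).2 ?_
          rcases hstretch b p hqr with h | h <;> rw [h]
          · exact W.spoke_mem (p := (0, p.2)) (Or.inl rfl)
          · exact W.spoke_mem (p := (1, p.2)) (Or.inr rfl)
      have hinc : ∀ q ∈ Set.range γ, ∃ x, W.inc x = K q 1 := by
        intro q hqr
        rcases W.inc_or_bandMap q with ⟨x, rfl⟩ | ⟨b, p, rfl⟩
        · exact ⟨x, by rw [hK1]; rfl⟩
        · have hend : ∀ e : I, (e = 0 ∨ e = 1) → stretch p.1 = e → ∃ x, W.inc x = K (W.bandMap b p) 1 := by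
            intro e he hs
            obtain ⟨x, -, -, hx⟩ := W.exists_attached b (p := (e, p.2)) he
            refine ⟨_, hx.symm.trans ?_⟩
            rw [hK2, seg_apply, hs]
            simp only [Set.Icc.coe_one, sub_self, zero_smul, zero_add, one_smul]
            exact (congrArg (W.bandMap b) (clampSquare_coe (e, p.2))).symm
          rcases hstretch b p hqr with h | h
          · exact hend 0 (Or.inl rfl) h
          · exact hend 1 (Or.inr rfl) h
      have hs : ∀ q : W.G.image, K q 0 = q := by
        intro q
        rcases W.inc_or_bandMap q with ⟨x, rfl⟩ | ⟨b, p, rfl⟩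
        · rw [hK1]; rfl
        · rw [hK2, seg_apply]
          simp only [Set.Icc.coe_zero, sub_zero, zero_smul, add_zero, one_smul]
          exact congrArg (W.bandMap b) (clampSquare_coe p)
      have hH := pcls_homotopy_of_eq (⟨fun p : I × I => K (γ p.2) p.1, by fun_prop⟩ : C(I × I, W.G.image))
        (a := γ) (b := K (γ 1)) (c := K (γ 0)) (d := ⟨fun t => K (γ t) 1, by fun_prop⟩)
        (fun t => hs _) (fun t => rfl) (fun t => rfl) (fun t => rfl)
      have hH' := congrArg (QuotientAddGroup.mk' W.bandClasses) hH
      rw [map_add, map_add] at hH'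
      rw [hK _ ⟨1, rfl⟩, hK _ ⟨0, rfl⟩, neg_sub_neg, eq_sub_iff_add_eq, hH', add_eq_left]
      exact (QuotientAddGroup.eq_zero_iff _).2 (W.pcls_inc_mem _ fun t => hinc _ ⟨t, rfl⟩)

/-- A cycle in `G_r` is homologous to the sum of a chain in `F_r` and multiples of the cores. -/
theorem exists_decomposition {c : C1 W.G.image} (hc : bd _ c = 0) :
    ∃ (a : C1 F.image) (n : Fin W.num → ℤ), c - W.coreComb (a, n) ∈ B1 W.G.image := by
  have h := eq_lift0_bd_of_local
    ((QuotientAddGroup.mk' W.bandClasses).comp (QuotientAddGroup.mk' (B1 W.G.image)))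
    (fun c hc => by
      rw [AddMonoidHom.comp_apply]
      have : QuotientAddGroup.mk' (B1 W.G.image) c = 0 := (QuotientAddGroup.eq_zero_iff _).2 hc
      rw [this, map_zero]) W.spokeClass W.exists_nhds_spokeClass c
  rw [hc, map_zero] at h
  obtain ⟨⟨a, n⟩, han⟩ := (QuotientAddGroup.eq_zero_iff _).1 h
  refine ⟨a, n, ?_⟩
  rw [← QuotientAddGroup.eq_zero_iff]
  have : QuotientAddGroup.mk' (B1 W.G.image) (W.coreComb (a, n)) = QuotientAddGroup.mk' (B1 W.G.image) c := han
  change QuotientAddGroup.mk' (B1 W.G.image) (c - W.coreComb (a, n)) = 0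
  rw [map_sub, this, sub_self]

/-- The angle of `b` is constant on `F_r` and on the other cores, and it increases by one along the
core of `b`. -/
theorem windingChain_coreComb (b : Fin W.num) (a : C1 F.image) (n : Fin W.num → ℤ) :
    (windingChain (W.bandAngle b)).hom (W.coreComb (a, n)) = n b := by
  rw [coreComb_apply, map_add, map_sum]
  have h1 : (windingChain (W.bandAngle b)).hom.comp (push1 W.inc) = 0 := by
    refine C1_hom_ext fun γ => ?_
    rw [AddMonoidHom.comp_apply, push1_pathChain,
      windingChain_pathChain (W.bandAngle b) (W.inc.comp γ) (.const I 0) fun t =>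
        (W.bandAngle_inc b (γ t)).symm]
    simp
  have h2 : (windingChain (W.bandAngle b)).hom (push1 W.inc a) = 0 := DFunLike.congr_fun h1 a
  have h3 : ∀ b', (windingChain (W.bandAngle b)).hom (pathChain (W.core b')) = if b' = b then 1 else 0 := by
    intro b'
    split_ifs with hb
    · rw [windingChain_pathChain _ _ ⟨fun t => (t : ℝ), by fun_prop⟩ fun t =>
        ((W.bandAngle_bandMap b b' (t, half)).trans (if_pos hb)).symm]
      simp
    · rw [windingChain_pathChain (W.bandAngle b) (W.core b') (.const I 0) fun t =>
        ((W.bandAngle_bandMap b b' (t, half)).trans (if_neg hb)).symm]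
      simp
  rw [h2, zero_add]
  simp only [map_zsmul, h3]
  simp

end VirtualBands

/-! ### Homotopies of paths and local path connectedness. -/

instance contractibleSpace_unitInterval : ContractibleSpace I :=
  (convex_Icc (0 : ℝ) 1).contractibleSpace ⟨0, by simp⟩

/-- Paths in the same path component are homotopic as maps. -/
theorem homotopic_of_joined {X : Type} [TopologicalSpace X] {a b : C(I, X)} (t t' : I)
    (h : Joined (a t) (b t')) : a.Homotopic b := by
  obtain ⟨y, hy⟩ := id_nullhomotopic I
  -- As `I` is contractible, each path is homotopic to a constant one, and constants in one path
  -- component are homotopic.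
  have hc : ∀ a : C(I, X), a.Homotopic (.const I (a y)) := fun a =>
    (ContinuousMap.Homotopic.refl a).comp hy
  have hj : ∀ (a : C(I, X)) (t : I), Joined (a y) (a t) := fun a t =>
    (PathConnectedSpace.joined y t).map a.continuous
  exact (hc a).trans ((ContinuousMap.homotopic_const_iff.2
    ((hj a t).trans (h.trans (hj b t').symm))).trans (hc b).symm)

instance RibbonSurface.locallyPathConnectedSpace (F : RibbonSurface.{u}) :
    LocallyPathConnectedSpace F.carrier :=
  ChartedSpace.locallyPathConnectedSpace (EuclideanHalfSpace 2) F.carrier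

instance RibbonSurface.compactSpace_image (F : RibbonSurface.{u}) : CompactSpace F.image :=
  isCompact_iff_compactSpace.1 (isCompact_range F.smooth.continuous)

theorem RibbonSurface.isQuotientMap (F : RibbonSurface.{u}) :
    Topology.IsQuotientMap (Set.rangeFactorization F.toFun) :=
  (F.smooth.continuous.subtype_mk _).isClosedMap.isQuotientMap (F.smooth.continuous.subtype_mk _)
    Set.rangeFactorization_surjective

instance RibbonSurface.locallyPathConnectedSpace_image (F : RibbonSurface.{u}) :
    LocallyPathConnectedSpace F.image := F.isQuotientMap.locallyPathConnectedSpace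

namespace VirtualBands

variable {F : RibbonSurface.{u}} {κ : RibbonCoordinates F.toFun} (W : VirtualBands.{u, v} F κ)

/-! ### The first homology of the surface with bands -/

open Classical in
/-- A map from `G_r` to a path component of `F_r`. -/
theorem exists_retraction (P : ZerothHomotopy F.image) : ∃ ρ : C(W.G.image, F.image),
    ∀ x, ρ (W.inc x) = if ZerothHomotopy.mk x = P then x else P.out := by
  have hP : ZerothHomotopy.mk P.out = P := Quotient.out_eq P
  -- Path components are clopen because `F_r` is locally path connected, so the map that collapses
  -- all other components to a point of `P` is continuous.
  have hcl : IsClopen ({x | ZerothHomotopy.mk x = P} : Set F.image) :=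
    (isClopen_discrete {P}).preimage continuous_quot_mk
  let h₀ : C(F.image, F.image) := ⟨fun x => if ZerothHomotopy.mk x = P then x else P.out,
    Continuous.if (fun x hx => by rw [hcl.frontier_eq] at hx; exact hx.elim) continuous_id
      continuous_const⟩
  have h₀P : ∀ x, ZerothHomotopy.mk (h₀ x) = P := fun x => by
    change ZerothHomotopy.mk (if ZerothHomotopy.mk x = P then x else P.out) = P
    split_ifs with h
    · exact h
    · exact hP
  have hatt : ∀ b (e : I), e = 0 ∨ e = 1 → ∃ a : C(I, F.image), ∀ t, W.inc (a t) = W.bandMap b (e, t) := by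
    intro b e he
    obtain ⟨l, hl⟩ := exists_continuous_lift W.inc.continuous isCompact_univ
      (fun x _ y _ h => W.inc_injective h) (g := fun t : I => W.bandMap b (e, t)) (by fun_prop) fun t => by
        obtain ⟨x, -, -, hx⟩ := W.exists_attached b (p := (e, t)) he
        exact ⟨_, trivial, hx.symm⟩
    exact ⟨l, fun t => (hl t).2⟩
  choose a₀ ha₀ using fun b => hatt b 0 (Or.inl rfl)
  choose a₁ ha₁ using fun b => hatt b 1 (Or.inr rfl)
  -- After `h₀`, both attaching arcs of a band are paths in `P`; a homotopy between them extends the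
  -- map over the band.
  have hH : ∀ b, (h₀.comp (a₀ b)).Homotopic (h₀.comp (a₁ b)) := fun b =>
    homotopic_of_joined 0 0 (Quotient.exact ((h₀P _).trans (h₀P _).symm))
  obtain ⟨ρ, hρ, -⟩ := W.exists_glue h₀ (fun b => (hH b).some.toContinuousMap) fun b p x h => by
    obtain ⟨e, t⟩ := p
    rcases W.fst_of_bandMap_eq_inc h with he | he
    · obtain rfl : e = 0 := he
      rw [← ha₀] at h
      rw [← W.inc_injective h]
      exact (hH b).some.map_zero_left t
    · obtain rfl : e = 1 := he
      rw [← ha₁] at h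
      rw [← W.inc_injective h]
      exact (hH b).some.map_one_left t
  exact ⟨ρ, hρ⟩

/-- A chain in `F_r` is a boundary if it is one in `G_r`. -/
theorem mem_B1_of_push1_inc_mem {c : C1 F.image} (hc : push1 W.inc c ∈ B1 W.G.image) :
    c ∈ B1 F.image := by
  classical
  -- There are finitely many path components, by compactness and local path connectedness, so the
  -- maps can be summed.
  have := Fintype.ofFinite (ZerothHomotopy F.image)
  choose ρ hρ using W.exists_retraction
  -- The map belonging to the component of a path fixes the path, and the others make it constant,
  -- hence null-homologous. So the sum is the identity modulo boundaries and factors through `push1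
  -- W.inc`.
  have hkey : (QuotientAddGroup.mk' (B1 F.image)).comp (∑ P, (push1 (ρ P)).comp (push1 W.inc)) =
      QuotientAddGroup.mk' (B1 F.image) := by
    refine C1_hom_ext fun γ => ?_
    rw [AddMonoidHom.comp_apply, AddMonoidHom.finsetSum_apply, map_sum]
    have hmk : ∀ t, ZerothHomotopy.mk (γ t) = ZerothHomotopy.mk (γ 0) := fun t =>
      Quotient.sound ((PathConnectedSpace.joined t 0).map γ.continuous)
    rw [Finset.sum_eq_single (ZerothHomotopy.mk (γ 0))]
    · rw [AddMonoidHom.comp_apply, push1_pathChain, push1_pathChain]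
      congr 2
      refine ContinuousMap.ext fun t => ?_
      exact (hρ _ _).trans (if_pos (hmk t))
    · intro P _ hP
      rw [AddMonoidHom.comp_apply, push1_pathChain, push1_pathChain]
      have : (ρ P).comp (W.inc.comp γ) = .const I P.out := ContinuousMap.ext fun t =>
        (hρ _ _).trans (if_neg fun h => hP (h.symm.trans (hmk t)))
      rw [this]
      exact pcls_const _
    · exact fun h => absurd (Finset.mem_univ _) h
  have h := DFunLike.congr_fun hkey c
  rw [AddMonoidHom.comp_apply, AddMonoidHom.finsetSum_apply] at h
  rw [← QuotientAddGroup.eq_zero_iff]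
  refine h.symm.trans ((QuotientAddGroup.eq_zero_iff _).2 (sum_mem fun P _ => ?_))
  exact push1_mem_B1 (ρ P) hc

theorem H1map_inc_injective : Function.Injective (H1map W.inc) := by
  rw [injective_iff_map_eq_zero]
  intro x hx
  obtain ⟨c, hc⟩ := exists_represents x
  exact hc.eq_zero_iff.2 (W.mem_B1_of_push1_inc_mem ((hc.push W.inc).eq_zero_iff.1 hx))

/-- A class that does not wind around any band comes from `F_r`. -/
theorem exists_H1map_inc_eq {x : H1 W.G.image} (hx : ∀ b, windingNumber (W.bandAngle b) x = 0) :
    ∃ y, H1map W.inc y = x := by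
  obtain ⟨c, hc⟩ := exists_represents x
  obtain ⟨a, n, han⟩ := W.exists_decomposition hc.bd_eq
  have hc' := hc.of_sub_mem han
  have hn : n = 0 := by
    funext b
    have h := hc'.windingNumber (W.bandAngle b)
    rw [hx, windingChain_coreComb] at h
    exact_mod_cast h.symm
  rw [hn, coreComb_apply] at hc'
  simp only [Pi.zero_apply, zero_smul, Finset.sum_const_zero, add_zero] at hc'
  -- With no cores left, the chain in `F_r` is a cycle in `G_r`, hence already in `F_r`.
  have hbd : bd _ a = 0 := push0_injective W.inc W.inc_injective (by
    rw [← bd_push1, hc'.bd_eq, map_zero])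
  obtain ⟨y, hy⟩ := exists_represents_of_bd hbd
  refine ⟨y, ((hy.push W.inc).eq_iff hc').2 ?_⟩
  rw [sub_self]
  exact zero_mem _

end VirtualBands

/-! ### Flat boundaries and independence of the coordinates. -/

/-- The boundaries of the chains that pass through the ribbon singularities with zero flux. -/
def RibbonCoordinates.flatBoundaries {F : Type*} [TopologicalSpace F] {f : F → S3}
    (κ : RibbonCoordinates f) : AddSubgroup (C0 (Set.range f)) :=
  (⨅ j, (κ.flux j).ker).map (bd (Set.range f))

theorem RibbonCoordinates.mem_flatBoundaries {F : Type*} [TopologicalSpace F] {f : F → S3}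
    {κ : RibbonCoordinates f} {x : C0 (Set.range f)} :
    x ∈ κ.flatBoundaries ↔ ∃ a, (∀ j, κ.flux j a = 0) ∧ bd _ a = x := by
  simp [flatBoundaries, AddSubgroup.mem_iInf, AddMonoidHom.mem_ker]

theorem push1_incl_self {Z : Type} [TopologicalSpace Z] {A : Set Z} (h : A ⊆ A) (c : C1 A) :
    push1 (incl h) c = c := by
  have : push1 (incl h) = AddMonoidHom.id (C1 A) := C1_hom_ext fun γ => by
    rw [push1_pathChain]; rfl
  rw [this]; rfl

theorem H1map_incl_self {Z : Type} [TopologicalSpace Z] {A : Set Z} (h : A ⊆ A) (x : H1 A) :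
    H1map (incl h) x = x := by
  obtain ⟨c, hc⟩ := exists_represents x
  have h1 := hc.push (incl h)
  rw [push1_incl_self] at h1
  exact (h1.eq_iff hc).2 (by rw [sub_self]; exact zero_mem _)

namespace RibbonSurface

variable {F : RibbonSurface.{u}} (κ κ' : RibbonCoordinates F.toFun)

theorem DH1_eq : κ.DH1 = κ'.DH1 := by
  ext x
  have h := (RibbonCoordinates.compatible_id F.smooth.continuous κ).mem_DH1_iff (μ := κ') x
  rw [H1map_incl_self] at h
  exact h.symm

theorem flatBoundaries_eq : κ.flatBoundaries = κ'.flatBoundaries := by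
  have key : ∀ κ κ' : RibbonCoordinates F.toFun, κ.flatBoundaries ≤ κ'.flatBoundaries := by
    intro κ κ' x hx
    obtain ⟨a, ha, rfl⟩ := RibbonCoordinates.mem_flatBoundaries.1 hx
    refine RibbonCoordinates.mem_flatBoundaries.2 ⟨a, fun i => ?_, rfl⟩
    have h := RibbonCoordinates.compatible_id F.smooth.continuous κ
    obtain ⟨j, hji⟩ := h.exists_arc_eq i
    obtain ⟨s, hs0, hs⟩ := h.flux_push1 hji
    have := hs a
    rw [ha, push1_incl_self] at this
    rcases hs0 with rfl | rfl <;> simpa using this.symm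
  exact le_antisymm (key _ _) (key _ _)

end RibbonSurface

namespace VirtualBands

variable {F : RibbonSurface.{u}} {κ : RibbonCoordinates F.toFun} (W : VirtualBands.{u, v} F κ)

/-! ### The boundary homomorphism -/

theorem flux_push1_inc_eq_zero_iff (a : C1 F.image) :
    (∀ i, W.coords.flux i (push1 W.inc a) = 0) ↔ ∀ j, κ.flux j a = 0 := by
  constructor
  · intro hi j
    obtain ⟨i, hji⟩ := W.compatible.arc_eq (μ := W.coords) j
    obtain ⟨s, -, hs⟩ := W.compatible.flux_push1 hji
    rw [hs]
    exact mul_eq_zero_of_right _ (hi i)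
  · intro hj i
    obtain ⟨j, hji⟩ := W.compatible.exists_arc_eq i
    obtain ⟨s, hs0, hs⟩ := W.compatible.flux_push1 hji
    have := hs a
    rw [hj] at this
    change W.coords.flux i (push1 (incl W.compatible.range_subset) a) = 0
    rcases hs0 with rfl | rfl <;> simpa using this.symm

theorem notMem_stripArc_of_mem_cutSurface {r : ℝ} (hr : 0 < r) {x : F.carrier}
    (hx : x ∈ κ.cutSurface r) (j : Fin κ.num) : x ∉ κ.stripArc j := fun h => by
  have h1 := hx j h.1
  have h2 : κ.chart j (F.toFun x) 2 = 0 := h.2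
  rw [h2, abs_zero] at h1
  linarith

/-- A band point over a ribbon singularity lies in `F_r`, hence on an attaching arc. That arc is in
the cut surface, which avoids the properly embedded arcs. -/
theorem band_notMem_stripArc (b : Fin W.num) (p : I × I) (i : Fin W.coords.num) :
    W.band b p ∉ W.coords.stripArc i := by
  intro h
  obtain ⟨j, hji⟩ := W.compatible.exists_arc_eq i
  have hm := W.coords.mem_arc_of_stripArc h
  rw [← hji] at hm
  obtain ⟨x, hx, hxq⟩ := κ.exists_stripArc_of_mem_arc hm
  obtain ⟨x', hx', he, -⟩ := W.exists_attached b (W.band_inter b p ⟨x, hxq⟩)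
  rw [← he, W.compatible.mem_stripArc_iff hji] at h
  exact notMem_stripArc_of_mem_cutSurface W.r_pos hx' j h

/-- The sawtooth functions are continuous along a band, since it avoids the properly embedded arcs.
Cores therefore do not affect whether a cycle is disoriented. -/
theorem flux_core (b : Fin W.num) (i : Fin W.coords.num) :
    W.coords.flux i (pathChain (W.core b)) = 0 := by
  refine jump_pathChain_of_continuous _ _ _ (continuous_iff_continuousAt.2 fun t => ?_)
  have h1 := W.coords.continuousAt_sawtooth W.G.smooth.continuous
    (W.band_notMem_stripArc b (t, half) i)
  exact ContinuousAt.comp (f := fun t : I => W.band b (t, half)) h1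
    (by fun_prop : Continuous fun t : I => W.band b (t, half)).continuousAt

theorem flux_coreComb (i : Fin W.coords.num) (a : C1 F.image) (n : Fin W.num → ℤ) :
    W.coords.flux i (W.coreComb (a, n)) = W.coords.flux i (push1 W.inc a) := by
  rw [coreComb_apply, map_add, map_sum]
  simp only [map_zsmul, flux_core, smul_zero, Finset.sum_const_zero, add_zero]

/-- The endpoint `e` of the core of a band, in `F`. -/
theorem exists_attachPt (b : Fin W.num) (e : Bool) : ∃ x ∈ κ.cutSurface W.r,
    W.inclusion x = W.band b (if e then 1 else 0, half) := by
  obtain ⟨x, hx, he, -⟩ := W.exists_attached b (p := (if e then 1 else 0, half)) (by cases e <;> simp)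
  exact ⟨x, hx, he⟩

/-- The endpoints of the core of a band, in `F`. -/
def attachPt (b : Fin W.num) (e : Bool) : F.carrier := (W.exists_attachPt b e).choose

theorem attachPt_mem (b : Fin W.num) (e : Bool) : W.attachPt b e ∈ κ.cutSurface W.r :=
  (W.exists_attachPt b e).choose_spec.1

theorem inclusion_attachPt (b : Fin W.num) (e : Bool) :
    W.inclusion (W.attachPt b e) = W.band b (if e then 1 else 0, half) :=
  (W.exists_attachPt b e).choose_spec.2

end VirtualBands

/-- A point of `F`, as a singular `0`-simplex of `F_r`. -/
def RibbonSurface.imagePt {F : RibbonSurface.{u}} (x : F.carrier) : C0 F.image :=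
  pt (⟨F.toFun x, x, rfl⟩ : F.image)

namespace VirtualBands

variable {F : RibbonSurface.{u}} {κ : RibbonCoordinates F.toFun} (W : VirtualBands.{u, v} F κ)

theorem push0_inc_attachPt (b : Fin W.num) (e : Bool) :
    push0 W.inc (RibbonSurface.imagePt (W.attachPt b e)) = pt (W.core b (if e then 1 else 0)) := by
  rw [RibbonSurface.imagePt, push0_pt]
  refine congrArg pt (Subtype.ext ?_)
  exact (W.toFun_inclusion _).symm.trans (congrArg W.G.toFun (W.inclusion_attachPt b e))

/-- The homomorphism that sends a band to the difference of the endpoints of its core. -/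
def bandDiff : (Fin W.num →₀ ℤ) →+ C0 F.image :=
  Finsupp.liftAddHom fun b => zmultiplesHom _
    (RibbonSurface.imagePt (W.attachPt b true) - RibbonSurface.imagePt (W.attachPt b false))

theorem bandDiff_apply (n : Fin W.num →₀ ℤ) : W.bandDiff n = ∑ b, n b •
    (RibbonSurface.imagePt (W.attachPt b true) - RibbonSurface.imagePt (W.attachPt b false)) := by
  rw [bandDiff, Finsupp.liftAddHom_apply, Finsupp.sum_fintype _ _ fun b => map_zero _]
  rfl

theorem bd_coreComb (a : C1 F.image) (n : Fin W.num →₀ ℤ) :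
    bd _ (W.coreComb (a, n)) = push0 W.inc (bd _ a + W.bandDiff n) := by
  rw [coreComb_apply, map_add, bd_push1, map_add, map_sum, bandDiff_apply, map_sum]
  congr 1
  refine Finset.sum_congr rfl fun b _ => ?_
  rw [map_zsmul, map_zsmul, map_sub, push0_inc_attachPt, push0_inc_attachPt, bd_pathChain]
  rfl

end VirtualBands

namespace VirtuallyBandedSurface

variable {F : RibbonSurface.{u}} {κ : RibbonCoordinates F.toFun}
  (W : VirtuallyBandedSurface.{u, v} F κ)

/-- Write a disoriented cycle as a chain `a` in `F_r` plus `n b` times each core. Its winding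
numbers are `n`, its flux is that of `a`, and being a cycle means that the boundary of `a` is
`-bandDiff n`. Conversely a flat chain bounded by `bandDiff n` is closed up by cores, with its sign
reversed. -/
theorem mem_range_boundaryMap_iff (n : Fin W.num →₀ ℤ) :
    n ∈ W.boundaryMap.range ↔ W.bandDiff n ∈ κ.flatBoundaries := by
  constructor
  · rintro ⟨⟨x, hx⟩, rfl⟩
    obtain ⟨c, hc⟩ := exists_represents x
    obtain ⟨a, n, han⟩ := W.exists_decomposition hc.bd_eq
    have hc' := hc.of_sub_mem han
    have hn : ∀ b, W.boundaryMap ⟨x, hx⟩ b = n b := fun b => by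
      rw [boundaryMap_apply]
      have := hc'.windingNumber (W.bandAngle b)
      rw [W.windingChain_coreComb] at this
      exact_mod_cast this
    have hflux : ∀ i, W.coords.flux i (push1 W.inc a) = 0 := fun i => by
      rw [← W.flux_coreComb i a n]
      exact (W.coords.mem_DH1_iff hc').1 hx i
    have hbd := hc'.bd_eq
    rw [show n = W.boundaryMap ⟨x, hx⟩ from (funext hn).symm, W.bd_coreComb,
      ← map_zero (push0 W.inc)] at hbd
    have := push0_injective W.inc W.inc_injective hbd
    rw [add_comm, add_eq_zero_iff_eq_neg] at this
    rw [this]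
    exact neg_mem (RibbonCoordinates.mem_flatBoundaries.2
      ⟨a, (W.flux_push1_inc_eq_zero_iff a).1 hflux, rfl⟩)
  · intro h
    obtain ⟨a, ha, hbd⟩ := RibbonCoordinates.mem_flatBoundaries.1 h
    obtain ⟨x, hx⟩ := exists_represents_of_bd (c := W.coreComb (-a, n)) (by
      rw [W.bd_coreComb, map_neg, hbd, neg_add_cancel, map_zero])
    have hmem : x ∈ W.coords.DH1 := (W.coords.mem_DH1_iff hx).2 fun i => by
      rw [W.flux_coreComb]
      exact (W.flux_push1_inc_eq_zero_iff _).2 (fun j => by rw [map_neg, ha, neg_zero]) i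
    refine ⟨⟨x, hmem⟩, Finsupp.ext fun b => ?_⟩
    rw [boundaryMap_apply]
    have := hx.windingNumber (W.bandAngle b)
    rw [W.windingChain_coreComb] at this
    exact_mod_cast this

end VirtuallyBandedSurface

/-- A preconnected subset of an open subset of a locally path-connected space lies in a path
component. -/
theorem joinedIn_of_isPreconnected {X : Type*} [TopologicalSpace X] [LocallyPathConnectedSpace X]
    {S U : Set X} (hS : _root_.IsPreconnected S) (hU : IsOpen U) (h : S ⊆ U) {x y : X} (hx : x ∈ S)
    (hy : y ∈ S) : JoinedIn U x y := by
  have hc : IsConnected (connectedComponentIn U x) := isConnected_connectedComponentIn_iff.2 (h hx)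
  have hp := (hU.connectedComponentIn.isConnected_iff_isPathConnected).1 hc
  have hsub := hS.subset_connectedComponentIn hx h
  exact (hp.joinedIn x (hsub hx) y (hsub hy)).mono (connectedComponentIn_subset _ _)

namespace RibbonSurface

variable {F : RibbonSurface.{u}} (κ : RibbonCoordinates F.toFun)

/-! ### Flat boundaries -/

/-- The immersion, as a map to its image. -/
def toImage (F : RibbonSurface.{u}) : C(F.carrier, F.image) :=
  ⟨fun x => ⟨F.toFun x, x, rfl⟩, F.smooth.continuous.subtype_mk _⟩

/-- The union of the properly embedded arcs. -/
def stripArcs : Set F.carrier := ⋃ j, κ.stripArc j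

theorem mem_stripArcs {x : F.carrier} : x ∈ stripArcs κ ↔ ∃ j, x ∈ κ.stripArc j := Set.mem_iUnion

theorem isOpen_compl_stripArcs : IsOpen (stripArcs κ)ᶜ :=
  (isClosed_iUnion_of_finite fun j => κ.isClosed_stripArc F.smooth.continuous j).isOpen_compl

variable {κ}

theorem flux_path_of_notMem {γ : C(I, F.carrier)} (h : ∀ t, γ t ∉ stripArcs κ) (j : Fin κ.num) :
    κ.flux j (pathChain (F.toImage.comp γ)) = 0 := by
  refine jump_pathChain_of_continuous _ _ _ (continuous_iff_continuousAt.2 fun t => ?_)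
  exact ContinuousAt.comp (f := γ) (κ.continuousAt_sawtooth F.smooth.continuous
    fun hj => h t ((mem_stripArcs κ).2 ⟨j, hj⟩)) γ.continuous.continuousAt

theorem flux_path_of_mem_strip {j : Fin κ.num} {γ : C(I, F.carrier)} (h : ∀ t, γ t ∈ κ.strip j) :
    κ.flux j (pathChain (F.toImage.comp γ)) =
      SignType.sign (κ.height j (F.toFun (γ 1))) - SignType.sign (κ.height j (F.toFun (γ 0))) := by
  have hb : ∀ t, F.toFun (γ t) ∈ κ.ball j := fun t => κ.mem_ball_of_mem_strip (h t)
  have hc : Continuous fun t => κ.height j (F.toFun (γ t)) :=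
    (κ.continuousOn_height j).comp_continuous (F.smooth.continuous.comp γ.continuous) hb
  have hs : ∀ t, κ.sawtooth j (F.toFun (γ t)) =
      κ.height j (F.toFun (γ t)) / 2 - SignType.sign (κ.height j (F.toFun (γ t))) :=
    fun t => if_pos (hb t)
  rw [RibbonCoordinates.flux, jump_pathChain _ _ _ ⟨_, hc.div_const 2⟩ fun t =>
    (κ.coe_sawtooth_of_mem_ball (hb t)).symm]
  change _ - (κ.sawtooth j (F.toFun (γ 1)) - κ.sawtooth j (F.toFun (γ 0))) = _
  rw [hs, hs]
  change κ.height j (F.toFun (γ 1)) / 2 - κ.height j (F.toFun (γ 0)) / 2 - _ = _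
  ring

theorem flux_path_of_mem_strip_ne {i j : Fin κ.num} (hij : i ≠ j) {γ : C(I, F.carrier)}
    (h : ∀ t, γ t ∈ κ.strip i) : κ.flux j (pathChain (F.toImage.comp γ)) = 0 := by
  refine jump_pathChain_of_continuous _ _ _ ?_
  have : (fun t => κ.sawtooth j (F.toImage (γ t) : F.image)) = fun _ => 0 :=
    funext fun t => κ.sawtooth_of_mem_ball_ne hij (κ.mem_ball_of_mem_strip (h t))
  exact this ▸ continuous_const

/-- Along a path off the properly embedded arcs all sawtooth functions are continuous, so its flux
is zero. -/
theorem imagePt_sub_mem_of_joinedIn {x y : F.carrier} (h : JoinedIn (stripArcs κ)ᶜ x y) :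
    imagePt x - imagePt y ∈ κ.flatBoundaries := by
  obtain ⟨γ, hγ⟩ := h.symm
  refine RibbonCoordinates.mem_flatBoundaries.2
    ⟨pathChain (F.toImage.comp γ.toContinuousMap), fun j => flux_path_of_notMem hγ j, ?_⟩
  rw [bd_pathChain]
  change pt (F.toImage (γ 1)) - pt (F.toImage (γ 0)) = _
  rw [γ.target, γ.source]
  rfl

theorem exists_strip_path {j : Fin κ.num} {x y : F.carrier} (hx : x ∈ κ.strip j)
    (hy : y ∈ κ.strip j) : ∃ γ : C(I, F.carrier), (∀ t, γ t ∈ κ.strip j) ∧ γ 0 = x ∧ γ 1 = y ∧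
      ∀ t : I, κ.height j (F.toFun (γ t)) =
        (1 - t) * κ.height j (F.toFun x) + t * κ.height j (F.toFun y) := by
  have hf := F.smooth.continuous
  let c : ℝ → ℝ × ℝ := fun t =>
    ((1 - t) * κ.chart j (F.toFun x) 1 + t * κ.chart j (F.toFun y) 1,
      (1 - t) * κ.height j (F.toFun x) + t * κ.height j (F.toFun y))
  refine ⟨⟨fun t : I => κ.stripMap hf j (c t), by fun_prop⟩, fun t => κ.stripMap_mem hf j _, ?_, ?_,
    fun t => ?_⟩
  · simp only [ContinuousMap.coe_mk, c, Set.Icc.coe_zero, sub_zero, one_mul, zero_mul, add_zero]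
    exact κ.stripMap_chart hf hx
  · simp only [ContinuousMap.coe_mk, c, Set.Icc.coe_one, sub_self, one_mul, zero_mul, zero_add]
    exact κ.stripMap_chart hf hy
  · simp only [ContinuousMap.coe_mk]
    rw [κ.height_stripMap]
    refine clamp_of_abs_le ?_
    have h1 := abs_le.1 (κ.chart_mem_stripModel hx).2.2
    have h2 := abs_le.1 (κ.chart_mem_stripModel hy).2.2
    change -2 ≤ κ.height j (F.toFun x) ∧ κ.height j (F.toFun x) ≤ 2 at h1
    change -2 ≤ κ.height j (F.toFun y) ∧ κ.height j (F.toFun y) ≤ 2 at h2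
    have ht := t.2
    rw [abs_le]
    constructor <;> simp only [c] <;> nlinarith [ht.1, ht.2]

theorem notMem_stripArcs_of_mem_strip {j : Fin κ.num} {x : F.carrier} (hx : x ∈ κ.strip j)
    (h : κ.height j (F.toFun x) ≠ 0) : x ∉ stripArcs κ := fun h' => by
  obtain ⟨i, hi⟩ := (mem_stripArcs κ).1 h'
  obtain rfl := κ.ball_unique (κ.mem_ball_of_mem_strip hi.1) (κ.mem_ball_of_mem_strip hx)
  exact h hi.2

/-- The height is affine along a straight path in the strip, so it does not vanish between two
heights of the same sign. -/
theorem joinedIn_of_same_side {j : Fin κ.num} {x y : F.carrier} (hx : x ∈ κ.strip j)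
    (hy : y ∈ κ.strip j) (h : 0 < κ.height j (F.toFun x) * κ.height j (F.toFun y)) :
    JoinedIn (stripArcs κ)ᶜ x y := by
  obtain ⟨γ, h1, h2, h3, h4⟩ := exists_strip_path hx hy
  refine ⟨⟨γ, h2, h3⟩, fun t => notMem_stripArcs_of_mem_strip (h1 t) ?_⟩
  change κ.height j (F.toFun (γ t)) ≠ 0
  rw [h4]
  have ht := t.2
  rcases mul_pos_iff.1 h with ⟨ha, hb⟩ | ⟨ha, hb⟩
  · rcases ht.1.eq_or_lt with h0 | h0
    · rw [← h0]; simpa using ha.ne'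
    · have := mul_pos h0 hb
      have := mul_nonneg (sub_nonneg.2 ht.2) ha.le
      linarith
  · rcases ht.1.eq_or_lt with h0 | h0
    · rw [← h0]; simpa using ha.ne
    · have := mul_pos h0 (neg_pos.2 hb)
      have := mul_nonneg (sub_nonneg.2 ht.2) (neg_pos.2 ha).le
      intro h5
      linarith

/-- The paths from `p` to the two sides of the arc have opposite fluxes, so their sum is flat
although neither of them is. This is the chain-level trace of the disoriented crossing rule. -/
theorem imagePt_sides_mem {j : Fin κ.num} {p x y : F.carrier} (hp : p ∈ κ.stripArc j)
    (hx : x ∈ κ.strip j) (hy : y ∈ κ.strip j)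
    (h : κ.height j (F.toFun x) * κ.height j (F.toFun y) < 0) :
    (imagePt x - imagePt p) + (imagePt y - imagePt p) ∈ κ.flatBoundaries := by
  obtain ⟨γ, h1, h2, h3, -⟩ := exists_strip_path hp.1 hx
  obtain ⟨γ', h1', h2', h3', -⟩ := exists_strip_path hp.1 hy
  refine RibbonCoordinates.mem_flatBoundaries.2
    ⟨pathChain (F.toImage.comp γ) + pathChain (F.toImage.comp γ'), fun i => ?_, ?_⟩
  · rw [map_add]
    by_cases hij : j = i
    · subst hij
      rw [flux_path_of_mem_strip h1, flux_path_of_mem_strip h1', h2, h3, h2', h3', hp.2]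
      rcases mul_neg_iff.1 h with ⟨ha, hb⟩ | ⟨ha, hb⟩
      · simp [sign_pos ha, sign_neg hb]
      · simp [sign_pos hb, sign_neg ha]
    · rw [flux_path_of_mem_strip_ne hij h1, flux_path_of_mem_strip_ne hij h1', add_zero]
  · rw [map_add, bd_pathChain, bd_pathChain]
    change pt (F.toImage (γ 1)) - pt (F.toImage (γ 0)) +
      (pt (F.toImage (γ' 1)) - pt (F.toImage (γ' 0))) = _
    rw [h2, h3, h2', h3']
    rfl

theorem cutSurface_subset {r : ℝ} (hr : 0 < r) : κ.cutSurface r ⊆ (stripArcs κ)ᶜ := fun x hx h => by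
  obtain ⟨j, hj⟩ := (mem_stripArcs κ).1 h
  exact VirtualBands.notMem_stripArc_of_mem_cutSurface hr hx j hj

/-- The points off the properly embedded arcs are joined to the cut surface. -/
theorem exists_joinedIn_cutSurface {r : ℝ} (hr : 0 < r) (hr' : r ≤ 1) {x : F.carrier}
    (hx : x ∉ stripArcs κ) : ∃ y ∈ κ.cutSurface r, JoinedIn (stripArcs κ)ᶜ x y := by
  by_cases hc : x ∈ κ.cutSurface r
  · exact ⟨x, hc, JoinedIn.refl hx⟩
  · simp only [RibbonCoordinates.cutSurface, Set.mem_ofPred_eq, not_forall, not_le] at hc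
    obtain ⟨j, hj, hlt⟩ := hc
    have h0 : κ.height j (F.toFun x) ≠ 0 := fun h => hx ((mem_stripArcs κ).2 ⟨j, hj, h⟩)
    have hf := F.smooth.continuous
    have key : ∀ s : ℝ, |s| = 1 → 0 < κ.height j (F.toFun x) * s →
        ∃ y ∈ κ.cutSurface r, JoinedIn (stripArcs κ)ᶜ x y := by
      intro s hs hpos
      have hsr : |s * r| = r := by rw [abs_mul, hs, one_mul, abs_of_pos hr]
      have hh : κ.height j (F.toFun (κ.stripMap hf j (0, s * r))) = s * r := by
        rw [κ.height_stripMap]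
        exact clamp_of_abs_le (by rw [hsr]; linarith)
      -- The point at height `±r` on the same side as `x` lies on the boundary of the removed
      -- neighbourhood, hence still in the cut surface.
      refine ⟨κ.stripMap hf j (0, s * r), fun i hi => ?_,
        joinedIn_of_same_side hj (κ.stripMap_mem hf j _) ?_⟩
      · obtain rfl := κ.ball_unique (κ.mem_ball_of_mem_strip hi)
          (κ.mem_ball_of_mem_strip (κ.stripMap_mem hf j _))
        change r ≤ |κ.height i (F.toFun (κ.stripMap hf i (0, s * r)))|
        rw [hh, hsr]
      · rw [hh, ← mul_assoc]
        exact mul_pos hpos hr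
    rcases lt_or_gt_of_ne h0 with h | h
    · exact key (-1) (by simp) (by linarith)
    · exact key 1 (by simp) (by linarith)

end RibbonSurface

namespace VirtualBands

open RibbonSurface

variable {F : RibbonSurface.{u}} {κ : RibbonCoordinates F.toFun} (W : VirtualBands.{u, v} F κ)

/-! ### Points linked by bands -/

/-- Flat boundaries and differences of the endpoints of bands. -/
def linkGroup : AddSubgroup (C0 F.image) := κ.flatBoundaries ⊔ W.bandDiff.range

/-- Two points of `F` are linked if their difference is a flat boundary, up to bands. -/
def Linked (x y : F.carrier) : Prop := imagePt x - imagePt y ∈ W.linkGroup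

variable {W}

theorem Linked.symm {x y : F.carrier} (h : W.Linked x y) : W.Linked y x := by
  have := neg_mem h
  rwa [neg_sub] at this

theorem Linked.trans {x y z : F.carrier} (h : W.Linked x y) (h' : W.Linked y z) :
    W.Linked x z := by
  have := add_mem h h'
  rwa [sub_add_sub_cancel] at this

variable (W)

theorem linked_of_joinedIn {x y : F.carrier} (h : JoinedIn (stripArcs κ)ᶜ x y) : W.Linked x y :=
  AddSubgroup.mem_sup_left (imagePt_sub_mem_of_joinedIn h)

/-- The cut surface lies in the open complement of the properly embedded arcs. There connectedness
gives paths, which have zero flux. -/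
theorem linked_of_isPreconnected {S : Set F.carrier} (hS : _root_.IsPreconnected S)
    (h : S ⊆ κ.cutSurface W.r) {x y : F.carrier} (hx : x ∈ S) (hy : y ∈ S) : W.Linked x y :=
  W.linked_of_joinedIn (joinedIn_of_isPreconnected hS (isOpen_compl_stripArcs κ)
    (h.trans (cutSurface_subset W.r_pos)) hx hy)

theorem linked_attachPt (b : Fin W.num) : W.Linked (W.attachPt b true) (W.attachPt b false) := by
  refine AddSubgroup.mem_sup_right ⟨Finsupp.single b 1, ?_⟩
  rw [bandDiff, Finsupp.liftAddHom_apply_single]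
  simp

theorem attachPt_mem_attachingArc (b : Fin W.num) (e : Bool) :
    W.attachPt b e ∈ W.attachingArc b (if e then 1 else 0) := ⟨half, W.inclusion_attachPt b e⟩

theorem exists_attachPt_mem {b : Fin W.num} {C : Set F.carrier} (h : W.IsAttachedTo b C) :
    ∃ e, W.attachPt b e ∈ C := by
  rcases h with h | h
  · exact ⟨false, h (W.attachPt_mem_attachingArc b false)⟩
  · exact ⟨true, h (W.attachPt_mem_attachingArc b true)⟩

theorem attachingArc_subset (b : Fin W.num) (e : Bool) :
    W.attachingArc b (if e then 1 else 0) ⊆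
      connectedComponentIn (κ.cutSurface W.r) (W.attachPt b e) := by
  have hend : (if e then 1 else 0 : I) = 0 ∨ (if e then 1 else 0 : I) = 1 := by cases e <;> simp
  have hsub : W.attachingArc b (if e then 1 else 0) ⊆ κ.cutSurface W.r := by
    rintro x ⟨t, ht⟩
    obtain ⟨x', hx', he, -⟩ := W.exists_attached b (p := (_, t)) hend
    rwa [W.inclusion_injective (ht.trans he.symm)]
  refine _root_.IsPreconnected.subset_connectedComponentIn ?_ (W.attachPt_mem_attachingArc b e) hsub
  have : W.attachingArc b (if e then 1 else 0) =
      W.inclusion ⁻¹' Set.range fun t : I => W.band b (if e then 1 else 0, t) := by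
    ext x
    exact exists_congr fun t => eq_comm
  rw [this]
  refine (isPreconnected_range (by fun_prop)).preimage_of_isClosedMap W.inclusion_injective
    W.inclusion.continuous.isClosedMap ?_
  rintro _ ⟨t, rfl⟩
  obtain ⟨x', -, he, -⟩ := W.exists_attached b (p := (_, t)) hend
  exact ⟨x', he⟩

/-- The component of the cut surface to which an end of a band is attached. -/
def attachVertex (b : Fin W.num) (e : Bool) :
    {C : Set F.carrier // κ.IsCutComponent W.r C ∧ ∃ b, W.IsAttachedTo b C} :=
  ⟨connectedComponentIn (κ.cutSurface W.r) (W.attachPt b e),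
    ⟨_, W.attachPt_mem b e, rfl⟩, b, by
      have h := W.attachingArc_subset b e
      cases e
      · exact Or.inl h
      · exact Or.inr h⟩

variable {W}

theorem linked_of_isCutComponent {C : Set F.carrier} (hC : κ.IsCutComponent W.r C) {x y : F.carrier}
    (hx : x ∈ C) (hy : y ∈ C) : W.Linked x y := by
  obtain ⟨z, -, rfl⟩ := hC
  exact W.linked_of_isPreconnected isPreconnected_connectedComponentIn
    (connectedComponentIn_subset _ _) hx hy

/-- Each edge of the band graph moves along a band, and between bands one moves inside a component
of the cut surface. -/
theorem linked_of_reachable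
    {C C' : {C : Set F.carrier // κ.IsCutComponent W.r C ∧ ∃ b, W.IsAttachedTo b C}}
    (h : W.bandGraph.Reachable C C') : ∀ x ∈ C.1, ∀ y ∈ C'.1, W.Linked x y := by
  obtain ⟨w⟩ := h
  induction w with
  | @nil C => exact fun x hx y hy => linked_of_isCutComponent C.2.1 hx hy
  | @cons C D C' hadj _ ih =>
    intro x hx y hy
    have key : ∃ z ∈ C.1, ∃ z' ∈ D.1, W.Linked z z' := by
      rw [bandGraph, SimpleGraph.fromRel_adj] at hadj
      obtain ⟨-, ⟨b, h0, h1⟩ | ⟨b, h0, h1⟩⟩ := hadj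
      · exact ⟨_, h0 (W.attachPt_mem_attachingArc b false), _, h1 (W.attachPt_mem_attachingArc b true),
          (W.linked_attachPt b).symm⟩
      · exact ⟨_, h1 (W.attachPt_mem_attachingArc b true), _, h0 (W.attachPt_mem_attachingArc b false),
          W.linked_attachPt b⟩
    obtain ⟨z, hz, z', hz', hzz'⟩ := key
    exact ((linked_of_isCutComponent C.2.1 hx hz).trans hzz').trans (ih z' hz' y hy)

theorem linked_attachPts (hc : W.bandGraph.Preconnected) (b b' : Fin W.num) (e e' : Bool) :
    W.Linked (W.attachPt b e) (W.attachPt b' e') :=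
  linked_of_reachable (hc (W.attachVertex b e) (W.attachVertex b' e')) _
    (mem_connectedComponentIn (W.attachPt_mem b e)) _ (mem_connectedComponentIn (W.attachPt_mem b' e'))

theorem imagePt_eq {x y : F.carrier} (h : F.toFun x = F.toFun y) : imagePt x = imagePt y :=
  congrArg pt (Subtype.ext h)

/-- The points on both sides of a properly embedded arc are linked to the same points, if the points
of the interior arc are. -/
theorem linked_iff_of_mem_strip {j : Fin κ.num} {x₀ p : F.carrier} (hp : p ∈ κ.stripArc j)
    (hlink : W.Linked p x₀) {x y : F.carrier} (hx : x ∈ κ.strip j) (hy : y ∈ κ.strip j)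
    (hx0 : x ∉ stripArcs κ) (hy0 : y ∉ stripArcs κ) : W.Linked x x₀ ↔ W.Linked y x₀ := by
  have h1 : κ.height j (F.toFun x) ≠ 0 := fun h => hx0 ((mem_stripArcs κ).2 ⟨j, hx, h⟩)
  have h2 : κ.height j (F.toFun y) ≠ 0 := fun h => hy0 ((mem_stripArcs κ).2 ⟨j, hy, h⟩)
  rcases lt_or_gt_of_ne (mul_ne_zero h1 h2) with h | h
  · have hs : (imagePt x - imagePt p) + (imagePt y - imagePt p) ∈ W.linkGroup :=
      AddSubgroup.mem_sup_left (imagePt_sides_mem hp hx hy h)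
    -- This is `(x - p) + (y - p)` plus twice `p - x₀`, so the two differences are negatives of each
    -- other modulo `linkGroup`.
    have hsum : (imagePt x - imagePt x₀) + (imagePt y - imagePt x₀) ∈ W.linkGroup := by
      have := add_mem (add_mem hs hlink) hlink
      convert this using 1
      abel
    exact ⟨fun h => (add_mem_cancel_left h).1 hsum, fun h => (add_mem_cancel_right h).1 hsum⟩
  · have := W.linked_of_joinedIn (joinedIn_of_same_side hx hy h)
    exact ⟨this.symm.trans, this.trans⟩

theorem interiorArc_subset_cutSurface {r : ℝ} (j : Fin κ.num) : κ.interiorArc j ⊆ κ.cutSurface r :=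
  fun _ hx _ hi => absurd hi (κ.notMem_strip_of_mem_square hx.1)

/-- If a virtual band is attached to every component of `F`, and the interior arcs are linked to
them, then all points are linked. -/
theorem linked_of_attached {x₀ : F.carrier} (hb : ∀ b e, W.Linked (W.attachPt b e) x₀)
    (hi : ∀ j, ∀ x ∈ κ.interiorArc j, W.Linked x x₀)
    (hatt : ∀ x : F.carrier, ∃ b, W.IsAttachedTo b (connectedComponent x)) {x : F.carrier}
    (hx : x ∉ stripArcs κ) : W.Linked x x₀ := by
  have hf := F.smooth.continuous
  have hp : ∀ j, ∃ p ∈ κ.stripArc j, W.Linked p x₀ := by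
    intro j
    obtain ⟨q, hq⟩ := κ.arc_nonempty j
    obtain ⟨p, hp, hpq⟩ := κ.exists_stripArc_of_mem_arc hq
    obtain ⟨p', hp', hpq'⟩ := κ.exists_interiorArc_of_mem_arc hq
    -- The properly embedded arc and the interior arc have the same image, so linking passes from
    -- the latter to the former.
    refine ⟨p, hp, ?_⟩
    rw [Linked, imagePt_eq (hpq.trans hpq'.symm)]
    exact hi j p' hp'
  -- `P` extends linkedness across the properly embedded arcs: a point of such an arc satisfies it
  -- if some nearby point of the strip is linked. This makes it locally constant on `F`.
  let P : F.carrier → Prop := fun x => ∃ y, y ∉ stripArcs κ ∧ W.Linked y x₀ ∧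
    (y = x ∨ ∃ j, x ∈ κ.stripArc j ∧ y ∈ κ.openStrip j)
  have hP : ∀ x, x ∉ stripArcs κ → (P x ↔ W.Linked x x₀) := by
    intro x hx
    constructor
    · rintro ⟨y, -, hy, rfl | ⟨j, hj, -⟩⟩
      · exact hy
      · exact absurd ((mem_stripArcs κ).2 ⟨j, hj⟩) hx
    · exact fun h => ⟨x, hx, h, Or.inl rfl⟩
  -- On an open strip `P` is constant, because the two sides are linked simultaneously.
  have hPs : ∀ j, ∀ x ∈ κ.openStrip j,
      (P x ↔ ∃ y ∈ κ.openStrip j, y ∉ stripArcs κ ∧ W.Linked y x₀) := by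
    intro j x hx
    by_cases hxs : x ∈ stripArcs κ
    · have hj : ∀ i, x ∈ κ.stripArc i → i = j := fun i hi =>
        κ.ball_unique (κ.mem_ball_of_mem_strip hi.1) (κ.mem_ball_of_mem_strip hx.1)
      obtain ⟨i, hi⟩ := (mem_stripArcs κ).1 hxs
      obtain rfl := hj i hi
      constructor
      · rintro ⟨y, hy, hl, rfl | ⟨k, hk, hyk⟩⟩
        · exact absurd hxs hy
        · obtain rfl := hj k hk
          exact ⟨y, hyk, hy, hl⟩
      · exact fun ⟨y, hy, hys, hl⟩ => ⟨y, hys, hl, Or.inr ⟨i, hi, hy⟩⟩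
    · rw [hP x hxs]
      constructor
      · exact fun h => ⟨x, hx, hxs, h⟩
      · rintro ⟨y, hy, hys, hl⟩
        obtain ⟨p, hp, hpl⟩ := hp j
        exact (linked_iff_of_mem_strip hp hpl hx.1 hy.1 hxs hys).2 hl
  have hloc : ∀ x, ∃ U, IsOpen U ∧ x ∈ U ∧ ∀ y ∈ U, (P y ↔ P x) := by
    intro x
    by_cases hxs : x ∈ stripArcs κ
    · obtain ⟨j, hj⟩ := (mem_stripArcs κ).1 hxs
      have hxo := κ.stripArc_subset_openStrip j hj
      exact ⟨κ.openStrip j, κ.isOpen_openStrip hf j, hxo, fun y hy =>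
        (hPs j y hy).trans (hPs j x hxo).symm⟩
    · refine ⟨pathComponentIn (stripArcs κ)ᶜ x, (isOpen_compl_stripArcs κ).pathComponentIn x,
        mem_pathComponentIn_self hxs, fun y hy => ?_⟩
      have hl := W.linked_of_joinedIn hy
      rw [hP x hxs, hP y (pathComponentIn_subset hy)]
      exact ⟨hl.trans, hl.symm.trans⟩
  have hclopen : IsClopen ({y | P y ↔ P x} : Set F.carrier) := by
    constructor
    · rw [← isOpen_compl_iff, isOpen_iff_forall_mem_open]
      intro y hy
      obtain ⟨U, hU, hyU, h⟩ := hloc y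
      exact ⟨U, fun z hz hz' => hy ((h z hz).symm.trans hz'), hU, hyU⟩
    · rw [isOpen_iff_forall_mem_open]
      intro y hy
      obtain ⟨U, hU, hyU, h⟩ := hloc y
      exact ⟨U, fun z hz => (h z hz).trans hy, hU, hyU⟩
  -- A locally constant predicate is constant on the component of `x`, which contains an end of a
  -- band.
  obtain ⟨b, hb'⟩ := hatt x
  obtain ⟨e, he⟩ := W.exists_attachPt_mem hb'
  have h1 : P (W.attachPt b e) ↔ P x := hclopen.connectedComponent_subset Iff.rfl he
  rw [hP _ (cutSurface_subset W.r_pos (W.attachPt_mem b e)), hP x hx] at h1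
  exact h1.1 (hb b e)

/-- All points are linked by an admissible collection of virtual bands. -/
theorem IsAdmissible.linked (h : W.IsAdmissible) {x y : F.carrier} (hx : x ∉ stripArcs κ)
    (hy : y ∉ stripArcs κ) : W.Linked x y := by
  rcases h with h | ⟨-, h2, h3, h4⟩
  · obtain ⟨x', hx', hxx'⟩ := exists_joinedIn_cutSurface W.r_pos W.r_le hx
    obtain ⟨y', hy', hyy'⟩ := exists_joinedIn_cutSurface W.r_pos W.r_le hy
    exact ((W.linked_of_joinedIn hxx').trans
      (W.linked_of_isPreconnected h subset_rfl hx' hy')).trans (W.linked_of_joinedIn hyy').symm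
  -- The condition on the components of `F` supplies at least one band, whose end serves as base
  -- point.
  · obtain ⟨b₀, -⟩ := h4 x
    have hb : ∀ b e, W.Linked (W.attachPt b e) (W.attachPt b₀ true) := fun b e =>
      linked_attachPts h3 b b₀ e true
    have hi : ∀ j, ∀ x ∈ κ.interiorArc j, W.Linked x (W.attachPt b₀ true) := by
      intro j x hx
      have hsub := (κ.isPreconnected_interiorArc F.smooth.continuous j).subset_connectedComponentIn
        hx (interiorArc_subset_cutSurface (r := W.r) j)
      have hC : κ.IsCutComponent W.r (connectedComponentIn (κ.cutSurface W.r) x) :=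
        ⟨x, interiorArc_subset_cutSurface j hx, rfl⟩
      obtain ⟨b, hb'⟩ := h2 _ hC ⟨j, hsub⟩
      obtain ⟨e, he⟩ := W.exists_attachPt_mem hb'
      exact (linked_of_isCutComponent hC (hsub hx) he).trans (hb b e)
    exact (linked_of_attached hb hi h4 hx).trans (linked_of_attached hb hi h4 hy).symm

end VirtualBands

/-! ### The cokernel of the boundary homomorphism. -/

/-- The subgroup generated by the differences of points. -/
def differences (X : Type) [TopologicalSpace X] : AddSubgroup (C0 X) :=
  AddSubgroup.closure {c | ∃ x y, c = pt x - pt y}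

theorem pt_sub_pt_mem {X : Type} [TopologicalSpace X] (x y : X) : pt x - pt y ∈ differences X :=
  AddSubgroup.subset_closure ⟨x, y, rfl⟩

namespace VirtualBands

variable {F : RibbonSurface.{u}} {κ : RibbonCoordinates F.toFun} {W : VirtualBands.{u, v} F κ}

theorem bandDiff_mem (n : Fin W.num →₀ ℤ) : W.bandDiff n ∈ differences F.image := by
  rw [bandDiff_apply]
  exact sum_mem fun b _ => zsmul_mem (pt_sub_pt_mem _ _) _

/-- Every point of `F_r` has a preimage off the properly embedded arcs, and such preimages are
linked. -/
theorem IsAdmissible.differences_le (h : W.IsAdmissible) :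
    differences F.image ≤ κ.flatBoundaries ⊔ W.bandDiff.range := by
  rw [differences, AddSubgroup.closure_le]
  rintro _ ⟨q, q', rfl⟩
  obtain ⟨x, hx, hxq⟩ := κ.exists_eq_of_mem_range q
  obtain ⟨y, hy, hyq⟩ := κ.exists_eq_of_mem_range q'
  have := h.linked (x := x) (y := y) (fun h => by
    obtain ⟨j, hj⟩ := (RibbonSurface.mem_stripArcs κ).1 h
    exact hx j hj) (fun h => by
    obtain ⟨j, hj⟩ := (RibbonSurface.mem_stripArcs κ).1 h
    exact hy j hj)
  have e1 : RibbonSurface.imagePt x = pt q := congrArg pt (Subtype.ext hxq)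
  have e2 : RibbonSurface.imagePt y = pt q' := congrArg pt (Subtype.ext hyq)
  rw [Linked, e1, e2] at this
  exact this

end VirtualBands

namespace VirtuallyBandedSurface

variable {F : RibbonSurface.{u}} {κ : RibbonCoordinates F.toFun}
  (W : VirtuallyBandedSurface.{u, v} F κ)

/-- The cokernel of the boundary homomorphism is the group of differences of points modulo flat
boundaries. -/
theorem exists_cokernel (N : AddSubgroup (C0 F.image)) (hN : κ.flatBoundaries = N) :
    ∃ ψ : (Fin W.num →₀ ℤ) →+ differences F.image ⧸ N.addSubgroupOf (differences F.image),
      Function.Surjective ψ ∧ ∀ n, ψ n = 0 ↔ n ∈ W.boundaryMap.range := by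
  subst hN
  refine ⟨(QuotientAddGroup.mk' _).comp (W.bandDiff.codRestrict (differences F.image)
    VirtualBands.bandDiff_mem), fun d => ?_, fun n => ?_⟩
  · obtain ⟨⟨d, hd⟩, rfl⟩ := QuotientAddGroup.mk'_surjective _ d
    obtain ⟨x, hx, _, ⟨n, rfl⟩, rfl⟩ := AddSubgroup.mem_sup.1 (W.admissible.differences_le hd)
    refine ⟨n, (QuotientAddGroup.eq).2 ?_⟩
    rw [AddSubgroup.mem_addSubgroupOf]
    change -W.bandDiff n + (x + W.bandDiff n) ∈ _
    rwa [neg_add_eq_sub, add_sub_cancel_right]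
  · rw [mem_range_boundaryMap_iff, AddMonoidHom.comp_apply, QuotientAddGroup.mk'_apply,
      QuotientAddGroup.eq_zero_iff, AddSubgroup.mem_addSubgroupOf]
    rfl

end VirtuallyBandedSurface

/-! ### The homology of the disoriented chain complex -/

/-- Two quotients of a group by the same subgroup are isomorphic. -/
theorem exists_addEquiv_of_ker_eq {A B C : Type*} [AddCommGroup A] [AddCommGroup B] [AddCommGroup C]
    {f : A →+ B} {g : A →+ C} (hf : Function.Surjective f) (hg : Function.Surjective g)
    (h : ∀ a, f a = 0 ↔ g a = 0) : ∃ e : B ≃+ C, ∀ a, e (f a) = g a := by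
  have hk : f.ker = g.ker := AddSubgroup.ext h
  refine ⟨(QuotientAddGroup.quotientKerEquivOfSurjective f hf).symm.trans
    ((QuotientAddGroup.quotientAddEquivOfEq hk).trans
      (QuotientAddGroup.quotientKerEquivOfSurjective g hg)), fun a => ?_⟩
  have : (QuotientAddGroup.quotientKerEquivOfSurjective f hf).symm (f a) = (a : A ⧸ f.ker) := by
    rw [AddEquiv.symm_apply_eq]
    rfl
  rw [AddEquiv.trans_apply, this]
  rfl

namespace VirtuallyBandedSurface

variable {F : RibbonSurface.{u}} {κ : RibbonCoordinates F.toFun}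
  (W : VirtuallyBandedSurface.{u, v} F κ)

/-- The target depends only on `F_r` and `N`. Passing `N` with an equation, instead of
`κ.flatBoundaries`, lets two systems of coordinates share the same quotient. -/
theorem exists_homology_zero (N : AddSubgroup (C0 F.image)) (hN : κ.flatBoundaries = N) :
    Nonempty (W.complex.homology 0 ≃+
      differences F.image ⧸ N.addSubgroupOf (differences F.image)) := by
  obtain ⟨ψ, hψ, hker⟩ := W.exists_cokernel N hN
  obtain ⟨e, -⟩ := exists_addEquiv_of_ker_eq (f := (W.complex.homologyπ 0).hom)
    (g := AddMonoidHom.comp ψ (W.complex.iCycles 0).hom) (homologyπ_surjective _ _) (fun d => by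
      obtain ⟨n, rfl⟩ := hψ d
      -- By convention `next 0 = 0` in `ComplexShape.down ℕ`, and `d 0 0` is zero, so every
      -- `0`-chain is a cycle.
      obtain ⟨z, hz⟩ := exists_cycle W.complex (i := 0) (j := 0) (by simp) n rfl
      exact ⟨z, congrArg ψ hz⟩) fun z =>
      (homologyπ_eq_zero_iff W.complex (j := 1) (by simp) z).trans (hker _).symm
  exact ⟨e⟩

theorem cycleClass_injective : Function.Injective W.cycleClass := fun _ _ h =>
  iCycles_injective _ _ (Subtype.ext h)

theorem boundaryMap_iCycles (z : W.complex.cycles 1) :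
    W.boundaryMap ((W.complex.iCycles 1).hom z) = 0 :=
  congrArg (fun f => f.hom z) (W.complex.iCycles_d 1 0)

/-- The class stays disoriented in `G_r` by the flux criterion, and it does not wind around any band
because the band angles vanish on `F_r`. -/
theorem exists_cycleClass_eq (x : κ.DH1) : ∃ z, W.cycleClass z = W.inclusionMap x := by
  have hx : W.inclusionMap x ∈ W.coords.DH1 :=
    (W.compatible.mem_DH1_iff (μ := W.coords) (x : H1 F.image)).2 x.2
  obtain ⟨z, hz⟩ := exists_cycle W.complex (i := 1) (j := 0) (by simp)
    (⟨W.inclusionMap x, hx⟩ : W.coords.DH1) (by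
      change W.boundaryMap ⟨W.inclusionMap x, hx⟩ = 0
      refine Finsupp.ext fun b => ?_
      rw [boundaryMap_apply]
      obtain ⟨c, hc⟩ := exists_represents (x : H1 F.image)
      have h := (hc.push W.inc).windingNumber (W.bandAngle b)
      have h2 := W.windingChain_coreComb b c 0
      rw [W.coreComb_apply] at h2
      simp only [Pi.zero_apply, zero_smul, Finset.sum_const_zero, add_zero, Int.cast_zero] at h2
      rw [h2] at h
      exact_mod_cast h)
  exact ⟨z, congrArg Subtype.val hz⟩

/-- A class in the kernel of the boundary map has zero winding numbers, so it comes from `H₁(F_r)`;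
the flux criterion, read backwards, puts the preimage in `DH₁(F_r)`. -/
theorem exists_inclusionMap_eq (z : W.complex.cycles 1) :
    ∃ x : κ.DH1, W.inclusionMap x = W.cycleClass z := by
  obtain ⟨y, hy⟩ := W.exists_H1map_inc_eq (x := W.cycleClass z) fun b => by
    have h := DFunLike.congr_fun (W.boundaryMap_iCycles z) b
    exact (W.boundaryMap_apply _ b).symm.trans h
  refine ⟨⟨y, (W.compatible.mem_DH1_iff (μ := W.coords) y).1 ?_⟩, hy⟩
  change H1map W.inc y ∈ _
  rw [hy]
  exact ((W.complex.iCycles 1).hom z : W.coords.DH1).2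

/-- The group in degree two is trivial, so homology in degree one is the group of cycles. -/
theorem homologyπ_one_injective : Function.Injective (W.complex.homologyπ 1).hom := by
  rw [injective_iff_map_eq_zero]
  intro z hz
  obtain ⟨y, hy⟩ := (homologyπ_eq_zero_iff W.complex (i := 1) (j := 2) (by simp) z).1 hz
  refine iCycles_injective _ _ ?_
  rw [map_zero, ← hy]
  rfl

/-- The inclusion induces an isomorphism of `DH₁(F_r)` and the first homology of the disoriented chain
complex. -/
theorem existsUnique_homology_one : ∃! e : κ.DH1 ≃+ W.complex.homology 1,
    ∀ x : κ.DH1, ∃ z : W.complex.cycles 1,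
      W.cycleClass z = W.inclusionMap x ∧ (W.complex.homologyπ 1).hom z = e x := by
  choose z hz using W.exists_cycleClass_eq
  have hadd : ∀ z z', W.cycleClass (z + z') = W.cycleClass z + W.cycleClass z' := fun z z' =>
    (congrArg W.coords.DH1.subtype (map_add (W.complex.iCycles 1).hom z z')).trans (map_add _ _ _)
  -- The chosen cycles depend additively on the class because `cycleClass` is injective; the same
  -- injectivity gives uniqueness at the end.
  let Z : κ.DH1 →+ W.complex.cycles 1 := AddMonoidHom.mk' z fun x y =>
    W.cycleClass_injective (by
      rw [hadd, hz, hz, hz, AddSubgroup.coe_add, map_add])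
  have hbij : Function.Bijective ((W.complex.homologyπ 1).hom.comp Z) := by
    refine ⟨W.homologyπ_one_injective.comp fun x y h => ?_, fun y => ?_⟩
    · have h' := congrArg W.cycleClass (show z x = z y from h)
      rw [hz, hz] at h'
      exact Subtype.ext (W.H1map_inc_injective h')
    · obtain ⟨w, rfl⟩ := homologyπ_surjective W.complex 1 y
      obtain ⟨x, hx⟩ := W.exists_inclusionMap_eq w
      refine ⟨x, congrArg (W.complex.homologyπ 1).hom (W.cycleClass_injective (a₁ := z x) ?_)⟩
      rw [hz, hx]
  refine ⟨AddEquiv.ofBijective _ hbij, fun x => ⟨z x, hz x, rfl⟩, fun e he => ?_⟩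
  refine AddEquiv.ext fun x => ?_
  obtain ⟨w, hw, hwe⟩ := he x
  rw [← hwe, W.cycleClass_injective (hw.trans (hz x).symm)]
  rfl

theorem subsingleton_homology (n : ℕ) : Subsingleton (W.complex.homology (n + 2)) := by
  refine ⟨fun x y => ?_⟩
  obtain ⟨z, rfl⟩ := homologyπ_surjective W.complex (n + 2) x
  obtain ⟨w, rfl⟩ := homologyπ_surjective W.complex (n + 2) y
  exact congrArg _ (iCycles_injective _ _ (Subsingleton.elim (α := PUnit) _ _))

/-- The homology of the disoriented chain complex does not depend on the choices. -/
theorem nonempty_homology_iso {κ' : RibbonCoordinates F.toFun}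
    (W' : VirtuallyBandedSurface.{u, w} F κ')
    (n : ℕ) : Nonempty (W.complex.homology n ≅ W'.complex.homology n) := by
  suffices Nonempty (W.complex.homology n ≃+ W'.complex.homology n) from
    this.map fun e => e.toAddCommGrpIso
  match n with
  | 0 =>
    obtain ⟨e⟩ := W.exists_homology_zero _ rfl
    obtain ⟨e'⟩ := W'.exists_homology_zero _ (RibbonSurface.flatBoundaries_eq κ' κ)
    exact ⟨e.trans e'.symm⟩
  | 1 =>
    obtain ⟨e, -⟩ := W.existsUnique_homology_one.exists
    obtain ⟨e', -⟩ := W'.existsUnique_homology_one.exists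
    exact ⟨e.symm.trans ((AddEquiv.addSubgroupCongr (RibbonSurface.DH1_eq κ κ')).trans e')⟩
  | n + 2 =>
    have := W.subsingleton_homology n
    have := W'.subsingleton_homology n
    exact ⟨⟨⟨fun _ => 0, fun _ => 0, fun _ => Subsingleton.elim _ _, fun _ => Subsingleton.elim _ _⟩,
      fun _ _ => Subsingleton.elim _ _⟩⟩

end VirtuallyBandedSurface

end

end DisorientedHomology

theorem mainTheorem8 (F : RibbonSurface) (κ : RibbonCoordinates F.toFun)
    (W : VirtuallyBandedSurface F κ) :
    (∀ (κ' : RibbonCoordinates F.toFun) (W' : VirtuallyBandedSurface F κ') (n : ℕ),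
      Nonempty (W.complex.homology n ≅ W'.complex.homology n)) ∧
    (∃! e : κ.DH1 ≃+ W.complex.homology 1,
      ∀ x : κ.DH1, ∃ z : W.complex.cycles 1,
        W.cycleClass z = W.inclusionMap x ∧ (W.complex.homologyπ 1).hom z = e x) := by
  exact ⟨fun _ W' n => W.nonempty_homology_iso W' n, W.existsUnique_homology_one⟩
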